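/- Let $n\ge 1$. Let $L$ be the lattice of integral vectors of $V=\{v=(v_0,\dots,v_n,v_{n+1})\in\mathbb C^{n+2}:\ v_0+\dots+v_n=0\}\cong\mathbb C^{n+1}$, with the bilinear form $\langle v,w\rangle=\sum_{i=0}^n v_iw_i-n(n+1)v_{n+1}w_{n+1}$, and let $\Omega=\mathbb C\oplus V\oplus\mathbb H\ni(u,v,\tau)$. The Jacobi group $\mathcal J(\tilde A_n)$ is the group of transformations of $\Omega$ generated by * the permutations $w\in S_{n+1}$ of $v_0,\dots,v_n$: $w(u,v,\tau)=(u,wv,\tau)$; * the translations $(\lambda,\mu,k)\in L\times L\times\mathbb Z$: $(u,v,\tau)\mapsto\big(u-\langle\lambda,v\rangle-\tfrac12\langle\lambda,\lambda\rangle\tau+k,\ v+\lambda\tau+\mu,\ \tau\big)$; * $\gamma=\begin{pmatrix}a&b\\c&d\end{pmatrix}\in SL_2(\mathbb Z)$: $(u,v,\tau)\mapsto\Big(u+\frac{c\langle v,v\rangle}{2(c\tau+d)},\ \frac{v}{c\tau+d},\ \frac{a\tau+b}{c\tau+d}\Big)$. The orbit space $\Omega/\mathcal J(\tilde A_n)$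 carries the quotient topology, and a function on an open subset of it is holomorphic if its pull-back to $\Omega$ is holomorphic. The Hurwitz space $H_{1,n-1,0}$ is the set of pairs $(C,\lambda)$, where $C=\mathbb C/\Lambda$ is a complex torus and $\lambda:C\to\mathbb{CP}^1$ is an elliptic function with exactly two poles, one of order $n$ and one simple, modulo Hurwitz equivalence: $(C,\lambda)\sim(C',\lambda')$ if there is an analytic isomorphism $F:C\to C'$ with $\lambda'\circ F=\lambda$. It carries its moduli structure: a subset is open (a function on an open subset is holomorphic) if and only if its preimage (its pull-back) under the classifying map of every holomorphic family of such pairs, parametrised by an open subset of some $\mathbb C^k$, is open (holomorphic). Let $\theta_1(z,\tau)=-i\sum_{m\in\mathbb Z}(-1)^m e^{\pi i(m+1/2)^2\tau+2\pi i(m+1/2)z}$ and, for $(u,v,\tau)\in\Omega$, $$\lambda_{(u,v,\tau)}(z)=e^{-2\pi iu}\,\frac{\prod_{i=0}^{n}\theta_1(z-v_i+v_{n+1},\tau)}{\theta_1(z,\tau)^n\,\theta_1(z+(n+1)v_{n+1},\tau)} .$$ Let $\Omega^{\circ}\subset\Omega$ be the set of $(u,v,\tau)$ such that, modulo $\mathbb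 Z+\tau\mathbb Z$, the points $0$ and $-(n+1)v_{n+1}$ are distinct and different from all the points $v_i-v_{n+1}$, $0\le i\le n$. Then $\Omega^\circ$ is $\mathcal J(\tilde A_n)$-invariant; for $(u,v,\tau)\in\Omega^\circ$ the function $\lambda_{(u,v,\tau)}$ is elliptic with respect to $\mathbb Z+\tau\mathbb Z$ with exactly two poles modulo this lattice, one of order $n$ and one simple; and the map $$\Omega^\circ/\mathcal J(\tilde A_n)\longrightarrow H_{1,n-1,0},\qquad [(u,v,\tau)]\longmapsto[(\mathbb C/(\mathbb Z+\tau\mathbb Z),\ \lambda_{(u,v,\tau)})]$$ is well defined, surjective, and a local biholomorphism: every point of $\Omega^\circ/\mathcal J(\tilde A_n)$ has an open neighbourhood which the map sends homeomorphically onto an open subset of $H_{1,n-1,0}$ in such a way that holomorphic functions correspond to holomorphic functions. -/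

import Mathlib

open Set Filter Topology
open scoped UpperHalfPlane MatrixGroups

noncomputable section

namespace JacobiHurwitz

/-! ### Theta function -/

/-- The odd Jacobi theta function
`θ₁(z, τ) = -i ∑_{m ∈ ℤ} (-1)^m exp(πi (m + 1/2)² τ + 2πi (m + 1/2) z)`,
written through Mathlib's two-variable theta function. -/
def theta1 (z τ : ℂ) : ℂ :=
  -Complex.I * Complex.exp (Real.pi * Complex.I * τ / 4 + Real.pi * Complex.I * z) *
    jacobiTheta₂ (z + 1 / 2 + τ / 2) τ

/-! ### The space `Ω = ℂ ⊕ ℂⁿ⁺¹ ⊕ ℍ` -/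

/-- Vectors `(v₀, …, vₙ)` with `v₀ + ⋯ + vₙ = 0`. -/
def sumZero (n : ℕ) : Submodule ℂ (Fin (n + 1) → ℂ) where
  carrier := {v | ∑ i, v i = 0}
  add_mem' := by
    intro a b ha hb
    simp only [mem_ofPred_eq, Pi.add_apply, Finset.sum_add_distrib] at *
    rw [ha, hb, add_zero]
  zero_mem' := by simp
  smul_mem' := by
    intro c a ha
    simp only [mem_ofPred_eq, Pi.smul_apply, smul_eq_mul, ← Finset.mul_sum] at *
    rw [ha, mul_zero]

/-- `V = L ⊗ ℂ ≅ ℂⁿ⁺¹`: vectors `(v₀, …, vₙ, vₙ₊₁)` with `v₀ + ⋯ + vₙ = 0`; the first component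
holds `(v₀, …, vₙ)`, the second one `vₙ₊₁`. -/
abbrev V (n : ℕ) : Type := sumZero n × ℂ

/-- The bilinear form `⟨v, w⟩ = ∑_{i=0}^n vᵢ wᵢ - n (n+1) vₙ₊₁ wₙ₊₁`. -/
def form {n : ℕ} (v w : V n) : ℂ :=
  ∑ i, v.1.1 i * w.1.1 i - (n : ℂ) * ((n : ℂ) + 1) * (v.2 * w.2)

/-- The lattice `L` of the integral vectors of `V`. -/
def L (n : ℕ) : AddSubgroup (V n) where
  carrier := {v | (∀ i, ∃ m : ℤ, v.1.1 i = m) ∧ ∃ m : ℤ, v.2 = m}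
  add_mem' := by
    rintro a b ⟨ha, ha'⟩ ⟨hb, hb'⟩
    refine ⟨fun i => ?_, ?_⟩
    · obtain ⟨x, hx⟩ := ha i
      obtain ⟨y, hy⟩ := hb i
      exact ⟨x + y, by simp [hx, hy]⟩
    · obtain ⟨x, hx⟩ := ha'
      obtain ⟨y, hy⟩ := hb'
      exact ⟨x + y, by simp [hx, hy]⟩
  zero_mem' := ⟨fun i => ⟨0, by simp⟩, ⟨0, by simp⟩⟩
  neg_mem' := by
    rintro a ⟨ha, ha'⟩
    refine ⟨fun i => ?_, ?_⟩
    · obtain ⟨x, hx⟩ := ha i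
      exact ⟨-x, by simp [hx]⟩
    · obtain ⟨x, hx⟩ := ha'
      exact ⟨-x, by simp [hx]⟩

/-- `Ω = ℂ ⊕ ℂⁿ⁺¹ ⊕ ℍ`, with points `(u, v, τ)`. -/
abbrev Omega (n : ℕ) : Type := ℂ × V n × ℍ

/-! ### The Jacobi group and its orbit space -/

/-- The Weyl group of `Aₙ` (permutations of `n + 1` letters) acts on the first `n + 1` entries. -/
def permV {n : ℕ} (w : Equiv.Perm (Fin (n + 1))) (v : V n) : V n :=
  (⟨fun i => v.1.1 (w.symm i), by
    have h : ∑ i, v.1.1 i = 0 := v.1.2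
    change ∑ i, v.1.1 (w.symm i) = 0
    rw [← h]
    exact Equiv.sum_comp w.symm v.1.1⟩, v.2)

/-- `w (u, v, τ) = (u, w v, τ)`. -/
def weylAct {n : ℕ} (w : Equiv.Perm (Fin (n + 1))) : Equiv.Perm (Omega n) where
  toFun p := (p.1, permV w p.2.1, p.2.2)
  invFun p := (p.1, permV w.symm p.2.1, p.2.2)
  left_inv p := by
    ext <;> simp [permV]
  right_inv p := by
    ext <;> simp [permV]

/-- `t (u, v, τ) = (u - ⟨λ, v⟩ - ⟨λ, λ⟩ τ / 2 + k, v + τ λ + μ, τ)` for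
`t = (λ, μ, k) ∈ L × L × ℤ`. -/
def translationAct {n : ℕ} (l m : L n) (k : ℤ) : Equiv.Perm (Omega n) where
  toFun p := (p.1 - form l.1 p.2.1 - form l.1 l.1 * (p.2.2 : ℂ) / 2 + k,
    p.2.1 + (p.2.2 : ℂ) • l.1 + m.1, p.2.2)
  invFun p := (p.1 + form l.1 (p.2.1 - (p.2.2 : ℂ) • l.1 - m.1)
      + form l.1 l.1 * (p.2.2 : ℂ) / 2 - k,
    p.2.1 - (p.2.2 : ℂ) • l.1 - m.1, p.2.2)
  left_inv p := by
    have h : p.2.1 + (p.2.2 : ℂ) • l.1 + m.1 - (p.2.2 : ℂ) • l.1 - m.1 = p.2.1 := by abel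
    simp only [h]
    refine Prod.ext ?_ rfl
    simp only
    ring
  right_inv p := by
    have h : p.2.1 - (p.2.2 : ℂ) • l.1 - m.1 + (p.2.2 : ℂ) • l.1 + m.1 = p.2.1 := by abel
    simp only [h]
    refine Prod.ext ?_ rfl
    simp only
    ring

/-- `c τ + d` for `γ = (a b; c d)`. -/
def cocyc (γ : SL(2, ℤ)) (τ : ℍ) : ℂ := ((γ 1 0 : ℤ) : ℂ) * (τ : ℂ) + ((γ 1 1 : ℤ) : ℂ)

lemma cocyc_ne_zero (γ : SL(2, ℤ)) (τ : ℍ) : cocyc γ τ ≠ 0 := by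
  have := UpperHalfPlane.denom_ne_zero (γ : GL (Fin 2) ℝ) τ
  rw [ModularGroup.denom_apply] at this
  simpa [cocyc] using this

/-- `γ (u, v, τ) = (u + c ⟨v, v⟩ / (2 (c τ + d)), v / (c τ + d), (a τ + b) / (c τ + d))`. -/
def modularAct {n : ℕ} (γ : SL(2, ℤ)) : Equiv.Perm (Omega n) where
  toFun p := (p.1 + ((γ 1 0 : ℤ) : ℂ) * form p.2.1 p.2.1 / (2 * cocyc γ p.2.2),
    (cocyc γ p.2.2)⁻¹ • p.2.1, γ • p.2.2)
  invFun p := (p.1 - ((γ 1 0 : ℤ) : ℂ) *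
      form (cocyc γ (γ⁻¹ • p.2.2) • p.2.1) (cocyc γ (γ⁻¹ • p.2.2) • p.2.1) /
        (2 * cocyc γ (γ⁻¹ • p.2.2)),
    cocyc γ (γ⁻¹ • p.2.2) • p.2.1, γ⁻¹ • p.2.2)
  left_inv p := by
    simp only [inv_smul_smul, smul_inv_smul₀ (cocyc_ne_zero γ p.2.2), add_sub_cancel_right]
  right_inv p := by
    simp only [smul_inv_smul, inv_smul_smul₀ (cocyc_ne_zero γ (γ⁻¹ • p.2.2)), sub_add_cancel]

/-- The Jacobi group `𝒥(Ãₙ) = (W(Aₙ) ⋉ (L × L × ℤ)) ⋊ SL₂(ℤ)`, which acts faithfully on `Ω`, as a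
group of transformations of `Ω`: it is generated by the Weyl group of `Aₙ`, the Heisenberg group
`L × L × ℤ` and `SL₂(ℤ)`, acting as above. -/
def jacobiGroup (n : ℕ) : Subgroup (Equiv.Perm (Omega n)) :=
  Subgroup.closure
    (range (weylAct (n := n)) ∪
      {g | ∃ (l m : L n) (k : ℤ), g = translationAct l m k} ∪
      range (modularAct (n := n)))

/-- The orbit space `Ω / 𝒥(Ãₙ)`, with the quotient topology. -/
def OrbitSpace (n : ℕ) : Type := MulAction.orbitRel.Quotient (jacobiGroup n) (Omega n)

instance (n : ℕ) : TopologicalSpace (OrbitSpace n) :=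
  inferInstanceAs (TopologicalSpace (Quotient (MulAction.orbitRel (jacobiGroup n) (Omega n))))

/-- The class `[(u, v, τ)]`. -/
def OrbitSpace.mk {n : ℕ} (p : Omega n) : OrbitSpace n :=
  Quotient.mk (MulAction.orbitRel (jacobiGroup n) (Omega n)) p

/-- Holomorphic functions on an open subset `U` of the orbit space: those whose pull-back to `Ω`
is holomorphic (here `Ω` is seen as an open subset of `ℂ ⊕ V ⊕ ℂ`). -/
def OrbitSpace.Holomorphic {n : ℕ} (U : Set (OrbitSpace n)) (f : OrbitSpace n → ℂ) : Prop :=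
  DifferentiableOn ℂ
    (fun x : ℂ × V n × ℂ => f (OrbitSpace.mk (x.1, x.2.1, UpperHalfPlane.ofComplex x.2.2)))
    {x | 0 < x.2.2.im ∧ OrbitSpace.mk (x.1, x.2.1, UpperHalfPlane.ofComplex x.2.2) ∈ U}

/-! ### Holomorphic maps to the Riemann sphere -/

/-- `g` is holomorphic (complex differentiable) in a neighbourhood of `x`. -/
def HolAt {E F : Type*} [NormedAddCommGroup E] [NormedSpace ℂ E] [NormedAddCommGroup F]
    [NormedSpace ℂ F] (g : E → F) (x : E) : Prop :=
  ∀ᶠ y in 𝓝 x, DifferentiableAt ℂ g y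

/-- The map `w ↦ 1 / w` from `ℂ` to the Riemann sphere, with `0 ↦ ∞`. -/
def recip (w : ℂ) : OnePoint ℂ :=
  open Classical in if w = 0 then OnePoint.infty else ((w⁻¹ : ℂ) : OnePoint ℂ)

/-- A map to the Riemann sphere is holomorphic near `x` if near `x` either it is a holomorphic
function with finite values, or its reciprocal is. -/
def SphereHolAt {E : Type*} [NormedAddCommGroup E] [NormedSpace ℂ E] (f : E → OnePoint ℂ)
    (x : E) : Prop :=
  (∃ g : E → ℂ, HolAt g x ∧ ∀ᶠ y in 𝓝 x, f y = ((g y : ℂ) : OnePoint ℂ)) ∨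
    ∃ g : E → ℂ, HolAt g x ∧ ∀ᶠ y in 𝓝 x, f y = recip (g y)

/-- `f` has a pole of exact order `m` at `a`. -/
def HasPoleOfOrder (f : ℂ → OnePoint ℂ) (m : ℕ) (a : ℂ) : Prop :=
  f a = OnePoint.infty ∧ ∃ g : ℂ → ℂ, HolAt g a ∧ g a ≠ 0 ∧
    ∀ᶠ z in 𝓝[≠] a, f z = ((g z / (z - a) ^ m : ℂ) : OnePoint ℂ)

/-! ### The Hurwitz space `H_{1,n-1,0}` -/

/-- `f` is an elliptic function with respect to the lattice `Λ` of `P` (a holomorphic map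
`ℂ / Λ → ℂP¹`) which has, modulo `Λ`, exactly two poles, one of order `n` and one simple. -/
structure IsHurwitzFunction (n : ℕ) (P : PeriodPair) (f : ℂ → OnePoint ℂ) : Prop where
  hol : ∀ z, SphereHolAt f z
  periodic : ∀ z, ∀ ω ∈ P.lattice, f (z + ω) = f z
  poles : ∃ a b : ℂ, a - b ∉ P.lattice ∧ HasPoleOfOrder f n a ∧ HasPoleOfOrder f 1 b ∧
    ∀ z, f z = OnePoint.infty → z - a ∈ P.lattice ∨ z - b ∈ P.lattice

/-- A pair `(C, λ)`: the genus one curve `C = ℂ / Λ` with the elliptic function `λ` on it. -/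
structure HurwitzPair (n : ℕ) where
  periods : PeriodPair
  fn : ℂ → OnePoint ℂ
  isHurwitz : IsHurwitzFunction n periods fn

/-- The map `F` between the complex tori `ℂ / Λ` and `ℂ / Λ'` is holomorphic, i.e. it lifts locally
to holomorphic functions. -/
def TorusHol {P Q : PeriodPair} (F : ℂ ⧸ P.lattice → ℂ ⧸ Q.lattice) : Prop :=
  ∀ z : ℂ, ∃ G : ℂ → ℂ, HolAt G z ∧
    ∀ᶠ w in 𝓝 z, F (P.lattice.mkQ w) = Q.lattice.mkQ (G w)

/-- Hurwitz equivalence of `(C, λ)` and `(C', λ')`: there is an analytic isomorphism `F : C → C'`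
with `λ' ∘ F = λ`. -/
def HurwitzEquivalent {n : ℕ} (A B : HurwitzPair n) : Prop :=
  ∃ F : (ℂ ⧸ A.periods.lattice) ≃ (ℂ ⧸ B.periods.lattice),
    TorusHol F ∧ TorusHol F.symm ∧
      ∀ z w : ℂ, F (A.periods.lattice.mkQ z) = B.periods.lattice.mkQ w → B.fn w = A.fn z

lemma HolAt.comp {g f : ℂ → ℂ} {x : ℂ} (hg : HolAt g (f x)) (hf : HolAt f x) :
    HolAt (fun y => g (f y)) x := by
  have hc : ContinuousAt f x := hf.self_of_nhds.continuousAt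
  filter_upwards [hf, hc.eventually hg] with y h1 h2
  exact h2.comp y h1

lemma TorusHol.comp {P Q R : PeriodPair} {F : ℂ ⧸ P.lattice → ℂ ⧸ Q.lattice}
    {F' : ℂ ⧸ Q.lattice → ℂ ⧸ R.lattice} (hF' : TorusHol F') (hF : TorusHol F) :
    TorusHol (fun x => F' (F x)) := by
  intro z
  obtain ⟨G, hG, hG'⟩ := hF z
  obtain ⟨K, hK, hK'⟩ := hF' (G z)
  refine ⟨fun w => K (G w), hK.comp hG, ?_⟩
  have hc : ContinuousAt G z := hG.self_of_nhds.continuousAt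
  filter_upwards [hG', hc.eventually hK'] with w h1 h2
  rw [h1, h2]

instance hurwitzSetoid (n : ℕ) : Setoid (HurwitzPair n) where
  r := HurwitzEquivalent
  iseqv :=
    { refl := by
        intro A
        have hid : TorusHol (P := A.periods) (Q := A.periods) (fun x => x) := fun z =>
          ⟨fun w => w, Eventually.of_forall fun w => differentiableAt_id,
            Eventually.of_forall fun w => rfl⟩
        refine ⟨Equiv.refl _, hid, hid, fun z w h => ?_⟩
        have h' : w - z ∈ A.periods.lattice := by
          have := (Submodule.Quotient.eq A.periods.lattice).1 h.symm
          exact this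
        have := A.isHurwitz.periodic z (w - z) h'
        rwa [add_sub_cancel] at this
      symm := by
        rintro A B ⟨F, h1, h2, h3⟩
        refine ⟨F.symm, h2, h1, fun z w h => ?_⟩
        refine (h3 w z ?_).symm
        rw [← h, Equiv.apply_symm_apply]
      trans := by
        rintro A B C ⟨F, h1, h2, h3⟩ ⟨F', h1', h2', h3'⟩
        refine ⟨F.trans F', h1'.comp h1, h2.comp h2', fun z w h => ?_⟩
        obtain ⟨y, hy⟩ := Submodule.mkQ_surjective _ (F (A.periods.lattice.mkQ z))
        rw [h3' y w (by rw [hy]; exact h), h3 z y hy.symm] }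

/-- The Hurwitz space `H_{1,n-1,0}` of pairs `(C, λ)` up to Hurwitz equivalence. -/
def HurwitzSpace (n : ℕ) : Type := Quotient (hurwitzSetoid n)

def HurwitzSpace.mk {n : ℕ} (A : HurwitzPair n) : HurwitzSpace n := Quotient.mk (hurwitzSetoid n) A

/-- A holomorphic family of pairs `(C_b, λ_b)`, parametrised by `b` in an open set `base ⊆ ℂᵏ`: the
periods depend holomorphically on `b`, and `λ_b(z)` is holomorphic in `(b, z)` as a map to the
Riemann sphere. The values of `member` outside `base` are irrelevant. -/
structure HurwitzFamily (n k : ℕ) where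
  base : Set (Fin k → ℂ)
  isOpen_base : IsOpen base
  member : (Fin k → ℂ) → HurwitzPair n
  hol_period₁ : DifferentiableOn ℂ (fun b => (member b).periods.ω₁) base
  hol_period₂ : DifferentiableOn ℂ (fun b => (member b).periods.ω₂) base
  hol_fn : ∀ b ∈ base, ∀ z : ℂ,
    SphereHolAt (fun x : (Fin k → ℂ) × ℂ => (member x.1).fn x.2) (b, z)

/-- The part of the base of a family over which the classifying map takes values in `U`. -/
def HurwitzFamily.preimage {n k : ℕ} (A : HurwitzFamily n k) (U : Set (HurwitzSpace n)) :
    Set (Fin k → ℂ) :=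
  {b | b ∈ A.base ∧ HurwitzSpace.mk (A.member b) ∈ U}

/-- The moduli topology of the Hurwitz space: the finest topology for which the classifying maps of
all holomorphic families are continuous. -/
instance (n : ℕ) : TopologicalSpace (HurwitzSpace n) where
  IsOpen U := ∀ (k : ℕ) (A : HurwitzFamily n k), IsOpen (A.preimage U)
  isOpen_univ := by
    intro k A
    simpa [HurwitzFamily.preimage] using A.isOpen_base
  isOpen_inter := by
    intro s t hs ht k A
    convert (hs k A).inter (ht k A) using 1
    ext b
    simp only [HurwitzFamily.preimage, mem_inter_iff, mem_ofPred_eq]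
    tauto
  isOpen_sUnion := by
    intro S hS k A
    have : A.preimage (⋃₀ S) = ⋃ s ∈ S, A.preimage s := by
      ext b
      simp only [HurwitzFamily.preimage, mem_sUnion, mem_ofPred_eq, mem_iUnion]
      constructor
      · rintro ⟨h, s, hs, hb⟩
        exact ⟨s, hs, h, hb⟩
      · rintro ⟨s, hs, h, hb⟩
        exact ⟨h, s, hs, hb⟩
    rw [this]
    exact isOpen_biUnion fun s hs => hS s hs k A

/-- The complex structure of the Hurwitz space: a function on an open subset `U` is holomorphic if
its pull-back under the classifying map of every holomorphic family is holomorphic. -/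
def HurwitzSpace.Holomorphic {n : ℕ} (U : Set (HurwitzSpace n)) (g : HurwitzSpace n → ℂ) : Prop :=
  ∀ (k : ℕ) (A : HurwitzFamily n k),
    DifferentiableOn ℂ (fun b => g (HurwitzSpace.mk (A.member b))) (A.preimage U)

/-! ### The map -/

/-- The periods `1, τ`. -/
def tauPeriods (τ : ℍ) : PeriodPair where
  ω₁ := 1
  ω₂ := τ
  indep := by
    rw [LinearIndependent.pair_iff]
    intro s t h
    have him := congrArg Complex.im h
    have hre := congrArg Complex.re h
    simp at him hre
    have ht : t = 0 := by
      rcases him with h | h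
      · exact h
      · exact absurd h τ.im_pos.ne'
    refine ⟨?_, ht⟩
    simpa [ht] using hre

/-- Numerator `e^{-2πiu} ∏_{i=0}^n θ₁(z - vᵢ + vₙ₊₁, τ)` of `λ`. -/
def superNum {n : ℕ} (p : Omega n) (z : ℂ) : ℂ :=
  Complex.exp (-(2 * Real.pi * Complex.I * p.1)) *
    ∏ i, theta1 (z - p.2.1.1.1 i + p.2.1.2) p.2.2

/-- Denominator `θ₁(z, τ)ⁿ θ₁(z + (n+1) vₙ₊₁, τ)` of `λ`. -/
def superDen {n : ℕ} (p : Omega n) (z : ℂ) : ℂ :=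
  theta1 z p.2.2 ^ n * theta1 (z + ((n : ℂ) + 1) * p.2.1.2) p.2.2

/-- `λ(z) = e^{-2πiu} ∏_{i=0}^n θ₁(z - vᵢ + vₙ₊₁, τ) / (θ₁(z, τ)ⁿ θ₁(z + (n+1) vₙ₊₁, τ))`, with the
value `∞` at the zeros of the denominator. -/
def superpotential {n : ℕ} (p : Omega n) (z : ℂ) : OnePoint ℂ :=
  open Classical in
  if superDen p z = 0 then OnePoint.infty else ((superNum p z / superDen p z : ℂ) : OnePoint ℂ)

/-- The points of `Ω` for which the zeros `vᵢ - vₙ₊₁` of the numerator and the zeros `0`,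
`-(n+1) vₙ₊₁` of the denominator of `λ` satisfy: the latter two are distinct modulo `ℤ + τ ℤ`, and
none of the former is congruent to one of the latter. -/
def regularLocus (n : ℕ) : Set (Omega n) :=
  {p | ((n : ℂ) + 1) * p.2.1.2 ∉ (tauPeriods p.2.2).lattice ∧
    ∀ i, p.2.1.1.1 i - p.2.1.2 ∉ (tauPeriods p.2.2).lattice ∧
      p.2.1.1.1 i + (n : ℂ) * p.2.1.2 ∉ (tauPeriods p.2.2).lattice}

/-- `Φ` is a local biholomorphism on `S`: every point of `S` has an open neighbourhood inside `S`
which `Φ` maps homeomorphically onto an open subset of the Hurwitz space, in such a way that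
holomorphic functions correspond to holomorphic functions. -/
def IsLocalBiholomorphismOn {n : ℕ} (Φ : OrbitSpace n → HurwitzSpace n)
    (S : Set (OrbitSpace n)) : Prop :=
  ∀ x ∈ S, ∃ e : OpenPartialHomeomorph (OrbitSpace n) (HurwitzSpace n),
    x ∈ e.source ∧ e.source ⊆ S ∧ EqOn Φ e e.source ∧
      ∀ U ⊆ e.target, IsOpen U → ∀ g : HurwitzSpace n → ℂ,
        HurwitzSpace.Holomorphic U g ↔
          OrbitSpace.Holomorphic (e.source ∩ Φ ⁻¹' U) (fun y => g (Φ y))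

end JacobiHurwitz

end

noncomputable section

namespace JacobiHurwitz

section

/-! ### Holomorphic functions on complex normed spaces -/

section Analysis

variable {E F : Type*} [NormedAddCommGroup E] [NormedSpace ℂ E] [NormedAddCommGroup F]
  [NormedSpace ℂ F]

/-! Coordinates. Replace `v` by the zeros `xᵢ = vᵢ - vₙ₊₁` and the simple pole `κ = -(n+1)vₙ₊₁` of
λ. The condition `∑ vᵢ = 0` becomes Abel's condition `∑ xᵢ = κ` (`sum_zerosV`), and the form becomes
`∑ xᵢyᵢ - κκ'` (`form_eq`). Hence λ is elliptic. A translation multiplies the theta products by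
factors of automorphy, an element of `SL₂(ℤ)` by Gaussian factors. The exponent left over in the
quotient is a value of the form, and the action on `u` is exactly what absorbs it. The zeros, the
oddness and the modular law of θ₁ all come from one rigidity statement, `IsThetaLike.exists_eq_mul`:
two functions with the same multipliers have a doubly periodic quotient, which is constant once it
is entire.

Surjectivity. Scale the lattice to `ℤ + ℤτ` and move the pole of order `n` to `0`. Multiplying the
function by `θ₁(z)ⁿ θ₁(z - κ)` gives an entire theta function of order `n+1`, which is an
exponential times `n+1` translates of θ₁ (`exists_theta_factorization`). Comparing multipliers
yields Abel's condition modulo the lattice; moving one zero by a lattice vector makes it exact and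
removes the exponential.

Local injectivity. Holomorphic maps of tori are affine, so an equivalence between two regular points
can be taken to be a homothety `α`. Along pairs of points tending to the same `p₀`, the `α` stay in
a compact subset of `ℂ \ {0}`; a limit preserves λ and its simple pole, hence equals `1` by looking
at the residue. Discreteness of lattices then makes `α`, `τ` and `κ` agree already near `p₀`, and
`orbitSpace_mk_eq_of_superpotential_eq` puts the points in one orbit.

Topology and holomorphic functions. One direction uses the universal family over Ω°
(`regularFamily`). The other direction must lift an arbitrary family to Ω, although colliding zeros
cannot be followed one by one holomorphically. By the argument principle the power sums of the zeros
in a cluster are holomorphic in the parameter (`exists_roots`). So `exists_lift` provides a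
holomorphic map `P` depending on ordered zeros and on the parameter, together with a choice of
tuples of zeros which need not be holomorphic. A function on the Hurwitz space, pulled back through
`P`, is invariant under permutations inside clusters. By `exists_eq_comp_powerSums` it is therefore
a holomorphic function of power sums, and so holomorphic along the family. The same lift shows that
the map is open. -/

lemma HolAt.differentiableAt {g : E → F} {x : E} (h : HolAt g x) : DifferentiableAt ℂ g x :=
  h.self_of_nhds

lemma HolAt.continuousAt {g : E → F} {x : E} (h : HolAt g x) : ContinuousAt g x :=
  h.differentiableAt.continuousAt

lemma HolAt.eventually {g : E → F} {x : E} (h : HolAt g x) : ∀ᶠ y in 𝓝 x, HolAt g y :=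
  eventually_eventually_nhds.2 h

lemma HolAt.congr {f g : E → F} {x : E} (h : HolAt f x) (hfg : f =ᶠ[𝓝 x] g) : HolAt g x := by
  filter_upwards [h, eventually_eventually_nhds.2 hfg] with y h1 h2
  exact h1.congr_of_eventuallyEq (h2.mono fun z hz => hz.symm)

lemma HolAt.comp' {G : Type*} [NormedAddCommGroup G] [NormedSpace ℂ G] {g : F → G} {f : E → F}
    {x : E} (hg : HolAt g (f x)) (hf : HolAt f x) : HolAt (fun y => g (f y)) x := by
  filter_upwards [hf, hf.continuousAt.eventually hg] with y h1 h2
  exact h2.comp y h1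

lemma holAt_of_differentiable {g : E → F} (h : Differentiable ℂ g) (x : E) : HolAt g x :=
  Eventually.of_forall fun y => h y

lemma HolAt.prodMk {G : Type*} [NormedAddCommGroup G] [NormedSpace ℂ G] {f : E → F} {g : E → G}
    {x : E} (hf : HolAt f x) (hg : HolAt g x) : HolAt (fun y => (f y, g y)) x := by
  filter_upwards [hf, hg] with y h1 h2
  exact h1.prodMk h2

lemma HolAt.add {f g : E → F} {x : E} (hf : HolAt f x) (hg : HolAt g x) :
    HolAt (fun y => f y + g y) x := by
  filter_upwards [hf, hg] with y h1 h2
  exact h1.add h2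

lemma HolAt.sub {f g : E → F} {x : E} (hf : HolAt f x) (hg : HolAt g x) :
    HolAt (fun y => f y - g y) x := by
  filter_upwards [hf, hg] with y h1 h2
  exact h1.sub h2

lemma HolAt.mul {f g : E → ℂ} {x : E} (hf : HolAt f x) (hg : HolAt g x) :
    HolAt (fun y => f y * g y) x := by
  filter_upwards [hf, hg] with y h1 h2
  exact h1.mul h2

lemma HolAt.pow {f : E → ℂ} {x : E} (hf : HolAt f x) (k : ℕ) : HolAt (fun y => f y ^ k) x := by
  filter_upwards [hf] with y h1
  exact h1.pow k

lemma HolAt.inv {f : E → ℂ} {x : E} (hf : HolAt f x) (h0 : f x ≠ 0) :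
    HolAt (fun y => (f y)⁻¹) x := by
  filter_upwards [hf, hf.continuousAt.eventually_ne h0] with y h1 h2
  exact h1.inv h2

lemma HolAt.div {f g : E → ℂ} {x : E} (hf : HolAt f x) (hg : HolAt g x) (h0 : g x ≠ 0) :
    HolAt (fun y => f y / g y) x := by
  simpa only [div_eq_mul_inv] using hf.mul (hg.inv h0)

lemma HolAt.sum {ι : Type*} {s : Finset ι} {f : ι → E → F} {x : E}
    (hf : ∀ i ∈ s, HolAt (f i) x) : HolAt (fun y => ∑ i ∈ s, f i y) x := by
  have : ∀ᶠ y in 𝓝 x, ∀ i ∈ s, DifferentiableAt ℂ (f i) y := by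
    rw [eventually_all_finset]
    exact hf
  filter_upwards [this] with y h1
  exact DifferentiableAt.fun_sum h1

lemma HolAt.prod {ι : Type*} {s : Finset ι} {f : ι → E → ℂ} {x : E}
    (hf : ∀ i ∈ s, HolAt (f i) x) : HolAt (fun y => ∏ i ∈ s, f i y) x := by
  have : ∀ᶠ y in 𝓝 x, ∀ i ∈ s, DifferentiableAt ℂ (f i) y := by
    rw [eventually_all_finset]
    exact hf
  classical
  filter_upwards [this] with y h1
  have := (HasFDerivAt.finsetProd (fun i hi => (h1 i hi).hasFDerivAt)).differentiableAt
  simpa [Finset.prod_fn] using this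

lemma holAt_pi {ι : Type*} [Fintype ι] {f : E → ι → ℂ} {x : E}
    (hf : ∀ i, HolAt (fun y => f y i) x) : HolAt f x := by
  have : ∀ᶠ y in 𝓝 x, ∀ i, DifferentiableAt ℂ (fun y => f y i) y := eventually_all.2 hf
  filter_upwards [this] with y h1
  exact differentiableAt_pi.2 h1

lemma holAt_iff_analyticAt {f : ℂ → ℂ} {x : ℂ} : HolAt f x ↔ AnalyticAt ℂ f x :=
  Complex.analyticAt_iff_eventually_differentiableAt.symm

/-- The derivative of a holomorphic function is locally Lipschitz. -/
lemma HolAt.continuousAt_fderiv {g : E → F} {x : E} (h : HolAt g x) :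
    ContinuousAt (fderiv ℂ g) x := by
  have h1 : ∀ᶠ y in 𝓝 x, DifferentiableAt ℂ g y ∧ dist (g y) (g x) < 1 :=
    h.and (h.continuousAt.eventually (Metric.ball_mem_nhds _ one_pos))
  obtain ⟨R, hR, hb⟩ := Metric.eventually_nhds_iff_ball.1 h1
  have hd : ∀ y ∈ Metric.ball x (R / 2), ‖fderiv ℂ g y‖ ≤ 2 / (R / 2) := by
    intro y hy
    have hsub : Metric.ball y (R / 2) ⊆ Metric.ball x R := by
      apply Metric.ball_subset_ball'
      rw [Metric.mem_ball] at hy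
      linarith
    -- Cauchy's estimate on balls of radius `R/2`: the oscillation of `g` there is at most `2`,
    -- which bounds the derivative uniformly on the half ball.
    refine Complex.norm_fderiv_le_div_of_mapsTo_ball
      (fun z hz => (hb z (hsub hz)).1.differentiableWithinAt) ?_ (half_pos hR)
    intro z hz
    have hz1 := (hb z (hsub hz)).2
    have hy1 := (hb y (hsub (Metric.mem_ball_self (half_pos hR)))).2
    rw [Metric.mem_closedBall]
    calc dist (g z) (g y) ≤ dist (g z) (g x) + dist (g y) (g x) := dist_triangle_right _ _ _
      _ ≤ 2 := by linarith
  have hlip : ∀ y ∈ Metric.ball x (R / 2), ∀ z ∈ Metric.ball x (R / 2),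
      ‖g z - g y‖ ≤ 2 / (R / 2) * ‖z - y‖ := by
    intro y hy z hz
    refine (convex_ball x (R / 2)).norm_image_sub_le_of_norm_fderiv_le (𝕜 := ℂ) (fun w hw => ?_) hd hy hz
    exact (hb w (Metric.ball_subset_ball (by linarith) hw)).1
  -- A second Cauchy estimate, for `z ↦ g (z + (y - x)) - g z`. Its derivative at `x` is `Dg(y) -
  -- Dg(x)`, and its oscillation is `O(‖y - x‖)` by the Lipschitz bound.
  have key : ∀ y ∈ Metric.ball x (R / 4),
      ‖fderiv ℂ g y - fderiv ℂ g x‖ ≤ (3 * (2 / (R / 2)) / (R / 4)) * ‖y - x‖ := by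
    intro y hy
    rcases eq_or_ne y x with rfl | hne
    · simp
    have hpos : 0 < ‖y - x‖ := norm_pos_iff.2 (sub_ne_zero.2 hne)
    rw [Metric.mem_ball, dist_eq_norm] at hy
    have hin : ∀ z ∈ Metric.ball x (R / 4), z + (y - x) ∈ Metric.ball x (R / 2) := by
      intro z hz
      rw [Metric.mem_ball, dist_eq_norm] at *
      calc ‖z + (y - x) - x‖ = ‖(z - x) + (y - x)‖ := by congr 1; abel
        _ ≤ ‖z - x‖ + ‖y - x‖ := norm_add_le _ _
        _ < R / 2 := by linarith
    have hin' : ∀ z ∈ Metric.ball x (R / 4), z ∈ Metric.ball x (R / 2) := fun z hz =>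
      Metric.ball_subset_ball (by linarith) hz
    have hdz : ∀ z ∈ Metric.ball x (R / 2), DifferentiableAt ℂ g z := fun z hz =>
      (hb z (Metric.ball_subset_ball (by linarith) hz)).1
    have hcomp : ∀ z ∈ Metric.ball x (R / 4),
        HasFDerivAt (fun z => g (z + (y - x)) - g z)
          (fderiv ℂ g (z + (y - x)) - fderiv ℂ g z) z := by
      intro z hz
      refine HasFDerivAt.sub ?_ (hdz z (hin' z hz)).hasFDerivAt
      have := (hdz _ (hin z hz)).hasFDerivAt
      exact (hasFDerivAt_comp_add_right _).2 this
    have hx0 : x ∈ Metric.ball x (R / 4) := Metric.mem_ball_self (by linarith)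
    have := Complex.norm_fderiv_le_div_of_mapsTo_ball (c := x) (R₁ := R / 4)
      (R₂ := 3 * (2 / (R / 2)) * ‖y - x‖) (f := fun z => g (z + (y - x)) - g z)
      (fun z hz => (hcomp z hz).differentiableAt.differentiableWithinAt) ?_ (by linarith)
    · rw [(hcomp x hx0).fderiv, add_sub_cancel] at this
      calc _ ≤ _ := this
        _ = _ := by ring
    · intro z hz
      rw [Metric.mem_closedBall, dist_eq_norm]
      have e1 := hlip z (hin' z hz) _ (hin z hz)
      have e2 := hlip x (hin' x hx0) _ (hin x hx0)
      rw [add_sub_cancel_left] at e1 e2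
      have : 0 < 2 / (R / 2) * ‖y - x‖ := by positivity
      calc _ ≤ ‖g (z + (y - x)) - g z‖ + ‖g (x + (y - x)) - g x‖ := norm_sub_le _ _
        _ ≤ _ := by linarith
  rw [ContinuousAt, tendsto_iff_norm_sub_tendsto_zero]
  have hlim : Tendsto (fun y => (3 * (2 / (R / 2)) / (R / 4)) * ‖y - x‖) (𝓝 x) (𝓝 0) := by
    have : Continuous fun y : E => (3 * (2 / (R / 2)) / (R / 4)) * ‖y - x‖ := by fun_prop
    simpa using this.tendsto x
  refine squeeze_zero' (Eventually.of_forall fun _ => norm_nonneg _) ?_ hlim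
  filter_upwards [Metric.ball_mem_nhds x (show 0 < R / 4 by linarith)] with y hy using key y hy

/-- A circle integral depending holomorphically on a parameter is holomorphic. -/
lemma holAt_circleIntegral {f : E × ℂ → ℂ} {e : E} {c : ℂ} {r : ℝ} (hr : 0 ≤ r)
    (hf : ∀ ζ ∈ Metric.sphere c r, HolAt f (e, ζ)) :
    HolAt (fun y => ∮ ζ in C(c, r), f (y, ζ)) e := by
  have hK : IsCompact (Metric.sphere c r) := isCompact_sphere c r
  have hcont : ContinuousOn (fun ζ => fderiv ℂ f (e, ζ)) (Metric.sphere c r) := by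
    intro ζ hζ
    refine ContinuousAt.continuousWithinAt ?_
    exact ContinuousAt.comp (f := fun ζ : ℂ => (e, ζ)) (hf ζ hζ).continuousAt_fderiv
      (by fun_prop)
  obtain ⟨M, hM⟩ := hK.exists_bound_of_continuousOn hcont
  -- Compactness of the circle makes the neighbourhood and the bound `M + 1` uniform in `ζ`; this
  -- bound dominates when differentiating under the integral.
  have hev : ∀ᶠ y in 𝓝 e, ∀ ζ ∈ Metric.sphere c r,
      HolAt f (y, ζ) ∧ ‖fderiv ℂ f (y, ζ)‖ < M + 1 := by
    refine hK.eventually_forall_of_forall_eventually fun ζ hζ => ?_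
    refine ((hf ζ hζ).eventually.and ?_)
    have := (hf ζ hζ).continuousAt_fderiv.norm
    exact this.eventually (gt_mem_nhds (lt_of_le_of_lt (hM ζ hζ) (lt_add_one M)))
  filter_upwards [eventually_eventually_nhds.2 hev] with y hy
  have hy0 := hy.self_of_nhds
  have hmem : ∀ t : ℝ, circleMap c r t ∈ Metric.sphere c r := fun t => circleMap_mem_sphere c hr t
  have hcircd : Continuous (deriv (circleMap c r)) := by
    have : deriv (circleMap c r) = fun t => circleMap 0 r t * Complex.I := by
      ext t; simp
    rw [this]
    exact (continuous_circleMap 0 r).mul continuous_const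
  have hmeas : ∀ z, (∀ ζ ∈ Metric.sphere c r,
      HolAt f (z, ζ) ∧ ‖fderiv ℂ f (z, ζ)‖ < M + 1) →
      Continuous fun t => deriv (circleMap c r) t • f (z, circleMap c r t) := by
    intro z hz
    refine hcircd.smul (continuous_iff_continuousAt.2 fun t => ?_)
    exact ContinuousAt.comp (f := fun t : ℝ => (z, circleMap c r t))
      (hz _ (hmem t)).1.continuousAt (by fun_prop)
  have hinl : ∀ (z : E) (ζ : ℂ), DifferentiableAt ℂ f (z, ζ) →
      HasFDerivAt (fun x => f (x, ζ)) ((fderiv ℂ f (z, ζ)).comp (ContinuousLinearMap.inl ℂ E ℂ)) z := by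
    intro z ζ h
    exact h.hasFDerivAt.comp z (hasFDerivAt_prodMk_left z ζ)
  have hmeas' : Continuous fun t => deriv (circleMap c r) t •
      ((fderiv ℂ f (y, circleMap c r t)).comp (ContinuousLinearMap.inl ℂ E ℂ)) := by
    refine hcircd.smul ?_
    refine Continuous.clm_comp (continuous_iff_continuousAt.2 fun t => ?_) continuous_const
    exact ContinuousAt.comp (f := fun t : ℝ => (y, circleMap c r t))
      (hy0 _ (hmem t)).1.continuousAt_fderiv (by fun_prop)
  have := intervalIntegral.hasFDerivAt_integral_of_dominated_of_fderiv_le (𝕜 := ℂ)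
    (μ := MeasureTheory.volume) (a := 0) (b := 2 * Real.pi)
    (F := fun z t => deriv (circleMap c r) t • f (z, circleMap c r t))
    (F' := fun z t => deriv (circleMap c r) t •
      ((fderiv ℂ f (z, circleMap c r t)).comp (ContinuousLinearMap.inl ℂ E ℂ)))
    (bound := fun _ => r * ((M + 1) * ‖ContinuousLinearMap.inl ℂ E ℂ‖)) hy
    (hy.mono fun z hz => (hmeas z hz).aestronglyMeasurable)
    ((hmeas y hy0).intervalIntegrable _ _) hmeas'.aestronglyMeasurable
    (Eventually.of_forall fun t _ z hz => ?_) (by simp)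
    (Eventually.of_forall fun t _ z hz => ?_)
  · exact this.differentiableAt
  · have h1 : ‖deriv (circleMap c r) t‖ = r := by
      simp [abs_of_nonneg hr]
    rw [norm_smul, h1]
    refine mul_le_mul_of_nonneg_left ?_ hr
    refine (ContinuousLinearMap.opNorm_comp_le _ _).trans ?_
    exact mul_le_mul_of_nonneg_right (hz _ (hmem t)).2.le (norm_nonneg _)
  · exact (hinl z _ (hz _ (hmem t)).1.differentiableAt).fun_const_smul (deriv (circleMap c r) t)

/-- The partial derivative of a holomorphic function is holomorphic. -/
lemma HolAt.deriv_snd {f : E × ℂ → ℂ} {e : E} {c : ℂ} (hf : HolAt f (e, c)) :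
    HolAt (fun x : E × ℂ => deriv (fun z => f (x.1, z)) x.2) (e, c) := by
  obtain ⟨R, hR, hb⟩ := Metric.eventually_nhds_iff_ball.1 (HolAt.eventually hf)
  -- Cauchy's formula over one fixed circle turns the derivative into a parameter integral.
  have hrep : (fun x : E × ℂ => (2 * Real.pi * Complex.I : ℂ)⁻¹ •
      ∮ ζ in C(c, R / 2), ((ζ - x.2) ^ 2)⁻¹ * f (x.1, ζ)) =ᶠ[𝓝 (e, c)]
      fun x : E × ℂ => deriv (fun z => f (x.1, z)) x.2 := by
    filter_upwards [Metric.ball_mem_nhds (e, c) (half_pos hR)] with x hx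
    rw [Metric.mem_ball, Prod.dist_eq, max_lt_iff] at hx
    have hU : DifferentiableOn ℂ (fun z => f (x.1, z)) (Metric.ball c R) := by
      intro z hz
      have : HolAt f (x.1, z) := hb _ (by
        rw [Metric.mem_ball, Prod.dist_eq, max_lt_iff]
        exact ⟨hx.1.trans (by simp; linarith), hz⟩)
      exact (this.differentiableAt.comp z (by fun_prop : DifferentiableAt ℂ (fun z => (x.1, z)) z)).differentiableWithinAt
    have := Complex.two_pi_I_inv_smul_circleIntegral_sub_sq_inv_smul_of_differentiable
      Metric.isOpen_ball (Metric.closedBall_subset_ball (by linarith : R / 2 < R)) hU (w₀ := x.2)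
      (by simpa using hx.2)
    simpa using this
  refine HolAt.congr ?_ hrep
  have : HolAt (fun x : E × ℂ => ∮ ζ in C(c, R / 2), ((ζ - x.2) ^ 2)⁻¹ * f (x.1, ζ)) (e, c) := by
    refine holAt_circleIntegral (f := fun y : (E × ℂ) × ℂ => ((y.2 - y.1.2) ^ 2)⁻¹ * f (y.1.1, y.2))
      (half_pos hR).le fun ζ hζ => ?_
    rw [mem_sphere_iff_norm] at hζ
    refine HolAt.mul (HolAt.inv (holAt_of_differentiable (by fun_prop) _) ?_) ?_
    · have : ζ - c ≠ 0 := by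
        rw [← norm_pos_iff, hζ]; linarith
      simpa using this
    · refine HolAt.comp' (g := f) (hb _ ?_) (holAt_of_differentiable (by fun_prop) _)
      rw [Metric.mem_ball, Prod.dist_eq, max_lt_iff, dist_eq_norm, dist_eq_norm]
      simp only [sub_self, norm_zero]
      exact ⟨hR, by linarith⟩
  filter_upwards [this] with y hy
  exact hy.fun_const_smul (2 * Real.pi * Complex.I : ℂ)⁻¹

end Analysis

end

section

/-! ### Zeros of holomorphic functions in a disc -/

lemma analyticOnNhd_dslope {f : ℂ → ℂ} {s : Set ℂ} (hf : AnalyticOnNhd ℂ f s) (w : ℂ) (hw : w ∈ s) :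
    AnalyticOnNhd ℂ (dslope f w) s := by
  obtain ⟨U, hsU, hU, hfU⟩ : ∃ U, s ⊆ U ∧ IsOpen U ∧ DifferentiableOn ℂ f U :=
    ⟨{z | AnalyticAt ℂ f z}, hf, isOpen_analyticAt ℂ f,
      fun z hz => hz.differentiableAt.differentiableWithinAt⟩
  have := (Complex.differentiableOn_dslope (hU.mem_nhds (hsU hw))).2 hfU
  exact (this.analyticOnNhd hU).mono hsU

/-- Split off the zero of order `k` at `w`. -/
lemma exists_eq_pow_mul {f : ℂ → ℂ} {s : Set ℂ} (hf : AnalyticOnNhd ℂ f s) (w : ℂ) (hw : w ∈ s)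
    (h0 : ¬ ∀ᶠ z in 𝓝 w, f z = 0) :
    ∃ (k : ℕ) (h : ℂ → ℂ), AnalyticOnNhd ℂ h s ∧ h w ≠ 0 ∧ ∀ z, f z = (z - w) ^ k * h z := by
  obtain ⟨k, g, hg, hg0, hfg⟩ := (hf w hw).exists_eventuallyEq_pow_smul_nonzero_iff.2 h0
  -- The local factorisation only supplies the order. Dividing by `z - w` through `dslope`, one step
  -- at a time, keeps the cofactor analytic on all of `s` and the identity valid for every `z`.
  induction k generalizing f with
  | zero =>
    refine ⟨0, f, hf, ?_, by simp⟩
    have := hfg.self_of_nhds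
    simpa [this] using hg0
  | succ k ih =>
    have hfw : f w = 0 := by
      have := hfg.self_of_nhds
      simpa using this
    have hmul : ∀ z, f z = (z - w) * dslope f w z := by
      intro z
      have := sub_smul_dslope f w z
      simpa [hfw] using this.symm
    have hev : ∀ᶠ z in 𝓝 w, dslope f w z = (z - w) ^ k • g z := by
      have hne : ∀ᶠ z in 𝓝[≠] w, dslope f w z = (z - w) ^ k • g z := by
        filter_upwards [hfg.filter_mono nhdsWithin_le_nhds, self_mem_nhdsWithin] with z hz hzw
        have hzw' : z - w ≠ 0 := sub_ne_zero.2 hzw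
        rw [hmul z, pow_succ'] at hz
        have : (z - w) * dslope f w z = (z - w) * ((z - w) ^ k • g z) := by
          rw [hz, smul_eq_mul, smul_eq_mul]; ring
        exact mul_left_cancel₀ hzw' this
      have hA := analyticOnNhd_dslope hf w hw w hw
      exact (hA.frequently_eq_iff_eventually_eq (by fun_prop)).1 hne.frequently
    obtain ⟨k', h, hh, hhw, hfh⟩ := ih (analyticOnNhd_dslope hf w hw) (by
      intro hz
      apply h0
      filter_upwards [hz] with z hz
      rw [hmul z, hz, mul_zero]) hev
    refine ⟨k' + 1, h, hh, hhw, fun z => ?_⟩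
    rw [hmul, hfh, pow_succ']
    ring

/-- A holomorphic function on a closed disc without zeros on the boundary is a polynomial with
zeros in the open disc times a function without zeros. -/
lemma exists_eq_prod_mul {f : ℂ → ℂ} {c : ℂ} {r : ℝ} (hr : 0 < r)
    (hf : AnalyticOnNhd ℂ f (Metric.closedBall c r)) (h0 : ∀ z ∈ Metric.sphere c r, f z ≠ 0) :
    ∃ (s : Multiset ℂ) (h : ℂ → ℂ), (∀ x ∈ s, x ∈ Metric.ball c r) ∧
      AnalyticOnNhd ℂ h (Metric.closedBall c r) ∧ (∀ z ∈ Metric.closedBall c r, h z ≠ 0) ∧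
      ∀ z, f z = (s.map fun x => z - x).prod * h z := by
  have hconn : IsPreconnected (Metric.closedBall c r) := (convex_closedBall c r).isPreconnected
  have hnz : ∀ w ∈ Metric.closedBall c r, ¬ ∀ᶠ z in 𝓝 w, f z = 0 := by
    intro w hw hz
    obtain ⟨z, hzs⟩ : (Metric.sphere c r).Nonempty := NormedSpace.sphere_nonempty.2 hr.le
    exact h0 z hzs (hf.eqOn_zero_of_preconnected_of_eventuallyEq_zero hconn hw hz
      (Metric.sphere_subset_closedBall hzs))
  -- Infinitely many zeros would accumulate in the compact disc and force `f` to vanish on it,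
  -- including the boundary.
  have hfin : ({z | f z = 0} ∩ Metric.closedBall c r).Finite := by
    by_contra hinf
    obtain ⟨w, hw, hacc⟩ := Set.Infinite.exists_accPt_of_subset_isCompact hinf
      (isCompact_closedBall c r) inter_subset_right
    rw [accPt_iff_frequently_nhdsNE] at hacc
    have : ∃ᶠ z in 𝓝[≠] w, f z = 0 := hacc.mono fun z hz => hz.1
    exact hnz w hw ((hf w hw).frequently_zero_iff_eventually_zero.1 this)
  have key : ∀ T : Finset ℂ, (∀ w ∈ T, w ∈ {z | f z = 0} ∩ Metric.closedBall c r) →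
      ∃ (s : Multiset ℂ) (h : ℂ → ℂ), (∀ x ∈ s, x ∈ T) ∧
      AnalyticOnNhd ℂ h (Metric.closedBall c r) ∧ (∀ z ∈ T, h z ≠ 0) ∧
      ∀ z, f z = (s.map fun x => z - x).prod * h z := by
    intro T
    induction T using Finset.induction_on with
    | empty => exact fun _ => ⟨0, f, by simp, hf, by simp, by simp⟩
    | insert w T hwT ih =>
      intro hT
      obtain ⟨s, h, hs, hh, hhT, hfh⟩ := ih fun x hx => hT x (Finset.mem_insert_of_mem hx)
      have hw := (hT w (Finset.mem_insert_self w T)).2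
      obtain ⟨k, g, hg, hgw, hhg⟩ := exists_eq_pow_mul hh w hw (by
        intro hz
        refine hnz w hw ?_
        filter_upwards [hz] with z hz
        rw [hfh, hz, mul_zero])
      refine ⟨s + Multiset.replicate k w, g, ?_, hg, ?_, ?_⟩
      · intro x hx
        rcases Multiset.mem_add.1 hx with hx | hx
        · exact Finset.mem_insert_of_mem (hs x hx)
        · rw [Multiset.eq_of_mem_replicate hx]
          exact Finset.mem_insert_self w T
      · intro z hz
        rcases Finset.mem_insert.1 hz with rfl | hz
        · exact hgw
        · intro hgz
          exact hhT z hz (by rw [hhg, hgz, mul_zero])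
      · intro z
        rw [hfh, hhg]
        simp
        ring
  obtain ⟨s, h, hs, hh, hhT, hfh⟩ := key hfin.toFinset (by simp)
  have hmem : ∀ z ∈ Metric.closedBall c r, f z = 0 → z ∈ Metric.ball c r := by
    intro z hz hfz
    rw [← Metric.ball_union_sphere] at hz
    rcases hz with hz | hz
    · exact hz
    · exact absurd hfz (h0 z hz)
  refine ⟨s, h, ?_, hh, ?_, hfh⟩
  · intro x hx
    have := hs x hx
    rw [Finite.mem_toFinset] at this
    exact hmem x this.2 this.1
  · intro z hz hhz
    have : f z = 0 := by rw [hfh, hhz, mul_zero]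
    exact hhT z (by rw [Finite.mem_toFinset]; exact ⟨this, hz⟩) hhz

lemma logDeriv_multiset_prod (s : Multiset ℂ) (z : ℂ) (hz : ∀ x ∈ s, z ≠ x) :
    logDeriv (fun z => (s.map fun x => z - x).prod) z = (s.map fun x => (z - x)⁻¹).sum := by
  induction s using Multiset.induction_on with
  | empty => simp [logDeriv]
  | cons a s ih =>
    have h1 := ih fun x hx => hz x (Multiset.mem_cons_of_mem hx)
    have ha : z - a ≠ 0 := sub_ne_zero.2 (hz a (Multiset.mem_cons_self a s))
    have hs : (s.map fun x => z - x).prod ≠ 0 := by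
      rw [Ne, Multiset.prod_eq_zero_iff, Multiset.mem_map]
      rintro ⟨x, hx, hx0⟩
      exact hz x (Multiset.mem_cons_of_mem hx) (sub_eq_zero.1 hx0)
    have hd : DifferentiableAt ℂ (fun z => (s.map fun x => z - x).prod) z := by
      clear h1 hs hz ih
      induction s using Multiset.induction_on with
      | empty => simp
      | cons b s ih => simpa using (by fun_prop : DifferentiableAt ℂ (fun z => z - b) z).fun_mul ih
    have := logDeriv_mul (f := fun z => z - a) (g := fun z => (s.map fun x => z - x).prod) z ha hs
      (by fun_prop) hd
    simp only [Multiset.map_cons, Multiset.prod_cons, Multiset.sum_cons]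
    rw [this, h1]
    congr 1
    simp [logDeriv]

/-- The argument principle in a disc, for a function in factorized form. -/
lemma circleIntegral_mul_logDeriv {f g h : ℂ → ℂ} {c : ℂ} {r : ℝ} (hr : 0 < r) (s : Multiset ℂ)
    (hs : ∀ x ∈ s, x ∈ Metric.ball c r) (hh : AnalyticOnNhd ℂ h (Metric.closedBall c r))
    (hh0 : ∀ z ∈ Metric.closedBall c r, h z ≠ 0)
    (hg : AnalyticOnNhd ℂ g (Metric.closedBall c r))
    (hf : ∀ z ∈ Metric.sphere c r, f =ᶠ[𝓝 z] fun z => (s.map fun x => z - x).prod * h z) :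
    (∮ z in C(c, r), g z * (deriv f z / f z)) = 2 * Real.pi * Complex.I * (s.map g).sum := by
  have hsph : ∀ z ∈ Metric.sphere c r, ∀ x ∈ s, z ≠ x := by
    rintro z hz x hx rfl
    have := hs z hx
    rw [Metric.mem_sphere] at hz
    rw [Metric.mem_ball] at this
    linarith
  -- The logarithmic derivative is a sum of simple poles plus a holomorphic term. Cauchy's formula
  -- evaluates the former at the roots, Cauchy's theorem kills the latter.
  have hlog : ∀ z ∈ Metric.sphere c r,
      g z * (deriv f z / f z) = (s.map fun x => (z - x)⁻¹ * g z).sum + g z * logDeriv h z := by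
    intro z hz
    have hzc := Metric.sphere_subset_closedBall hz
    have h1 : deriv f z / f z = logDeriv (fun z => (s.map fun x => z - x).prod * h z) z := by
      rw [logDeriv_apply, (hf z hz).deriv_eq, (hf z hz).self_of_nhds]
    have hs0 : (s.map fun x => z - x).prod ≠ 0 := by
      rw [Ne, Multiset.prod_eq_zero_iff, Multiset.mem_map]
      rintro ⟨x, hx, hx0⟩
      exact hsph z hz x hx (sub_eq_zero.1 hx0)
    have hd : DifferentiableAt ℂ (fun z => (s.map fun x => z - x).prod) z := by
      clear hs hs0 h1 hf hsph
      induction s using Multiset.induction_on with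
      | empty => simp
      | cons b s ih => simpa using (by fun_prop : DifferentiableAt ℂ (fun z => z - b) z).fun_mul ih
    rw [h1, logDeriv_mul (f := fun z => (s.map fun x => z - x).prod) (g := h) z hs0 (hh0 z hzc) hd
      (hh z hzc).differentiableAt, logDeriv_multiset_prod s z (hsph z hz), mul_add,
      Multiset.sum_map_mul_right, mul_comm (g z)]
  rw [circleIntegral.integral_congr hr.le hlog]
  have hgc : ContinuousOn g (Metric.sphere c r) :=
    hg.continuousOn.mono Metric.sphere_subset_closedBall
  have hI0 : AnalyticOnNhd ℂ (fun z => g z * logDeriv h z) (Metric.closedBall c r) := by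
    intro z hz
    exact (hg z hz).mul ((hh z hz).deriv.div (hh z hz) (hh0 z hz))
  have hI1 : ∀ x ∈ s, CircleIntegrable (fun z => (z - x)⁻¹ * g z) c r := by
    intro x hx
    refine ContinuousOn.circleIntegrable hr.le (ContinuousOn.mul (ContinuousOn.inv₀ (by fun_prop) ?_) hgc)
    intro z hz
    exact sub_ne_zero.2 (hsph z hz x hx)
  have hI2 : ∀ t ≤ s, CircleIntegrable (fun z => (t.map fun x => (z - x)⁻¹ * g z).sum) c r ∧
      (∮ z in C(c, r), (t.map fun x => (z - x)⁻¹ * g z).sum) =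
        2 * Real.pi * Complex.I * (t.map g).sum := by
    intro t
    induction t using Multiset.induction_on with
    | empty =>
      intro _
      simp [circleIntegrable_const, circleIntegral]
    | cons a t ih =>
      intro hts
      obtain ⟨i1, i2⟩ := ih ((Multiset.le_cons_self t a).trans hts)
      have ha : a ∈ s := Multiset.mem_of_le hts (Multiset.mem_cons_self a t)
      simp only [Multiset.map_cons, Multiset.sum_cons]
      refine ⟨(hI1 a ha).add i1, ?_⟩
      rw [circleIntegral.integral_add (hI1 a ha) i1, i2]
      have := hg.differentiableOn.circleIntegral_sub_inv_smul (hs a ha)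
      simp only [smul_eq_mul] at this
      rw [this]
      ring
  rw [circleIntegral.integral_add (hI2 s le_rfl).1
    ((hI0.continuousOn.mono Metric.sphere_subset_closedBall).circleIntegrable hr.le), (hI2 s le_rfl).2]
  have : (∮ z in C(c, r), g z * logDeriv h z) = 0 :=
    Complex.circleIntegral_eq_zero_of_differentiable_on_off_countable hr.le countable_empty
      hI0.continuousOn fun z hz => (hI0 z (Metric.ball_subset_closedBall hz.1)).differentiableAt
  rw [this, add_zero]

end

/-! ### Zeros depending on parameters, Newton's identities and holomorphic symmetric functions. -/

section

/-- Turns the multiset of roots in a disc into a tuple indexed by `ι`. -/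
lemma exists_fun_map_univ_eq {ι α : Type*} [Fintype ι] (s : Multiset α)
    (h : Multiset.card s = Fintype.card ι) : ∃ x : ι → α, Finset.univ.val.map x = s := by
  induction s using Quotient.inductionOn with
  | h l =>
    have hl : l.length = Fintype.card ι := h
    let e : ι ≃ Fin l.length := Fintype.equivOfCardEq (by simp [hl])
    refine ⟨fun i => l.get (e i), ?_⟩
    have h1 : Finset.univ.val.map (fun i : ι => l.get (e i)) =
        (Finset.univ.val.map e).map l.get := by rw [Multiset.map_map]; rfl
    have h2 : Finset.univ.val.map e = (Finset.univ : Finset (Fin l.length)).val := by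
      simp
    rw [h1, h2]
    simp [Fin.univ_def]

/-- The roots of a holomorphic family of functions near a zero of exact order `card ι`:
their power sums are holomorphic in the parameter. -/
lemma exists_roots {E ι : Type*} [NormedAddCommGroup E] [NormedSpace ℂ E] [Fintype ι]
    {φ : E × ℂ → ℂ} {e₀ : E} {c : ℂ} (hφ : HolAt φ (e₀, c)) {g : ℂ → ℂ} (hg : HolAt g c)
    (hg0 : g c ≠ 0)
    (hord : ∀ᶠ z in 𝓝 c, φ (e₀, z) = (z - c) ^ Fintype.card ι * g z) :
    ∃ x : E → ι → ℂ, Tendsto x (𝓝 e₀) (𝓝 fun _ => c) ∧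
      (∀ k : ℕ, HolAt (fun e => ∑ i, x e i ^ k) e₀) ∧
      ∃ r > 0, ∀ᶠ e in 𝓝 e₀, ∃ h : ℂ → ℂ, AnalyticOnNhd ℂ h (Metric.closedBall c r) ∧
        (∀ z ∈ Metric.closedBall c r, h z ≠ 0) ∧
        ∀ z, φ (e, z) = (∏ i, (z - x e i)) * h z := by
  have hev : ∀ᶠ z in 𝓝 c, HolAt φ (e₀, z) ∧ HolAt g z ∧ g z ≠ 0 ∧
      φ (e₀, z) = (z - c) ^ Fintype.card ι * g z := by
    have h1 : ∀ᶠ z in 𝓝 c, HolAt φ (e₀, z) :=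
      (by fun_prop : ContinuousAt (fun z : ℂ => (e₀, z)) c).eventually (HolAt.eventually hφ)
    filter_upwards [h1, HolAt.eventually hg, hg.continuousAt.eventually_ne hg0, hord]
      with z a1 a2 a3 a4 using ⟨a1, a2, a3, a4⟩
  obtain ⟨R, hR, hb⟩ := Metric.eventually_nhds_iff_ball.1 hev
  obtain ⟨r, hr, hrR⟩ : ∃ r, 0 < r ∧ r < R := ⟨R / 2, half_pos hR, half_lt_self hR⟩
  have hcb : ∀ z ∈ Metric.closedBall c r, z ∈ Metric.ball c R := fun z hz =>
    Metric.closedBall_subset_ball hrR hz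
  have hhol : ∀ᶠ e in 𝓝 e₀, ∀ z ∈ Metric.closedBall c r, HolAt φ (e, z) :=
    (isCompact_closedBall c r).eventually_forall_of_forall_eventually fun z hz =>
      HolAt.eventually (hb z (hcb z hz)).1
  -- For `e₀` the only zero in the disc is `c`, so by compactness nearby parameters have no zero
  -- outside the `ε`-ball. Taking `ε = r` clears the circle; small `ε` gives convergence of the
  -- roots.
  have hne : ∀ ε > 0, ∀ᶠ e in 𝓝 e₀, ∀ z ∈ Metric.closedBall c r \ Metric.ball c ε,
      φ (e, z) ≠ 0 := by
    intro ε hε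
    refine ((isCompact_closedBall c r).diff Metric.isOpen_ball).eventually_forall_of_forall_eventually
      fun z hz => ?_
    have hz' := hb z (hcb z hz.1)
    refine hz'.1.continuousAt.eventually_ne ?_
    rw [hz'.2.2.2]
    refine mul_ne_zero (pow_ne_zero _ (sub_ne_zero.2 ?_)) hz'.2.2.1
    rintro rfl
    exact hz.2 (Metric.mem_ball_self hε)
  have hsph : ∀ z ∈ Metric.sphere c r, z ∈ Metric.closedBall c r \ Metric.ball c r := by
    intro z hz
    rw [Metric.mem_sphere] at hz
    exact ⟨by rw [Metric.mem_closedBall]; exact hz.le, by rw [Metric.mem_ball]; exact hz.not_lt⟩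
  have hslice : ∀ e, (∀ z ∈ Metric.closedBall c r, HolAt φ (e, z)) →
      AnalyticOnNhd ℂ (fun z => φ (e, z)) (Metric.closedBall c r) := by
    intro e he z hz
    rw [← holAt_iff_analyticAt]
    exact HolAt.comp' (g := φ) (he z hz) (holAt_of_differentiable (by fun_prop) z)
  -- By the argument principle this is the `k`-th power sum of the zeros in the disc; as a circle
  -- integral it is holomorphic in the parameter.
  let P : ℕ → E → ℂ := fun k e => (2 * Real.pi * Complex.I)⁻¹ *
    ∮ z in C(c, r), z ^ k * (deriv (fun z => φ (e, z)) z / φ (e, z))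
  have hP : ∀ k, HolAt (P k) e₀ := by
    intro k
    have : HolAt (fun e => ∮ z in C(c, r), z ^ k * (deriv (fun z => φ (e, z)) z / φ (e, z))) e₀ := by
      refine holAt_circleIntegral (f := fun y : E × ℂ =>
        y.2 ^ k * (deriv (fun z => φ (y.1, z)) y.2 / φ y)) hr.le fun ζ hζ => ?_
      have h1 := (hb ζ (hcb ζ (Metric.sphere_subset_closedBall hζ))).1
      refine HolAt.mul (holAt_of_differentiable (by fun_prop) _) (HolAt.div h1.deriv_snd h1 ?_)
      exact (hne r hr).self_of_nhds ζ (hsph ζ hζ)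
    exact HolAt.mul (f := fun _ => (2 * Real.pi * Complex.I : ℂ)⁻¹) (holAt_of_differentiable (by fun_prop) _) this
  have hpi : (2 * Real.pi * Complex.I : ℂ) ≠ 0 := Complex.two_pi_I_ne_zero
  have hfac : ∀ e, (∀ z ∈ Metric.closedBall c r, HolAt φ (e, z)) →
      ∀ (s : Multiset ℂ) (h : ℂ → ℂ), (∀ x ∈ s, x ∈ Metric.ball c r) →
      AnalyticOnNhd ℂ h (Metric.closedBall c r) → (∀ z ∈ Metric.closedBall c r, h z ≠ 0) →
      (∀ z ∈ Metric.ball c R, φ (e, z) = (s.map fun x => z - x).prod * h z) →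
      ∀ k, P k e = (s.map fun x => x ^ k).sum := by
    intro e he s h hs hh hh0 hfh k
    have := circleIntegral_mul_logDeriv (f := fun z => φ (e, z)) (g := fun z => z ^ k) hr s hs hh hh0
      (fun z _ => by fun_prop) (fun z hz => by
        filter_upwards [Metric.isOpen_ball.mem_nhds (hcb z (Metric.sphere_subset_closedBall hz))]
          with w hw using hfh w hw)
    simp only [P]
    rw [this, inv_mul_cancel_left₀ hpi]
  have hP0 : P 0 e₀ = Fintype.card ι := by
    rw [hfac e₀ hhol.self_of_nhds (Multiset.replicate (Fintype.card ι) c) g _ _ _ _ 0]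
    · simp
    · intro x hx
      rw [Multiset.eq_of_mem_replicate hx]
      exact Metric.mem_ball_self hr
    · intro z hz
      exact holAt_iff_analyticAt.1 (hb z (hcb z hz)).2.1
    · exact fun z hz => (hb z (hcb z hz)).2.2.1
    · intro z hz
      rw [(hb z hz).2.2.2]
      simp
  have hclose : ∀ᶠ e in 𝓝 e₀, ‖P 0 e - Fintype.card ι‖ < 1 := by
    have := (hP 0).continuousAt.eventually (Metric.ball_mem_nhds _ one_pos)
    filter_upwards [this] with e he
    rwa [← hP0, ← dist_eq_norm]
  have hgood : ∀ᶠ e in 𝓝 e₀, ∃ x : ι → ℂ, (∀ i, x i ∈ Metric.ball c r) ∧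
      (∀ k, ∑ i, x i ^ k = P k e) ∧
      ∃ h : ℂ → ℂ, AnalyticOnNhd ℂ h (Metric.closedBall c r) ∧
        (∀ z ∈ Metric.closedBall c r, h z ≠ 0) ∧
        ∀ z, φ (e, z) = (∏ i, (z - x i)) * h z := by
    filter_upwards [hhol, hne r hr, hclose] with e h1 h2 h3
    obtain ⟨s, h, hs, hh, hh0, hfh⟩ := exists_eq_prod_mul hr (hslice e h1)
      fun z hz => h2 z (hsph z hz)
    have hPk := hfac e h1 s h hs hh hh0 fun z _ => hfh z
    -- `P 0` counts the zeros, so it is an integer; lying at distance less than `1` from its value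
    -- at `e₀`, it has not changed.
    have hcard : Multiset.card s = Fintype.card ι := by
      rw [hPk 0] at h3
      simp only [pow_zero, Multiset.map_const', Multiset.sum_replicate, nsmul_eq_mul, mul_one] at h3
      have : ‖(((Multiset.card s : ℤ) - (Fintype.card ι : ℤ) : ℤ) : ℂ)‖ < 1 := by
        push_cast
        exact h3
      rw [Complex.norm_intCast] at this
      have h4 : |(Multiset.card s : ℤ) - (Fintype.card ι : ℤ)| < 1 := by exact_mod_cast this
      rw [Int.abs_lt_one_iff] at h4
      omega
    obtain ⟨x, hx⟩ := exists_fun_map_univ_eq s hcard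
    refine ⟨x, fun i => hs _ ?_, fun k => ?_, h, hh, hh0, fun z => ?_⟩
    · rw [← hx]
      exact Multiset.mem_map_of_mem x (Finset.mem_univ_val i)
    · rw [hPk k, ← hx, Multiset.map_map]
      rfl
    · rw [hfh z, ← hx, Multiset.map_map]
      rfl
  classical
  -- The ordering of the roots is chosen separately for each parameter, so only symmetric functions
  -- of `x e` can be expected to be holomorphic.
  let x : E → ι → ℂ := fun e => if H : _ then (Classical.choose (p := fun x : ι → ℂ =>
      (∀ i, x i ∈ Metric.ball c r) ∧ (∀ k, ∑ i, x i ^ k = P k e) ∧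
      ∃ h : ℂ → ℂ, AnalyticOnNhd ℂ h (Metric.closedBall c r) ∧
        (∀ z ∈ Metric.closedBall c r, h z ≠ 0) ∧
        ∀ z, φ (e, z) = (∏ i, (z - x i)) * h z) H) else fun _ => c
  have hx : ∀ᶠ e in 𝓝 e₀, (∀ i, x e i ∈ Metric.ball c r) ∧ (∀ k, ∑ i, x e i ^ k = P k e) ∧
      ∃ h : ℂ → ℂ, AnalyticOnNhd ℂ h (Metric.closedBall c r) ∧
        (∀ z ∈ Metric.closedBall c r, h z ≠ 0) ∧
        ∀ z, φ (e, z) = (∏ i, (z - x e i)) * h z := by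
    filter_upwards [hgood] with e he
    have : x e = Classical.choose he := dif_pos he
    rw [this]
    exact Classical.choose_spec he
  refine ⟨x, ?_, fun k => ?_, r, hr, hx.mono fun e he => he.2.2⟩
  · rw [tendsto_pi_nhds]
    intro i
    rw [Metric.tendsto_nhds]
    intro ε hε
    filter_upwards [hx, hne ε hε] with e h1 h2
    by_contra hcon
    refine h2 (x e i) ⟨Metric.ball_subset_closedBall (h1.1 i), hcon⟩ ?_
    obtain ⟨h, -, -, hh⟩ := h1.2.2
    rw [hh, Finset.prod_eq_zero (Finset.mem_univ i) (sub_self _), zero_mul]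
  · exact (hP k).congr (hx.mono fun e he => (he.2.1 k).symm)

/-- A product `∏ (ζ - xᵢ)` is a polynomial in `ζ` and the power sums of the `xᵢ`. -/
lemma exists_esymm_of_psum (m : ℕ) (k : ℕ) (hk : k ≤ m) : ∃ Q : (Fin m → ℂ) → ℂ,
    Differentiable ℂ Q ∧ ∀ x : Fin m → ℂ,
      Q (fun j => ∑ i, x i ^ (j.1 + 1)) = MvPolynomial.aeval x (MvPolynomial.esymm (Fin m) ℂ k) := by
  induction k using Nat.strong_induction_on with
  | _ k ih =>
    rcases Nat.eq_zero_or_pos k with rfl | hpos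
    · exact ⟨fun _ => 1, by fun_prop, fun x => by simp⟩
    have : ∀ a : Finset.HasAntidiagonal.antidiagonal k, ∃ Q : (Fin m → ℂ) → ℂ, Differentiable ℂ Q ∧ (a.1.1 < k →
        ∀ x : Fin m → ℂ, Q (fun j => ∑ i, x i ^ (j.1 + 1)) =
          MvPolynomial.aeval x (MvPolynomial.esymm (Fin m) ℂ a.1.1 * MvPolynomial.psum (Fin m) ℂ a.1.2)) := by
      rintro ⟨⟨a, b⟩, hab⟩
      rw [Finset.HasAntidiagonal.mem_antidiagonal] at hab
      by_cases hak : a < k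
      · obtain ⟨Q, hQ, hQx⟩ := ih a hak (hak.le.trans hk)
        simp only at hab
        -- Entry `j` holds the power sum of exponent `j + 1`, so exponent `b` sits at `b - 1`; here
        -- `b ≥ 1` because `a < k`.
        refine ⟨fun s => Q s * s ⟨b - 1, by omega⟩, by fun_prop, fun _ x => ?_⟩
        have hb : b - 1 + 1 = b := by omega
        simp only [hQx, map_mul, hb, MvPolynomial.psum, map_sum, map_pow, MvPolynomial.aeval_X]
      · exact ⟨fun _ => 0, by fun_prop, fun h => absurd h hak⟩
    choose Q hQ hQx using this
    -- Newton's identity solved for the `k`-th elementary symmetric function; the `if` reproduces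
    -- its range of summation.
    refine ⟨fun s => (k : ℂ)⁻¹ * ((-1) ^ (k + 1) * ∑ a ∈ (Finset.HasAntidiagonal.antidiagonal k).attach,
      if a.1.1 < k then (-1) ^ a.1.1 * Q a s else 0), ?_, fun x => ?_⟩
    · refine Differentiable.const_mul (Differentiable.const_mul (Differentiable.fun_sum fun a _ => ?_) _) _
      split_ifs
      · exact (hQ a).const_mul _
      · fun_prop
    · have hN := congrArg (MvPolynomial.aeval x) (MvPolynomial.mul_esymm_eq_sum (Fin m) ℂ k)
      have hk0 : (k : ℂ) ≠ 0 := by exact_mod_cast hpos.ne'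
      rw [map_mul, map_natCast] at hN
      rw [inv_mul_eq_iff_eq_mul₀ hk0, hN, Finset.sum_filter, map_mul, map_pow, map_neg, map_one, map_sum]
      congr 1
      conv_rhs => rw [← Finset.sum_attach]
      refine Finset.sum_congr rfl fun a _ => ?_
      split_ifs with h
      · rw [hQx a h x]
        simp [mul_assoc]
      · simp

/-- By Vieta the coefficients of the product are elementary symmetric functions of the `xᵢ`, which
Newton's identities express through the power sums. -/
lemma exists_prod_of_psum (m : ℕ) : ∃ Q : (Fin m → ℂ) × ℂ → ℂ, Differentiable ℂ Q ∧
    ∀ (x : Fin m → ℂ) (ζ : ℂ), Q (fun j => ∑ i, x i ^ (j.1 + 1), ζ) = ∏ i, (ζ - x i) := by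
  have : ∀ k : Fin (m + 1), ∃ Q : (Fin m → ℂ) → ℂ,
    Differentiable ℂ Q ∧ ∀ x : Fin m → ℂ,
      Q (fun j => ∑ i, x i ^ (j.1 + 1)) = MvPolynomial.aeval x (MvPolynomial.esymm (Fin m) ℂ k) :=
    fun k => exists_esymm_of_psum m k (Nat.lt_succ_iff.1 k.2)
  choose Q hQ hQx using this
  refine ⟨fun y => ∑ k : Fin (m + 1), (-1) ^ k.1 * (Q k y.1 * y.2 ^ (m - k.1)), ?_, fun x ζ => ?_⟩
  · have : ∀ k, Differentiable ℂ fun y : (Fin m → ℂ) × ℂ => Q k y.1 := fun k =>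
      (hQ k).comp differentiable_fst
    fun_prop
  · have h := Multiset.prod_X_sub_X_eq_sum_esymm (Finset.univ.val.map x)
    have h2 := congrArg (Polynomial.eval ζ) h
    simp only [Polynomial.eval_multiset_prod, Multiset.map_map, Polynomial.eval_finsetSum] at h2
    have h3 : ∏ i, (ζ - x i) = (Multiset.map (fun i => ζ - x i) Finset.univ.val).prod := rfl
    simp only [hQx]
    rw [h3]
    simp only [Function.comp_def, Polynomial.eval_sub, Polynomial.eval_X, Polynomial.eval_C,
      Multiset.card_map, Finset.card_val, Finset.card_univ, Fintype.card_fin, Polynomial.eval_mul,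
      Polynomial.eval_pow, Polynomial.eval_neg, Polynomial.eval_one] at h2
    rw [h2, Finset.sum_range]
    refine Finset.sum_congr rfl fun k _ => ?_
    rw [MvPolynomial.aeval_esymm_eq_multiset_esymm]


/-- The power sums `∑ xᵢ^(j+1)`, `j < m`, of `m` numbers. -/
def powerSums (m : ℕ) (x : Fin m → ℂ) : Fin m → ℂ := fun j => ∑ i, x i ^ (j.1 + 1)

lemma differentiable_powerSums (m : ℕ) : Differentiable ℂ (powerSums m) := by
  rw [differentiable_pi]
  intro j
  unfold powerSums
  fun_prop

lemma powerSums_comp_perm {m : ℕ} (x : Fin m → ℂ) (w : Equiv.Perm (Fin m)) :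
    powerSums m (x ∘ w) = powerSums m x := by
  ext j
  exact Equiv.sum_comp w fun i => x i ^ (j.1 + 1)

/-- A holomorphic function which is symmetric near a point is a holomorphic function of the
power sums of the coordinates. -/
theorem exists_eq_comp_powerSums.{u} (m : ℕ) : ∀ {E : Type u} [NormedAddCommGroup E] [NormedSpace ℂ E]
    (f : (Fin m → ℂ) × E → ℂ) (c : Fin m → ℂ) (e₀ : E), HolAt f (c, e₀) →
    (∀ w : Equiv.Perm (Fin m), c ∘ w = c → ∀ᶠ y in 𝓝 (c, e₀), f (y.1 ∘ w, y.2) = f y) →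
    ∃ G : (Fin m → ℂ) × E → ℂ, HolAt G (powerSums m c, e₀) ∧
      ∀ᶠ y in 𝓝 (c, e₀), f y = G (powerSums m y.1, y.2) := by
  induction m with
  | zero =>
    intro E _ _ f c e₀ hf _
    refine ⟨f, ?_, Eventually.of_forall fun y => ?_⟩
    · rwa [Subsingleton.elim (powerSums 0 c) c]
    · rw [Subsingleton.elim (powerSums 0 y.1) y.1]
  | succ m ih =>
    intro E _ _ f c e₀ hf hsymm
    set c0 := c 0 with hc0
    set c' : Fin m → ℂ := Fin.tail c with hc'
    have hcc : Fin.cons c0 c' = c := Fin.cons_self_tail c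
    have hcons : Differentiable ℂ fun y : (Fin m → ℂ) × (ℂ × E) =>
        ((Fin.cons y.2.1 y.1 : Fin (m + 1) → ℂ), y.2.2) := by
      refine Differentiable.prodMk ?_ (by fun_prop)
      rw [differentiable_pi]
      intro i
      refine Fin.cases ?_ (fun j => ?_) i
      · simp only [Fin.cons_zero]; fun_prop
      · simp only [Fin.cons_succ]; fun_prop
    have htend : Tendsto (fun y : (Fin m → ℂ) × (ℂ × E) =>
        ((Fin.cons y.2.1 y.1 : Fin (m + 1) → ℂ), y.2.2)) (𝓝 (c', (c0, e₀))) (𝓝 (c, e₀)) := by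
      have := hcons.continuous.tendsto (c', (c0, e₀))
      simpa only [hcc] using this
    -- Coordinate `0` joins the parameters. Permutations fixing `c'` extend to permutations fixing
    -- `c`, so the induction hypothesis handles the other coordinates.
    obtain ⟨G1, hG1, hG1f⟩ := ih (E := ℂ × E)
      (fun y => f ((Fin.cons y.2.1 y.1 : Fin (m + 1) → ℂ), y.2.2)) c' (c0, e₀)
      (HolAt.comp' (g := f) (by simpa only [hcc] using hf) (holAt_of_differentiable hcons _)) (by
        intro w hw
        have hperm : ∀ (ζ : ℂ) (x : Fin m → ℂ), (Fin.cons ζ (x ∘ w) : Fin (m + 1) → ℂ) =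
            (Fin.cons ζ x : Fin (m + 1) → ℂ) ∘ Equiv.Perm.decomposeFin.symm (0, w) := by
          intro ζ x
          ext i
          refine Fin.cases ?_ (fun j => ?_) i
          · simp
          · simp
        have := hsymm (Equiv.Perm.decomposeFin.symm (0, w)) (by rw [← hcc, ← hperm, hw])
        filter_upwards [htend.eventually this] with y hy
        rw [hperm]
        exact hy)
    -- Recovers the power sums of the other `m` coordinates from those of all `m + 1`, once the
    -- removed coordinate `ζ` is known.
    let T : ℂ → (Fin (m + 1) → ℂ) → Fin m → ℂ := fun ζ s j => s j.castSucc - ζ ^ (j.1 + 1)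
    have hT : ∀ (ζ : ℂ) (x : Fin m → ℂ),
        T ζ (powerSums (m + 1) (Fin.cons ζ x)) = powerSums m x := by
      intro ζ x
      ext j
      simp [T, powerSums, Fin.sum_univ_succ]
    let H : ((Fin (m + 1) → ℂ) × E) × ℂ → ℂ := fun y => G1 (T y.2 y.1.1, (y.2, y.1.2))
    have hTd : Differentiable ℂ fun y : ((Fin (m + 1) → ℂ) × E) × ℂ =>
        (T y.2 y.1.1, (y.2, y.1.2)) := by
      refine Differentiable.prodMk ?_ (by fun_prop)
      rw [differentiable_pi]
      intro j
      simp only [T]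
      fun_prop
    have hHhol : HolAt H ((powerSums (m + 1) c, e₀), c0) := by
      refine HolAt.comp' (g := G1) ?_ (holAt_of_differentiable hTd _)
      simp only
      rw [← hcc, hT]
      exact hG1
    -- When `c i = c 0`, swapping `0` and `i` fixes `c`, so in `f = H(power sums, removed
    -- coordinate)` any coordinate of the cluster of `c 0` may be the removed one.
    have hHf : ∀ᶠ y in 𝓝 (c, e₀), ∀ i, c i = c0 → f y = H ((powerSums (m + 1) y.1, y.2), y.1 i) := by
      rw [eventually_all]
      intro i
      rw [eventually_imp_distrib_left]
      intro hi
      have hsw : c ∘ Equiv.swap 0 i = c := by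
        ext j
        simp only [Function.comp_apply]
        rcases eq_or_ne j 0 with rfl | h0
        · rw [Equiv.swap_apply_left, hi]
        rcases eq_or_ne j i with rfl | h1
        · rw [Equiv.swap_apply_right, hi]
        rw [Equiv.swap_apply_of_ne_of_ne h0 h1]
      have ht2 : Tendsto (fun y : (Fin (m + 1) → ℂ) × E =>
          (Fin.tail (y.1 ∘ Equiv.swap 0 i), (y.1 i, y.2))) (𝓝 (c, e₀)) (𝓝 (c', (c0, e₀))) := by
        have hcont : Continuous fun y : (Fin (m + 1) → ℂ) × E =>
            (Fin.tail (y.1 ∘ Equiv.swap 0 i), (y.1 i, y.2)) := by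
          refine Continuous.prodMk (continuous_pi fun j => ?_) (by fun_prop)
          simp only [Fin.tail, Function.comp_apply]
          fun_prop
        have := hcont.tendsto (c, e₀)
        simpa only [hsw, hi] using this
      filter_upwards [hsymm _ hsw, ht2.eventually hG1f] with y h1 h2
      have h3 : (Fin.cons (y.1 i) (Fin.tail (y.1 ∘ Equiv.swap 0 i)) : Fin (m + 1) → ℂ) =
          y.1 ∘ Equiv.swap 0 i := by
        have := Fin.cons_self_tail (y.1 ∘ Equiv.swap 0 i)
        simpa using this
      simp only [h3] at h2
      rw [← h1, h2]
      simp only [H]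
      rw [← hT (y.1 i), h3, powerSums_comp_perm]
    obtain ⟨Q, hQ, hQx⟩ := exists_prod_of_psum (m + 1)
    have hev : ∀ᶠ ζ in 𝓝 c0, HolAt H ((powerSums (m + 1) c, e₀), ζ) ∧ ∀ i, c i ≠ c0 → c i ≠ ζ := by
      refine Eventually.and ?_ (eventually_all.2 fun i => ?_)
      · exact (by fun_prop : ContinuousAt (fun ζ : ℂ => ((powerSums (m + 1) c, e₀), ζ)) c0).eventually
          (HolAt.eventually hHhol)
      · rw [eventually_imp_distrib_left]
        intro hi
        exact (continuousAt_id.eventually_ne hi.symm).mono fun z hz => hz.symm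
    obtain ⟨R, hR, hb⟩ := Metric.eventually_nhds_iff_ball.1 hev
    obtain ⟨r, hr, hrR⟩ : ∃ r, 0 < r ∧ r < R := ⟨R / 2, half_pos hR, half_lt_self hR⟩
    have hcb : ∀ z ∈ Metric.closedBall c0 r, z ∈ Metric.ball c0 R := fun z hz =>
      Metric.closedBall_subset_ball hrR hz
    classical
    let S : Finset (Fin (m + 1)) := Finset.univ.filter fun i => c i = c0
    have hS : (S.card : ℂ) ≠ 0 := by
      have : 0 < S.card := Finset.card_pos.2 ⟨0, by simp [S, hc0]⟩
      exact_mod_cast this.ne'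
    -- The average of `H` over the roots near `c0`, written as a residue integral against the
    -- logarithmic derivative of `∏ (ζ - xᵢ)`. The integrand involves only power sums, so `G` is
    -- holomorphic in them; every term of the average equals `f`.
    let G : (Fin (m + 1) → ℂ) × E → ℂ := fun y => (S.card : ℂ)⁻¹ * ((2 * Real.pi * Complex.I)⁻¹ *
      ∮ ζ in C(c0, r), H (y, ζ) * (deriv (fun z => Q (y.1, z)) ζ / Q (y.1, ζ)))
    refine ⟨G, ?_, ?_⟩
    · refine HolAt.mul (f := fun _ => (S.card : ℂ)⁻¹) (holAt_of_differentiable (by fun_prop) _) ?_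
      refine HolAt.mul (f := fun _ => (2 * Real.pi * Complex.I : ℂ)⁻¹)
        (holAt_of_differentiable (by fun_prop) _) ?_
      refine holAt_circleIntegral (f := fun y : ((Fin (m + 1) → ℂ) × E) × ℂ =>
        H (y.1, y.2) * (deriv (fun z => Q (y.1.1, z)) y.2 / Q (y.1.1, y.2))) hr.le fun ζ hζ => ?_
      have hζ' := hb ζ (hcb ζ (Metric.sphere_subset_closedBall hζ))
      have hp : Differentiable ℂ fun y : ((Fin (m + 1) → ℂ) × E) × ℂ => (y.1.1, y.2) := by fun_prop
      have hQhol : HolAt Q (powerSums (m + 1) c, ζ) := holAt_of_differentiable hQ _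
      refine HolAt.mul hζ'.1 (HolAt.div ?_ ?_ ?_)
      · exact HolAt.comp' (g := fun x : (Fin (m + 1) → ℂ) × ℂ => deriv (fun z => Q (x.1, z)) x.2)
          (f := fun y : ((Fin (m + 1) → ℂ) × E) × ℂ => (y.1.1, y.2))
          (x := ((powerSums (m + 1) c, e₀), ζ)) hQhol.deriv_snd (holAt_of_differentiable hp _)
      · exact HolAt.comp' (g := Q) (f := fun y : ((Fin (m + 1) → ℂ) × E) × ℂ => (y.1.1, y.2))
          (x := ((powerSums (m + 1) c, e₀), ζ)) hQhol (holAt_of_differentiable hp _)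
      · have : Q (powerSums (m + 1) c, ζ) = ∏ i, (ζ - c i) := hQx c ζ
        simp only [this]
        rw [Finset.prod_ne_zero_iff]
        intro i _
        rw [sub_ne_zero]
        by_cases hi : c i = c0
        · rintro rfl
          rw [hi, Metric.mem_sphere, dist_self] at hζ
          exact hr.ne hζ
        · exact (hζ'.2 i hi).symm
    · have hhol : ∀ᶠ y in 𝓝 (c, e₀), ∀ ζ ∈ Metric.closedBall c0 r,
          HolAt H ((powerSums (m + 1) y.1, y.2), ζ) := by
        have h1 : ∀ᶠ y in 𝓝 (powerSums (m + 1) c, e₀), ∀ ζ ∈ Metric.closedBall c0 r, HolAt H (y, ζ) :=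
          (isCompact_closedBall c0 r).eventually_forall_of_forall_eventually fun z hz =>
            HolAt.eventually (hb z (hcb z hz)).1
        have hcont : Continuous fun y : (Fin (m + 1) → ℂ) × E => (powerSums (m + 1) y.1, y.2) := by
          have := (differentiable_powerSums (m + 1)).continuous
          fun_prop
        exact (hcont.tendsto (c, e₀)).eventually h1
      have hin : ∀ᶠ y : (Fin (m + 1) → ℂ) × E in 𝓝 (c, e₀), ∀ i, c i = c0 → y.1 i ∈ Metric.ball c0 r := by
        refine eventually_all.2 fun i => ?_
        rw [eventually_imp_distrib_left]
        intro hi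
        refine (by fun_prop : ContinuousAt (fun y : (Fin (m + 1) → ℂ) × E => y.1 i) (c, e₀)).eventually ?_
        simp only [hi]
        exact Metric.ball_mem_nhds c0 hr
      have hout : ∀ᶠ y : (Fin (m + 1) → ℂ) × E in 𝓝 (c, e₀), ∀ i, c i ≠ c0 →
          y.1 i ∉ Metric.closedBall c0 r := by
        refine eventually_all.2 fun i => ?_
        rw [eventually_imp_distrib_left]
        intro hi
        have hmem : (Metric.closedBall c0 r)ᶜ ∈ 𝓝 (c i) :=
          Metric.isClosed_closedBall.isOpen_compl.mem_nhds fun hmem =>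
            (hb _ (hcb _ hmem)).2 i hi rfl
        exact (by fun_prop : ContinuousAt (fun y : (Fin (m + 1) → ℂ) × E => y.1 i) (c, e₀)).eventually
          hmem
      filter_upwards [hHf, hhol, hin, hout] with y h1 h2 h3 h4
      have hint := circleIntegral_mul_logDeriv
        (f := fun z => Q (powerSums (m + 1) y.1, z)) (g := fun z => H ((powerSums (m + 1) y.1, y.2), z))
        (h := fun z => ∏ i ∈ Sᶜ, (z - y.1 i)) hr (S.val.map y.1) (by
          intro x hx
          obtain ⟨i, hi, rfl⟩ := Multiset.mem_map.1 hx
          exact h3 i (by simpa [S] using hi)) (by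
          intro z _
          exact Finset.analyticAt_fun_prod _ fun i _ => by fun_prop) (by
          intro z hz
          rw [Finset.prod_ne_zero_iff]
          intro i hi
          rw [sub_ne_zero]
          rintro rfl
          exact h4 i (by simpa [S] using hi) hz) (by
          intro z hz
          rw [← holAt_iff_analyticAt]
          exact HolAt.comp' (g := H) (h2 z hz) (holAt_of_differentiable (by fun_prop) z)) (by
          intro z _
          refine Eventually.of_forall fun w => ?_
          have : Q (powerSums (m + 1) y.1, w) = ∏ i, (w - y.1 i) := hQx y.1 w
          simp only [this]
          rw [← Finset.prod_mul_prod_compl S, Multiset.map_map]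
          rfl)
      have hsum : (Multiset.map (fun z => H ((powerSums (m + 1) y.1, y.2), z)) (S.val.map y.1)).sum =
          S.card * f y := by
        rw [Multiset.map_map]
        change ∑ i ∈ S, H ((powerSums (m + 1) y.1, y.2), y.1 i) = _
        rw [Finset.sum_congr rfl fun i hi => (h1 i (by simpa [S] using hi)).symm]
        simp
      simp only [G]
      rw [hint, hsum, inv_mul_cancel_left₀ Complex.two_pi_I_ne_zero, inv_mul_cancel_left₀ hS]

end

section

/-! ### Entire functions and lattices -/

lemma mem_tauLattice {τ : ℍ} {x : ℂ} :
    x ∈ (tauPeriods τ).lattice ↔ ∃ m k : ℤ, x = m + k * (τ : ℂ) := by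
  rw [PeriodPair.mem_lattice]
  simp only [tauPeriods, mul_one]
  exact ⟨fun ⟨m, k, h⟩ => ⟨m, k, h.symm⟩, fun ⟨m, k, h⟩ => ⟨m, k, h.symm⟩⟩

/-- The factor can be cancelled near one point where it does not vanish, and the identity theorem
does the rest. -/
lemma eq_of_mul_eq_mul {f g p : ℂ → ℂ} (hf : Differentiable ℂ f) (hg : Differentiable ℂ g)
    (hp : Differentiable ℂ p) {z₀ : ℂ} (h0 : p z₀ ≠ 0) (h : ∀ z, p z * f z = p z * g z) (z : ℂ) :
    f z = g z := by
  have hfg : f =ᶠ[𝓝 z₀] g := by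
    filter_upwards [hp.continuous.continuousAt.eventually_ne h0] with w hw
    exact mul_left_cancel₀ hw (h w)
  exact congrFun (AnalyticOnNhd.eq_of_eventuallyEq (fun w _ => hf.analyticAt w)
    (fun w _ => hg.analyticAt w) hfg) z

/-- An entire function that vanishes on the simple zeros of another one is divisible by it. -/
lemma exists_entire_quotient {f g : ℂ → ℂ} (hf : Differentiable ℂ f) (hg : Differentiable ℂ g)
    (hs : ∀ z, g z = 0 → deriv g z ≠ 0) (h0 : ∀ z, g z = 0 → f z = 0) :
    ∃ h : ℂ → ℂ, Differentiable ℂ h ∧ ∀ z, f z = g z * h z := by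
  classical
  -- At a zero of `g` the value is the limit of the quotient. Near it the quotient is the ratio of
  -- the two `dslope`s, which is differentiable since the zero is simple.
  refine ⟨fun z => if g z = 0 then deriv f z / deriv g z else f z / g z, fun w => ?_, fun z => ?_⟩
  · by_cases hw : g w = 0
    · have hdf : ∀ {f : ℂ → ℂ}, Differentiable ℂ f → DifferentiableAt ℂ (dslope f w) w :=
        fun hf => ((Complex.differentiableOn_dslope univ_mem).2 hf.differentiableOn).differentiableAt
          univ_mem
      have hne : ∀ᶠ z in 𝓝[≠] w, g z ≠ 0 := by
        have := (hg w).hasDerivAt.eventually_ne (c := 0) (hs w hw)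
        simpa using this
      have hquot : DifferentiableAt ℂ (fun z => dslope f w z / dslope g w z) w :=
        (hdf hf).div (hdf hg) (by rw [dslope_same]; exact hs w hw)
      refine hquot.congr_of_eventuallyEq ?_
      filter_upwards [eventually_nhdsWithin_iff.1 hne] with z hz
      rcases eq_or_ne z w with rfl | hzw
      · simp [hw, dslope_same]
      replace hz := hz hzw
      have hzw' : z - w ≠ 0 := sub_ne_zero.2 hzw
      simp only [hz, if_false]
      have h1 := sub_smul_dslope f w z
      have h2 := sub_smul_dslope g w z
      rw [h0 w hw, sub_zero, smul_eq_mul] at h1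
      rw [hw, sub_zero, smul_eq_mul] at h2
      rw [← h1, ← h2, mul_div_mul_left _ _ hzw']
    · have hev : ∀ᶠ z in 𝓝 w, g z ≠ 0 := (hg w).continuousAt.eventually_ne hw
      refine ((hf w).div (hg w) hw).congr_of_eventuallyEq ?_
      filter_upwards [hev] with z hz
      simp [hz]
  · by_cases hz : g z = 0
    · simp [hz, h0 z hz]
    · simp only [hz, if_false]
      field_simp

/-- Integer and fractional parts of the real coordinates with respect to the basis `1, τ`: every
point is congruent to one of the closed fundamental parallelogram. -/
lemma exists_eq_add_mul_tau (τ : ℍ) (z : ℂ) : ∃ (s t : ℝ) (m k : ℤ),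
    s ∈ Icc (0 : ℝ) 1 ∧ t ∈ Icc (0 : ℝ) 1 ∧ z = (s + t * (τ : ℂ)) + m + k * (τ : ℂ) := by
  set y := z.im / τ.im with hy
  set x := z.re - y * τ.re with hx
  refine ⟨Int.fract x, Int.fract y, ⌊x⌋, ⌊y⌋, ⟨Int.fract_nonneg _, (Int.fract_lt_one _).le⟩,
    ⟨Int.fract_nonneg _, (Int.fract_lt_one _).le⟩, ?_⟩
  have e1 : (Int.fract x : ℝ) = x - ⌊x⌋ := rfl
  have e2 : (Int.fract y : ℝ) = y - ⌊y⌋ := rfl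
  have hy' : y * τ.im = z.im := by rw [hy]; field_simp [τ.im_pos.ne']
  apply Complex.ext
  · simp [-Int.self_sub_floor]
    rw [e1, e2]
    linarith
  · simp [-Int.self_sub_floor]
    rw [e2]
    linarith

lemma periodic_int {α : Type*} {f : ℂ → α} {τ : ℂ} (h1 : ∀ z, f (z + 1) = f z)
    (h2 : ∀ z, f (z + τ) = f z) (m k : ℤ) (z : ℂ) : f (z + m + k * τ) = f z := by
  have a1 : Function.Periodic f 1 := h1
  have a2 : Function.Periodic f τ := h2
  rw [a2.int_mul k]
  simpa using a1.int_mul m z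

/-- A continuous doubly periodic function is bounded. -/
lemma exists_bound_of_periodic {F : Type*} [NormedAddCommGroup F] {f : ℂ → F} {τ : ℍ}
    (hf : Continuous f) (h1 : ∀ z, f (z + 1) = f z) (h2 : ∀ z, f (z + τ) = f z) :
    ∃ M, ∀ z, ‖f z‖ ≤ M := by
  have hK : IsCompact ((fun p : ℝ × ℝ => ((p.1 : ℂ) + p.2 * (τ : ℂ))) '' (Icc 0 1 ×ˢ Icc 0 1)) :=
    (isCompact_Icc.prod isCompact_Icc).image (by fun_prop)
  obtain ⟨M, hM⟩ := hK.exists_bound_of_continuousOn hf.continuousOn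
  refine ⟨M, fun z => ?_⟩
  obtain ⟨s, t, m, k, hs, ht, rfl⟩ := exists_eq_add_mul_tau τ z
  rw [periodic_int h1 h2]
  exact hM _ ⟨(s, t), ⟨hs, ht⟩, rfl⟩

/-- Liouville's theorem, as a continuous doubly periodic function is bounded. -/
lemma exists_eq_const_of_periodic {f : ℂ → ℂ} {τ : ℍ} (hf : Differentiable ℂ f)
    (h1 : ∀ z, f (z + 1) = f z) (h2 : ∀ z, f (z + τ) = f z) : ∃ C, ∀ z, f z = C := by
  obtain ⟨M, hM⟩ := exists_bound_of_periodic hf.continuous h1 h2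
  exact hf.exists_const_forall_eq_of_bounded
    (isBounded_iff_forall_norm_le.2 ⟨M, by rintro _ ⟨z, rfl⟩; exact hM z⟩)

/-! ### The theta function -/

lemma differentiableAt_theta1 (z : ℂ) {τ : ℂ} (hτ : 0 < τ.im) :
    DifferentiableAt ℂ (fun p : ℂ × ℂ => theta1 p.1 p.2) (z, τ) := by
  unfold theta1
  refine DifferentiableAt.mul (by fun_prop) ?_
  exact DifferentiableAt.comp (z, τ) (f := fun p : ℂ × ℂ => (p.1 + 1 / 2 + p.2 / 2, p.2))
    (g := fun p : ℂ × ℂ => jacobiTheta₂ p.1 p.2)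
    (hasFDerivAt_jacobiTheta₂ (z + 1 / 2 + τ / 2) hτ).differentiableAt (by fun_prop)

lemma differentiable_theta1 (τ : ℍ) : Differentiable ℂ fun z => theta1 z τ := by
  intro z
  exact (differentiableAt_theta1 z τ.im_pos).comp z
    (by fun_prop : DifferentiableAt ℂ (fun z : ℂ => (z, (τ : ℂ))) z)

lemma theta1_add_one (z τ : ℂ) : theta1 (z + 1) τ = -theta1 z τ := by
  unfold theta1
  have h1 : z + 1 + 1 / 2 + τ / 2 = z + 1 / 2 + τ / 2 + 1 := by ring
  have h2 : (Real.pi * Complex.I * τ / 4 + Real.pi * Complex.I * (z + 1) : ℂ) =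
      (Real.pi * Complex.I * τ / 4 + Real.pi * Complex.I * z) + Real.pi * Complex.I := by ring
  rw [h1, jacobiTheta₂_add_left, h2, Complex.exp_add, Complex.exp_pi_mul_I]
  ring

lemma theta1_add_tau (z τ : ℂ) : theta1 (z + τ) τ =
    -Complex.exp (-(Real.pi * Complex.I * τ) - 2 * Real.pi * Complex.I * z) * theta1 z τ := by
  unfold theta1
  have h1 : z + τ + 1 / 2 + τ / 2 = z + 1 / 2 + τ / 2 + τ := by ring
  rw [h1, jacobiTheta₂_add_left']
  have h3 : (-1 : ℂ) = Complex.exp (-(Real.pi * Complex.I)) := by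
    rw [Complex.exp_neg, Complex.exp_pi_mul_I]; norm_num
  have h2 : Complex.exp (Real.pi * Complex.I * τ / 4 + Real.pi * Complex.I * (z + τ)) *
      Complex.exp (-Real.pi * Complex.I * (τ + 2 * (z + 1 / 2 + τ / 2))) =
      (-1) * Complex.exp (-(Real.pi * Complex.I * τ) - 2 * Real.pi * Complex.I * z) *
      Complex.exp (Real.pi * Complex.I * τ / 4 + Real.pi * Complex.I * z) := by
    rw [h3, ← Complex.exp_add, ← Complex.exp_add, ← Complex.exp_add]
    congr 1
    ring
  linear_combination (-Complex.I * jacobiTheta₂ (z + 1 / 2 + τ / 2) τ) * h2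

/-- The points `1/2 - τ/2` and `1/2 + τ/2` agree up to sign and an integer, so `jacobiTheta₂` takes
the same value at both. They also differ by `τ`, with multiplier `-1` there; so this value is its
own negative. -/
lemma theta1_zero (τ : ℂ) : theta1 0 τ = 0 := by
  have h := jacobiTheta₂_add_left' (1 / 2 - τ / 2) τ
  have h1 : jacobiTheta₂ (1 / 2 - τ / 2) τ = jacobiTheta₂ (1 / 2 + τ / 2) τ := by
    rw [← jacobiTheta₂_neg_left, ← jacobiTheta₂_add_left]
    congr 1; ring
  have h2 : (1 / 2 - τ / 2 : ℂ) + τ = 1 / 2 + τ / 2 := by ring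
  have h3 : Complex.exp (-Real.pi * Complex.I * (τ + 2 * (1 / 2 - τ / 2))) = -1 := by
    have : (-Real.pi * Complex.I * (τ + 2 * (1 / 2 - τ / 2)) : ℂ) = -(Real.pi * Complex.I) := by ring
    rw [this, Complex.exp_neg, Complex.exp_pi_mul_I]; norm_num
  rw [h2, h3, h1] at h
  have : jacobiTheta₂ (1 / 2 + τ / 2) τ = 0 := by linear_combination h / 2
  unfold theta1
  rw [zero_add, this, mul_zero]

/-- The zeroth Fourier coefficient of `jacobiTheta₂` in `z`, computed by integrating termwise over
`[0, 1]`, is `1`. -/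
lemma exists_theta1_ne_zero (τ : ℍ) : ∃ z, theta1 z τ ≠ 0 := by
  by_contra! hcon
  have hz : ∀ z, jacobiTheta₂ z τ = 0 := by
    intro z
    have := hcon (z - 1 / 2 - (τ : ℂ) / 2)
    unfold theta1 at this
    have h1 : z - 1 / 2 - (τ : ℂ) / 2 + 1 / 2 + (τ : ℂ) / 2 = z := by ring
    rw [h1] at this
    simpa [Complex.exp_ne_zero, Complex.I_ne_zero] using this
  have hc : ∀ n : ℤ, Continuous fun t : ℝ => jacobiTheta₂_term n (t : ℂ) τ := by
    intro n
    unfold jacobiTheta₂_term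
    fun_prop
  have hnorm : ∀ (n : ℤ) (t : ℝ), ‖jacobiTheta₂_term n (t : ℂ) τ‖ = ‖jacobiTheta₂_term n 0 τ‖ := by
    intro n t
    rw [norm_jacobiTheta₂_term, norm_jacobiTheta₂_term]
    simp
  have hint : ∀ n : ℤ, (∫ t in (0 : ℝ)..1, jacobiTheta₂_term n (t : ℂ) τ) = if n = 0 then 1 else 0 := by
    intro n
    split_ifs with hn
    · subst hn
      simp [jacobiTheta₂_term]
    · have hc0 : (2 * Real.pi * Complex.I * n : ℂ) ≠ 0 := by
        simp [Real.pi_ne_zero, hn]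
      have : ∀ t : ℝ, jacobiTheta₂_term n (t : ℂ) τ =
          Complex.exp (Real.pi * Complex.I * n ^ 2 * τ) * Complex.exp ((2 * Real.pi * Complex.I * n) * t) := by
        intro t
        rw [jacobiTheta₂_term, Complex.exp_add, mul_comm]
      simp_rw [this]
      rw [intervalIntegral.integral_const_mul, integral_exp_mul_complex hc0]
      have h1 : Complex.exp (2 * Real.pi * Complex.I * n * (1 : ℝ)) = 1 := by
        have := Complex.exp_int_mul_two_pi_mul_I n
        rw [← this]
        congr 1
        push_cast
        ring
      rw [h1]
      simp
  have hsum := intervalIntegral.hasSum_intervalIntegral_of_summable_norm (a := (0 : ℝ)) (b := 1)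
    (f := fun n : ℤ => (⟨fun t : ℝ => jacobiTheta₂_term n (t : ℂ) τ, hc n⟩ : C(ℝ, ℂ))) (by
      have hs := ((summable_jacobiTheta₂_term_iff 0 τ).2 τ.im_pos).norm
      refine Summable.of_nonneg_of_le (fun _ => norm_nonneg _) (fun n => ?_) hs
      rw [ContinuousMap.norm_le _ (norm_nonneg _)]
      intro t
      simp [hnorm])
  simp only [ContinuousMap.coe_mk, hint] at hsum
  have h1 := hsum.unique (hasSum_ite_eq 0 1)
  have h2 : ∀ t : ℝ, ∑' n : ℤ, jacobiTheta₂_term n (t : ℂ) τ = 0 := fun t => hz t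
  simp [h2] at h1

end

/-! ### Quasi-periodic functions, the product formula and the zeros of `θ₁`. -/

section

/-- The quasi-periodicity of `θ₁`. -/
structure IsThetaLike (f : ℂ → ℂ) (τ : ℍ) : Prop where
  diff : Differentiable ℂ f
  add_one : ∀ z, f (z + 1) = -f z
  add_tau : ∀ z, f (z + τ) =
    -Complex.exp (-(Real.pi * Complex.I * τ) - 2 * Real.pi * Complex.I * z) * f z

lemma isThetaLike_theta1 (τ : ℍ) : IsThetaLike (fun z => theta1 z τ) τ :=
  ⟨differentiable_theta1 τ, fun z => theta1_add_one z τ, fun z => theta1_add_tau z τ⟩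

/-- The factor of automorphy of `θ₁` for the lattice vector `m + k τ`. -/
def thetaFactor (τ : ℂ) (m k : ℤ) (z : ℂ) : ℂ :=
  Complex.exp (Real.pi * Complex.I * (m + k) - Real.pi * Complex.I * k ^ 2 * τ -
    2 * Real.pi * Complex.I * k * z)

lemma exp_neg_pi_mul_I : Complex.exp (-(Real.pi * Complex.I)) = -1 := by
  rw [Complex.exp_neg, Complex.exp_pi_mul_I]; norm_num

lemma IsThetaLike.add_lattice {f : ℂ → ℂ} {τ : ℍ} (h : IsThetaLike f τ) (m k : ℤ) (z : ℂ) :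
    f (z + (m + k * (τ : ℂ))) = thetaFactor τ m k z * f z := by
  have hm : ∀ (m : ℤ) (z : ℂ), f (z + m) = Complex.exp (Real.pi * Complex.I * m) * f z := by
    intro m
    induction m using Int.induction_on with
    | zero => intro z; simp
    | succ i ih =>
      intro z
      have : z + ((i + 1 : ℤ) : ℂ) = (z + (i : ℤ)) + 1 := by push_cast; ring
      rw [this, h.add_one, ih]
      push_cast
      rw [mul_add, mul_one, Complex.exp_add _ (Real.pi * Complex.I), Complex.exp_pi_mul_I]
      ring
    | pred i ih =>
      intro z
      have e := h.add_one (z + ((-i - 1 : ℤ) : ℂ))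
      have : (z + ((-i - 1 : ℤ) : ℂ)) + 1 = z + ((-i : ℤ) : ℂ) := by push_cast; ring
      rw [this, ih] at e
      have e2 : (Real.pi * Complex.I * ((-i - 1 : ℤ) : ℂ)) =
          Real.pi * Complex.I * ((-i : ℤ) : ℂ) + -(Real.pi * Complex.I) := by push_cast; ring
      rw [e2, Complex.exp_add, exp_neg_pi_mul_I]
      linear_combination e
  have hk : ∀ (k : ℤ) (z : ℂ), f (z + k * (τ : ℂ)) = thetaFactor τ 0 k z * f z := by
    intro k
    induction k using Int.induction_on with
    | zero => intro z; simp [thetaFactor]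
    | succ i ih =>
      intro z
      have : z + ((i + 1 : ℤ) : ℂ) * (τ : ℂ) = (z + (i : ℤ) * (τ : ℂ)) + τ := by push_cast; ring
      rw [this, h.add_tau, ih, ← mul_assoc]
      congr 1
      rw [thetaFactor, thetaFactor, neg_mul, ← Complex.exp_add, ← neg_one_mul,
        ← Complex.exp_pi_mul_I, ← Complex.exp_add]
      congr 1
      push_cast
      ring
    | pred i ih =>
      intro z
      have e := h.add_tau (z + ((-i - 1 : ℤ) : ℂ) * (τ : ℂ))
      have : (z + ((-i - 1 : ℤ) : ℂ) * (τ : ℂ)) + τ = z + ((-i : ℤ) : ℂ) * τ := by push_cast; ring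
      rw [this, ih] at e
      have h0 := Complex.exp_ne_zero (-(Real.pi * Complex.I * τ) -
        2 * Real.pi * Complex.I * (z + ((-i - 1 : ℤ) : ℂ) * τ))
      have e2 : thetaFactor τ 0 (-i) z = -Complex.exp (-(Real.pi * Complex.I * τ) -
          2 * Real.pi * Complex.I * (z + ((-i - 1 : ℤ) : ℂ) * τ)) * thetaFactor τ 0 (-i - 1) z := by
        have hneg : ∀ x : ℂ, -Complex.exp x = Complex.exp (Real.pi * Complex.I + x) := by
          intro x
          rw [Complex.exp_add, Complex.exp_pi_mul_I, neg_one_mul]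
        rw [thetaFactor, thetaFactor, hneg, ← Complex.exp_add]
        congr 1
        push_cast
        ring
      rw [e2] at e
      have : -Complex.exp (-(Real.pi * Complex.I * τ) -
          2 * Real.pi * Complex.I * (z + ((-i - 1 : ℤ) : ℂ) * τ)) ≠ 0 := neg_ne_zero.2 h0
      apply mul_left_cancel₀ this
      rw [← e]
      ring
  have : z + (m + k * (τ : ℂ)) = (z + m) + k * (τ : ℂ) := by ring
  rw [this, hk, hm, ← mul_assoc]
  congr 1
  rw [thetaFactor, thetaFactor, ← Complex.exp_add]
  -- Shifting by `m` first and by `k τ` afterwards produces the extra factor `e^{-2πimk} = 1`.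
  have h1 : Complex.exp (-(m * k : ℤ) * (2 * Real.pi * Complex.I)) = 1 := by
    have := Complex.exp_int_mul_two_pi_mul_I (-(m * k))
    exact_mod_cast this
  rw [← mul_one (Complex.exp (Real.pi * Complex.I * (m + k) - _ - _)), ← h1, ← Complex.exp_add]
  congr 1
  push_cast
  ring

lemma thetaFactor_ne_zero (τ : ℂ) (m k : ℤ) (z : ℂ) : thetaFactor τ m k z ≠ 0 :=
  Complex.exp_ne_zero _

/-- In the product rule at `0` the derivative of the factor of automorphy is multiplied by `f 0 =
0`. So a simple zero at the origin makes all lattice zeros simple. -/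
lemma IsThetaLike.deriv_add_lattice {f : ℂ → ℂ} {τ : ℍ} (h : IsThetaLike f τ) (h0 : f 0 = 0)
    (m k : ℤ) : deriv f (m + k * (τ : ℂ)) = thetaFactor τ m k 0 * deriv f 0 := by
  have h1 : HasDerivAt (fun z => f (z + (m + k * (τ : ℂ)))) (deriv f (0 + (m + k * (τ : ℂ)))) 0 :=
    (h.diff _).hasDerivAt.comp_add_const 0 _
  have hd : DifferentiableAt ℂ (thetaFactor τ m k) 0 := by
    unfold thetaFactor
    fun_prop
  have h2 := hd.hasDerivAt.mul (h.diff 0).hasDerivAt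
  have h3 : (fun z => f (z + (m + k * (τ : ℂ)))) = thetaFactor τ m k * f := by
    ext z
    exact h.add_lattice m k z
  rw [h3] at h1
  have := h1.unique h2
  rw [zero_add, h0, mul_zero, zero_add] at this
  exact this

/-- A quasi-periodic function vanishing at the origin is a multiple of one which has simple zeros
at the lattice points and no others. -/
lemma IsThetaLike.exists_eq_mul {f p : ℂ → ℂ} {τ : ℍ} (hf : IsThetaLike f τ) (hp : IsThetaLike p τ)
    (hf0 : f 0 = 0) (hpz : ∀ z, p z = 0 → z ∈ (tauPeriods τ).lattice)
    (hp0 : p 0 = 0) (hpd : deriv p 0 ≠ 0) (hne : ∃ z, p z ≠ 0) : ∃ C, ∀ z, f z = C * p z := by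
  -- All zeros of `p` are simple lattice points, where `f` vanishes too. The quotient is entire and
  -- the multipliers cancel in it, so it is constant.
  obtain ⟨h, hh, hfh⟩ := exists_entire_quotient hf.diff hp.diff (by
    intro z hz
    obtain ⟨m, k, rfl⟩ := mem_tauLattice.1 (hpz z hz)
    rw [hp.deriv_add_lattice hp0]
    exact mul_ne_zero (thetaFactor_ne_zero _ _ _ _) hpd) (by
    intro z hz
    obtain ⟨m, k, rfl⟩ := mem_tauLattice.1 (hpz z hz)
    have := hf.add_lattice m k 0
    rw [zero_add, hf0, mul_zero] at this
    exact this)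
  obtain ⟨z₀, hz₀⟩ := hne
  obtain ⟨C, hC⟩ := exists_eq_const_of_periodic (τ := τ) hh
    (eq_of_mul_eq_mul (f := fun z => h (z + 1)) (hh.comp (by fun_prop)) hh hp.diff hz₀ (by
      intro z
      have := hfh (z + 1)
      rw [hf.add_one, hp.add_one, hfh] at this
      linear_combination this))
    (eq_of_mul_eq_mul (f := fun z => h (z + τ)) (hh.comp (by fun_prop)) hh hp.diff hz₀ (by
      intro z
      have := hfh (z + τ)
      rw [hf.add_tau, hp.add_tau, hfh] at this
      have h0 := Complex.exp_ne_zero (-(Real.pi * Complex.I * τ) - 2 * Real.pi * Complex.I * z)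
      apply mul_left_cancel₀ h0
      linear_combination this))
  exact ⟨C, fun z => by rw [hfh, hC, mul_comm]⟩

/-! ### The product formula and the zeros of `θ₁` -/

/-- The infinite product `∏ (1 - qᵐ w)`. -/
def qProd (q w : ℂ) : ℂ := ∏' m : ℕ, (1 + -(q ^ m * w))

section qProd

variable {q : ℂ} (hq : ‖q‖ < 1)

include hq

lemma summable_qProd (w : ℂ) : Summable fun m : ℕ => ‖-(q ^ m * w)‖ := by
  simpa [norm_mul, norm_pow] using (summable_geometric_of_lt_one (norm_nonneg _) hq).mul_right ‖w‖

lemma differentiable_qProd : Differentiable ℂ (qProd q) := by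
  intro w
  have h := Summable.hasProdLocallyUniformlyOn_nat_one_add (R := ℂ) (f := fun (m : ℕ) (w : ℂ) => -(q ^ m * w))
    (K := Metric.ball 0 (‖w‖ + 1)) Metric.isOpen_ball (u := fun m => ‖q‖ ^ m * (‖w‖ + 1))
    ((summable_geometric_of_lt_one (norm_nonneg _) hq).mul_right _) (by
      refine Eventually.of_forall fun m x hx => ?_
      rw [mem_ball_zero_iff] at hx
      rw [norm_neg, norm_mul, norm_pow]
      gcongr) (fun m => by fun_prop)
  have h2 := h.differentiableOn (.of_forall fun s => by
    simpa [Finset.prod_fn] using DifferentiableOn.finsetProd (fun _ _ => by fun_prop)) Metric.isOpen_ball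
  exact h2.differentiableAt (Metric.isOpen_ball.mem_nhds (by simp))

/-- Splitting off the factor with `m = 0`; this is the source of the quasi-periodicity of
`thetaProd`. -/
lemma qProd_eq (w : ℂ) : qProd q w = (1 - w) * qProd q (q * w) := by
  unfold qProd
  have hm : ∀ w : ℂ, Multipliable fun m : ℕ => (1 + -(q ^ m * w)) := fun w =>
    multipliable_one_add_of_summable (summable_qProd hq w)
  have e : ∀ m : ℕ, (1 + -(q ^ m * (q * w))) = (1 + -(q ^ (m + 1) * w)) := fun m => by ring
  rw [tprod_eq_zero_mul' (by simpa only [e] using hm (q * w))]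
  simp only [e]
  ring

lemma qProd_ne_zero {w : ℂ} (hw : ∀ m : ℕ, q ^ m * w ≠ 1) : qProd q w ≠ 0 := by
  refine tprod_one_add_ne_zero_of_summable (fun m => ?_) (summable_qProd hq w)
  rw [← sub_eq_add_neg, sub_ne_zero]
  exact (hw m).symm

end qProd

lemma norm_exp_tau_lt_one (τ : ℍ) : ‖Complex.exp (2 * Real.pi * Complex.I * τ)‖ < 1 := by
  rw [Complex.norm_exp]
  have : (2 * Real.pi * Complex.I * (τ : ℂ)).re = -(2 * Real.pi * τ.im) := by simp
  rw [this, Real.exp_lt_one_iff]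
  have := mul_pos Real.two_pi_pos τ.im_pos
  linarith

/-- The product `e^{-πiz} ∏ (1 - qᵐ w) ∏ (1 - q^{m+1} w⁻¹)`, which is proportional to `θ₁`. -/
def thetaProd (τ : ℍ) (z : ℂ) : ℂ :=
  Complex.exp (-(Real.pi * Complex.I * z)) *
    (qProd (Complex.exp (2 * Real.pi * Complex.I * τ)) (Complex.exp (2 * Real.pi * Complex.I * z)) *
      qProd (Complex.exp (2 * Real.pi * Complex.I * τ))
        (Complex.exp (2 * Real.pi * Complex.I * τ) * Complex.exp (-(2 * Real.pi * Complex.I * z))))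

/-- The shift by `τ` replaces `w` by `q w`: the first product loses the factor `1 - w`, the second
gains `1 - w⁻¹`, and `(1 - w⁻¹) / (1 - w) = -w⁻¹`. -/
lemma isThetaLike_thetaProd (τ : ℍ) : IsThetaLike (thetaProd τ) τ := by
  have hd := differentiable_qProd (norm_exp_tau_lt_one τ)
  refine ⟨?_, fun z => ?_, fun z => ?_⟩
  · unfold thetaProd
    refine Differentiable.mul (by fun_prop) (Differentiable.mul ?_ ?_)
    · exact hd.comp (by fun_prop : Differentiable ℂ fun z => Complex.exp (2 * Real.pi * Complex.I * z))
    · exact hd.comp (by fun_prop : Differentiable ℂ fun z =>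
        Complex.exp (2 * Real.pi * Complex.I * τ) * Complex.exp (-(2 * Real.pi * Complex.I * z)))
  · unfold thetaProd
    have e1 : Complex.exp (2 * Real.pi * Complex.I * (z + 1)) =
        Complex.exp (2 * Real.pi * Complex.I * z) := by
      rw [mul_add, mul_one, Complex.exp_add, Complex.exp_two_pi_mul_I, mul_one]
    have e2 : Complex.exp (-(Real.pi * Complex.I * (z + 1))) =
        -Complex.exp (-(Real.pi * Complex.I * z)) := by
      rw [mul_add, mul_one, neg_add, Complex.exp_add, exp_neg_pi_mul_I]; ring
    rw [Complex.exp_neg (2 * Real.pi * Complex.I * (z + 1)), e1, e2, ← Complex.exp_neg]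
    ring
  · unfold thetaProd
    set q := Complex.exp (2 * Real.pi * Complex.I * τ) with hq
    set w := Complex.exp (2 * Real.pi * Complex.I * z) with hw
    have hq0 : q ≠ 0 := Complex.exp_ne_zero _
    have hw0 : w ≠ 0 := Complex.exp_ne_zero _
    have e1 : Complex.exp (2 * Real.pi * Complex.I * (z + τ)) = q * w := by
      rw [mul_add, Complex.exp_add, mul_comm]
    have e2 : q * Complex.exp (-(2 * Real.pi * Complex.I * (z + τ))) = w⁻¹ := by
      rw [Complex.exp_neg, e1]
      field_simp
    have e3 : Complex.exp (-(2 * Real.pi * Complex.I * z)) = w⁻¹ := Complex.exp_neg _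
    rw [e1, e2, e3, qProd_eq (norm_exp_tau_lt_one τ) w, qProd_eq (norm_exp_tau_lt_one τ) w⁻¹, ← hq]
    have e4 : Complex.exp (-(Real.pi * Complex.I * (z + τ))) =
        Complex.exp (-(Real.pi * Complex.I * τ)) * Complex.exp (-(Real.pi * Complex.I * z)) := by
      rw [← Complex.exp_add]; congr 1; ring
    have e5 : Complex.exp (-(Real.pi * Complex.I * τ) - 2 * Real.pi * Complex.I * z) =
        Complex.exp (-(Real.pi * Complex.I * τ)) * w⁻¹ := by
      rw [sub_eq_add_neg, Complex.exp_add, e3]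
    rw [e4, e5]
    field_simp
    ring

/-- An absolutely convergent product vanishes only with one of its factors, that is when `qᵐ w = 1`
or `qᵐ⁺¹ w⁻¹ = 1` for some `m ≥ 0`. -/
lemma mem_lattice_of_thetaProd_eq_zero {τ : ℍ} {z : ℂ} (h : thetaProd τ z = 0) :
    z ∈ (tauPeriods τ).lattice := by
  have hpi : (2 * Real.pi * Complex.I : ℂ) ≠ 0 := Complex.two_pi_I_ne_zero
  by_contra hz
  rw [mem_tauLattice] at hz
  refine absurd h (mul_ne_zero (Complex.exp_ne_zero _) (mul_ne_zero ?_ ?_))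
  · refine qProd_ne_zero (norm_exp_tau_lt_one τ) fun m hm => ?_
    rw [← Complex.exp_nat_mul, ← Complex.exp_add, Complex.exp_eq_one_iff] at hm
    obtain ⟨k, hk⟩ := hm
    refine hz ⟨k, -m, ?_⟩
    apply mul_left_cancel₀ hpi
    push_cast
    linear_combination hk
  · refine qProd_ne_zero (norm_exp_tau_lt_one τ) fun m hm => ?_
    rw [← Complex.exp_nat_mul, ← Complex.exp_add, ← Complex.exp_add, Complex.exp_eq_one_iff] at hm
    obtain ⟨k, hk⟩ := hm
    refine hz ⟨-k, m + 1, ?_⟩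
    apply mul_left_cancel₀ hpi
    push_cast
    linear_combination -hk

/-- The factor `1 - e^{2πiz}` carries the zero; the remaining product `B` is nonzero at `0` because
`|q| < 1`. -/
lemma thetaProd_simple (τ : ℍ) : thetaProd τ 0 = 0 ∧ deriv (thetaProd τ) 0 ≠ 0 := by
  set q := Complex.exp (2 * Real.pi * Complex.I * τ) with hq
  have hq1 : ‖q‖ < 1 := norm_exp_tau_lt_one τ
  let B : ℂ → ℂ := fun z => Complex.exp (-(Real.pi * Complex.I * z)) *
    (qProd q (q * Complex.exp (2 * Real.pi * Complex.I * z)) *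
      qProd q (q * Complex.exp (-(2 * Real.pi * Complex.I * z))))
  have hB : ∀ z, thetaProd τ z = (1 - Complex.exp (2 * Real.pi * Complex.I * z)) * B z := by
    intro z
    simp only [thetaProd, B]
    rw [qProd_eq hq1]
    ring
  have hd := differentiable_qProd hq1
  have hBd : DifferentiableAt ℂ B 0 := by
    refine DifferentiableAt.mul (by fun_prop) (DifferentiableAt.mul ?_ ?_)
    · exact (hd _).comp (0 : ℂ) (by fun_prop : DifferentiableAt ℂ (fun z => q * Complex.exp (2 * Real.pi * Complex.I * z)) 0)
    · exact (hd _).comp (0 : ℂ) (by fun_prop : DifferentiableAt ℂ (fun z => q * Complex.exp (-(2 * Real.pi * Complex.I * z))) 0)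
  have hqq : qProd q q ≠ 0 := by
    refine qProd_ne_zero hq1 fun m hm => ?_
    have := congrArg norm hm
    rw [← pow_succ, norm_pow, norm_one] at this
    exact (pow_lt_one₀ (norm_nonneg _) hq1 (Nat.succ_ne_zero m)).ne this
  have hB0 : B 0 ≠ 0 := by
    simp [B, hqq]
  constructor
  · rw [hB]; simp
  · have h1 : HasDerivAt (fun z : ℂ => 1 - Complex.exp (2 * Real.pi * Complex.I * z))
        (-(Complex.exp (2 * Real.pi * Complex.I * 0) * (2 * Real.pi * Complex.I * 1))) 0 :=
      (((hasDerivAt_id' (0 : ℂ)).const_mul (2 * Real.pi * Complex.I : ℂ)).cexp).const_sub 1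
    have h2 := h1.mul hBd.hasDerivAt
    have h3 : thetaProd τ = (fun z : ℂ => 1 - Complex.exp (2 * Real.pi * Complex.I * z)) * B :=
      funext hB
    rw [h3, h2.deriv]
    simp [hB0, Real.pi_ne_zero]

/-- The triple product formula up to an undetermined nonzero constant. It transfers the location and
simplicity of the zeros from the product to the series. -/
lemma exists_theta1_eq (τ : ℍ) : ∃ C, C ≠ 0 ∧ ∀ z, theta1 z τ = C * thetaProd τ z := by
  obtain ⟨h1, h2⟩ := thetaProd_simple τ
  obtain ⟨C, hC⟩ := (isThetaLike_theta1 τ).exists_eq_mul (isThetaLike_thetaProd τ) (theta1_zero τ)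
    (fun z hz => mem_lattice_of_thetaProd_eq_zero hz) h1 h2 (by
      by_contra! hcon
      have : thetaProd τ = fun _ => 0 := funext hcon
      rw [this] at h2
      simp at h2)
  refine ⟨C, ?_, hC⟩
  rintro rfl
  obtain ⟨z, hz⟩ := exists_theta1_ne_zero τ
  exact hz (by rw [hC, zero_mul])

lemma theta1_eq_zero_iff {τ : ℍ} {z : ℂ} : theta1 z τ = 0 ↔ z ∈ (tauPeriods τ).lattice := by
  constructor
  · intro h
    obtain ⟨C, hC0, hC⟩ := exists_theta1_eq τ
    rw [hC, mul_eq_zero, or_iff_right hC0] at h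
    exact mem_lattice_of_thetaProd_eq_zero h
  · intro h
    obtain ⟨m, k, rfl⟩ := mem_tauLattice.1 h
    have := (isThetaLike_theta1 τ).add_lattice m k 0
    simpa [theta1_zero] using this

lemma deriv_theta1_zero_ne_zero (τ : ℍ) : deriv (fun z => theta1 z τ) 0 ≠ 0 := by
  obtain ⟨C, hC0, hC⟩ := exists_theta1_eq τ
  have : (fun z => theta1 z τ) = fun z => C * thetaProd τ z := funext hC
  rw [this, deriv_const_mul_field]
  exact mul_ne_zero hC0 (thetaProd_simple τ).2

lemma deriv_theta1_ne_zero {τ : ℍ} {z : ℂ} (h : theta1 z τ = 0) :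
    deriv (fun z => theta1 z τ) z ≠ 0 := by
  obtain ⟨m, k, rfl⟩ := mem_tauLattice.1 (theta1_eq_zero_iff.1 h)
  rw [(isThetaLike_theta1 τ).deriv_add_lattice (theta1_zero τ)]
  exact mul_ne_zero (thetaFactor_ne_zero _ _ _ _) (deriv_theta1_zero_ne_zero τ)

lemma theta1_add_lattice (τ : ℍ) (m k : ℤ) (z : ℂ) :
    theta1 (z + (m + k * (τ : ℂ))) τ = thetaFactor τ m k z * theta1 z τ :=
  (isThetaLike_theta1 τ).add_lattice m k z

end

section

/-! ### Modular transformation of `θ₁` -/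

lemma exp_pi_mul_I_of_odd {k : ℤ} (hk : Odd k) : Complex.exp (Real.pi * Complex.I * k) = -1 := by
  obtain ⟨j, rfl⟩ := hk
  have : (Real.pi * Complex.I * ((2 * j + 1 : ℤ) : ℂ)) =
      j * (2 * Real.pi * Complex.I) + Real.pi * Complex.I := by push_cast; ring
  rw [this, Complex.exp_add, Complex.exp_int_mul_two_pi_mul_I, Complex.exp_pi_mul_I, one_mul]

lemma det_eq_one (γ : SL(2, ℤ)) : γ 0 0 * γ 1 1 - γ 0 1 * γ 1 0 = 1 := by
  have := γ.det_coe
  rwa [Matrix.det_fin_two] at this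

lemma coe_smul_mul_cocyc (γ : SL(2, ℤ)) (τ : ℍ) :
    ((γ • τ : ℍ) : ℂ) * cocyc γ τ = ((γ 0 0 : ℤ) : ℂ) * τ + ((γ 0 1 : ℤ) : ℂ) := by
  rw [UpperHalfPlane.coe_specialLinearGroup_apply]
  have h := cocyc_ne_zero γ τ
  unfold cocyc at *
  simp only [algebraMap_int_eq, eq_intCast, Complex.ofReal_intCast] at *
  rw [div_mul_cancel₀ _ h]

/-- After a Gaussian correction, `θ₁(z/(cτ+d), γτ)` has the multipliers of `θ₁(z, τ)` and vanishes
at `0`, so the two are proportional. The constant `ε` need not be identified: λ has `n + 1` theta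
factors both above and below. -/
theorem exists_theta1_modular (γ : SL(2, ℤ)) (τ : ℍ) : ∃ ε : ℂ, ε ≠ 0 ∧ ∀ z,
    theta1 ((cocyc γ τ)⁻¹ * z) (γ • τ : ℍ) =
      ε * Complex.exp (Real.pi * Complex.I * ((γ 1 0 : ℤ) : ℂ) * z ^ 2 / cocyc γ τ) * theta1 z τ := by
  set J := cocyc γ τ with hJ
  have hJ0 : J ≠ 0 := cocyc_ne_zero γ τ
  set a : ℤ := γ 0 0 with ha
  set b : ℤ := γ 0 1 with hb
  set c : ℤ := γ 1 0 with hc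
  set d : ℤ := γ 1 1 with hd
  have hdet : a * d - b * c = 1 := det_eq_one γ
  have hdet' : (a : ℂ) * d - b * c = 1 := by exact_mod_cast hdet
  set τ' : ℍ := γ • τ with hτ'
  have hJdef : J = c * (τ : ℂ) + d := rfl
  have hτJ : (τ' : ℂ) * J = a * (τ : ℂ) + b := coe_smul_mul_cocyc γ τ
  have hτJ' : (τ' : ℂ) = (a * (τ : ℂ) + b) / J := by rw [← hτJ]; field_simp
  let f : ℂ → ℂ := fun z => Complex.exp (-(Real.pi * Complex.I * c * z ^ 2 / J)) * theta1 (J⁻¹ * z) τ'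
  have hf : IsThetaLike f τ := by
    refine ⟨?_, fun z => ?_, fun z => ?_⟩
    · refine Differentiable.mul (by fun_prop) ?_
      exact (differentiable_theta1 τ').comp (by fun_prop : Differentiable ℂ fun z => J⁻¹ * z)
    -- In terms of `τ' = γτ`, the determinant condition gives `1/J = a - cτ'`; likewise `τ/J = -b +
    -- dτ'` below.
    · have h1 : J⁻¹ * (z + 1) = J⁻¹ * z + ((a : ℤ) + ((-c : ℤ) : ℂ) * τ') := by
        rw [hτJ']
        field_simp
        push_cast
        rw [hJdef]
        linear_combination -hdet'
      -- The integer equals `(1 + a)(1 - c) - 1`, and `a`, `c` are not both even since the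
      -- determinant is `1`. This parity supplies the sign `-1` of `θ₁(z + 1)`.
      have hodd : Odd (a - c - a * c) := by
        by_cases h1 : Odd c
        · have : ¬ (Even (1 - c)) → False := fun h => h (by simpa [Int.even_sub, parity_simps] using h1)
          have h2 : a - c - a * c = (1 + a) * (1 - c) - 1 := by ring
          rw [h2]
          exact Even.sub_odd ((by by_contra h; exact this h : Even (1 - c)).mul_left _) odd_one
        · have hc2 : Even c := by simpa using h1
          have ha2 : Odd a := by
            by_contra h
            have h3 : Even a := by simpa using h
            have : Even (a * d - b * c) := (h3.mul_right d).sub (hc2.mul_left b)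
            rw [hdet] at this
            exact absurd this (by decide)
          have h2 : a - c - a * c = (1 + a) * (1 - c) - 1 := by ring
          rw [h2]
          exact Even.sub_odd ((odd_one.add_odd ha2).mul_right _) odd_one
      simp only [f]
      have key : Complex.exp (-(Real.pi * Complex.I * c * (z + 1) ^ 2 / J)) *
          thetaFactor τ' a (-c) (J⁻¹ * z) = Complex.exp (Real.pi * Complex.I * (a - c - a * c : ℤ)) *
          Complex.exp (-(Real.pi * Complex.I * c * z ^ 2 / J)) := by
        rw [thetaFactor, ← Complex.exp_add, ← Complex.exp_add]
        congr 1
        rw [hτJ']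
        push_cast
        field_simp
        rw [hJdef]
        linear_combination (c : ℂ) * hdet'
      rw [exp_pi_mul_I_of_odd hodd] at key
      rw [h1, theta1_add_lattice]
      linear_combination theta1 (J⁻¹ * z) τ' * key
    · have h1 : J⁻¹ * (z + τ) = J⁻¹ * z + (((-b : ℤ) : ℂ) + ((d : ℤ) : ℂ) * τ') := by
        rw [hτJ']
        field_simp
        push_cast
        rw [hJdef]
        linear_combination -(τ : ℂ) * hdet'
      have hodd : Odd (d - b - b * d) := by
        by_cases h1 : Odd b
        · have h2 : d - b - b * d = (1 + d) * (1 - b) - 1 := by ring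
          rw [h2]
          exact Even.sub_odd ((odd_one.sub_odd h1).mul_left _) odd_one
        · have hb2 : Even b := by simpa using h1
          have hd2 : Odd d := by
            by_contra h
            have h3 : Even d := by simpa using h
            have : Even (a * d - b * c) := (h3.mul_left a).sub (hb2.mul_right c)
            rw [hdet] at this
            exact absurd this (by decide)
          have h2 : d - b - b * d = (1 + d) * (1 - b) - 1 := by ring
          rw [h2]
          exact Even.sub_odd ((odd_one.add_odd hd2).mul_right _) odd_one
      simp only [f]
      have key : Complex.exp (-(Real.pi * Complex.I * c * (z + τ) ^ 2 / J)) *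
          thetaFactor τ' (-b) d (J⁻¹ * z) = Complex.exp (Real.pi * Complex.I * (d - b - b * d : ℤ)) *
          (Complex.exp (-(Real.pi * Complex.I * τ) - 2 * Real.pi * Complex.I * z) *
          Complex.exp (-(Real.pi * Complex.I * c * z ^ 2 / J))) := by
        rw [thetaFactor, ← Complex.exp_add, ← Complex.exp_add, ← Complex.exp_add]
        congr 1
        rw [hτJ']
        push_cast
        field_simp
        rw [hJdef]
        linear_combination (-d * (τ : ℂ)) * hdet'
      rw [exp_pi_mul_I_of_odd hodd] at key
      rw [h1, theta1_add_lattice]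
      linear_combination theta1 (J⁻¹ * z) τ' * key
  obtain ⟨ε, hε⟩ := hf.exists_eq_mul (isThetaLike_theta1 τ) (by simp [f, theta1_zero])
    (fun z hz => theta1_eq_zero_iff.1 hz) (theta1_zero τ) (deriv_theta1_zero_ne_zero τ)
    (exists_theta1_ne_zero τ)
  refine ⟨ε, ?_, fun z => ?_⟩
  · rintro rfl
    obtain ⟨z, hz⟩ := exists_theta1_ne_zero τ'
    have := hε (J * z)
    rw [zero_mul] at this
    simp only [f] at this
    rw [inv_mul_cancel_left₀ hJ0] at this
    exact mul_ne_zero (Complex.exp_ne_zero _) hz this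
  · have := hε z
    simp only [f] at this
    rw [mul_assoc, mul_comm ε, mul_assoc, mul_comm _ ε, ← this, ← mul_assoc, ← Complex.exp_add,
      add_neg_cancel, Complex.exp_zero, one_mul]

/-! ### Factorization of theta functions -/

/-- An entire function with the quasi-periodicity of a theta function of order `N` is, up to an
exponential factor, a product of `N` translates of `θ₁`. -/
theorem exists_theta_factorization (τ : ℍ) (N : ℕ) : ∀ (F : ℂ → ℂ) (e₁ e₂ : ℂ), Differentiable ℂ F →
    (∃ z, F z ≠ 0) → (∀ z, F (z + 1) = e₁ * F z) →
    (∀ z, F (z + τ) = e₂ * Complex.exp (-(2 * Real.pi * Complex.I * N * z)) * F z) →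
    ∃ (C κ : ℂ) (x : Fin N → ℂ), C ≠ 0 ∧
      ∀ z, F z = C * Complex.exp (κ * z) * ∏ i, theta1 (z - x i) τ := by
  induction N with
  | zero =>
    intro F e₁ e₂ hF hne h1 h2
    obtain ⟨z₀, hz₀⟩ := hne
    have he₁ : e₁ ≠ 0 := by
      rintro rfl
      have := h1 (z₀ - 1)
      rw [sub_add_cancel, zero_mul] at this
      exact hz₀ this
    have he₂ : e₂ ≠ 0 := by
      rintro rfl
      have := h2 (z₀ - τ)
      rw [sub_add_cancel, zero_mul, zero_mul] at this
      exact hz₀ this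
    -- Chosen so that `Re κ = log ‖e₁‖` and `Re (κτ) = log ‖e₂‖`. Then the modulus of `e^{-κz} F(z)`
    -- is doubly periodic, hence bounded, and Liouville applies.
    let κ : ℂ := ⟨Real.log ‖e₁‖, (Real.log ‖e₁‖ * τ.re - Real.log ‖e₂‖) / τ.im⟩
    have hκ1 : ‖Complex.exp (-κ)‖ * ‖e₁‖ = 1 := by
      rw [Complex.norm_exp]
      have : (-κ).re = -Real.log ‖e₁‖ := rfl
      rw [this, Real.exp_neg, Real.exp_log (norm_pos_iff.2 he₁), inv_mul_cancel₀ (norm_ne_zero_iff.2 he₁)]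
    have hκ2 : ‖Complex.exp (-(κ * τ))‖ * ‖e₂‖ = 1 := by
      rw [Complex.norm_exp]
      have : (-(κ * τ)).re = -Real.log ‖e₂‖ := by
        have := τ.im_pos.ne'
        simp [κ]
        field_simp
        ring
      rw [this, Real.exp_neg, Real.exp_log (norm_pos_iff.2 he₂), inv_mul_cancel₀ (norm_ne_zero_iff.2 he₂)]
    have hHd : Differentiable ℂ fun z => Complex.exp (-(κ * z)) * F z :=
      Differentiable.mul (by fun_prop) hF
    obtain ⟨M, hM⟩ := exists_bound_of_periodic (f := fun z => ‖Complex.exp (-(κ * z)) * F z‖) (τ := τ)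
      hHd.continuous.norm (by
        intro z
        have : -(κ * (z + 1)) = -κ + -(κ * z) := by ring
        rw [h1, this, Complex.exp_add, norm_mul, norm_mul, norm_mul, norm_mul]
        linear_combination (‖Complex.exp (-(κ * z))‖ * ‖F z‖) * hκ1) (by
        intro z
        have : -(κ * (z + τ)) = -(κ * τ) + -(κ * z) := by ring
        rw [h2, this, Complex.exp_add]
        simp only [norm_mul]
        simp only [Nat.cast_zero, mul_zero, zero_mul, neg_zero, Complex.exp_zero, norm_one, mul_one]
        linear_combination (‖Complex.exp (-(κ * z))‖ * ‖F z‖) * hκ2)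
    obtain ⟨C, hC⟩ := hHd.exists_const_forall_eq_of_bounded (isBounded_iff_forall_norm_le.2
      ⟨M, by rintro _ ⟨z, rfl⟩; simpa using hM z⟩)
    have hFC : ∀ z, F z = C * Complex.exp (κ * z) := by
      intro z
      rw [← hC z, mul_right_comm, ← Complex.exp_add, neg_add_cancel, Complex.exp_zero, one_mul]
    refine ⟨C, κ, Fin.elim0, ?_, fun z => by simp [hFC z]⟩
    rintro rfl
    exact hz₀ (by rw [hFC, zero_mul])
  | succ N ih =>
    intro F e₁ e₂ hF hne h1 h2
    obtain ⟨z₀, hz₀⟩ := hne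
    have he₁ : e₁ ≠ 0 := by
      rintro rfl
      have := h1 (z₀ - 1)
      rw [sub_add_cancel, zero_mul] at this
      exact hz₀ this
    have he₂ : e₂ ≠ 0 := by
      rintro rfl
      have := h2 (z₀ - τ)
      rw [sub_add_cancel, zero_mul, zero_mul] at this
      exact hz₀ this
    -- Without zeros `F'/F` would be entire with doubly periodic derivative, hence affine. Its
    -- period `1` makes it constant, contradicting the nonzero jump `-2πi(N+1)` under the shift by
    -- `τ`.
    obtain ⟨w, hw⟩ : ∃ w, F w = 0 := by
      by_contra! hcon
      have hDd : Differentiable ℂ fun z => deriv F z / F z := fun z =>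
        (hF.deriv z).div (hF z) (hcon z)
      have hD1 : ∀ z, deriv F (z + 1) / F (z + 1) = deriv F z / F z := by
        intro z
        have : deriv F (z + 1) = e₁ * deriv F z := by
          rw [← deriv_comp_add_const, funext h1, deriv_const_mul_field]
        rw [this, h1, mul_div_mul_left _ _ he₁]
      have hD2 : ∀ z, deriv F (z + τ) / F (z + τ) =
          deriv F z / F z - 2 * Real.pi * Complex.I * ((N + 1 : ℕ) : ℂ) := by
        intro z
        have hE : HasDerivAt (fun z => e₂ * Complex.exp (-(2 * Real.pi * Complex.I * ((N + 1 : ℕ) : ℂ) * z)))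
            (e₂ * (Complex.exp (-(2 * Real.pi * Complex.I * ((N + 1 : ℕ) : ℂ) * z)) *
              -(2 * Real.pi * Complex.I * ((N + 1 : ℕ) : ℂ) * 1))) z :=
          (((hasDerivAt_id' z).const_mul _).neg.cexp).const_mul _
        have hder := (hE.mul (hF z).hasDerivAt).deriv
        have e : (fun z => e₂ * Complex.exp (-(2 * Real.pi * Complex.I * ((N + 1 : ℕ) : ℂ) * z))) * F =
          fun z => F (z + τ) := (funext h2).symm
        rw [e, deriv_comp_add_const] at hder
        rw [hder, h2]
        have hF0 := hcon z
        have hexp := Complex.exp_ne_zero (-(2 * Real.pi * Complex.I * ((N + 1 : ℕ) : ℂ) * z))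
        field_simp
        ring
      obtain ⟨α, hα⟩ := exists_eq_const_of_periodic (τ := τ) hDd.deriv (by
          intro z
          rw [← deriv_comp_add_const, funext hD1]) (by
          intro z
          rw [← deriv_comp_add_const, funext hD2, deriv_sub_const])
      have hlin : ∀ z, deriv F z / F z - α * z = deriv F 0 / F 0 - α * 0 := by
        intro z
        refine is_const_of_deriv_eq_zero (f := fun z => deriv F z / F z - α * z)
          (hDd.sub (by fun_prop)) (fun x => ?_) z 0
        rw [deriv_fun_sub (hDd x) (by fun_prop), hα, deriv_const_mul_field]
        simp
      have hα0 : α = 0 := by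
        have a1 := hlin 1
        have a2 := hD1 0
        rw [zero_add] at a2
        rw [a2] at a1
        linear_combination -a1
      have a1 := hlin τ
      have a2 := hD2 0
      rw [zero_add] at a2
      rw [a2, hα0] at a1
      have : 2 * Real.pi * Complex.I * ((N + 1 : ℕ) : ℂ) = 0 := by linear_combination -a1
      exact mul_ne_zero Complex.two_pi_I_ne_zero (Nat.cast_ne_zero.2 (Nat.succ_ne_zero N)) this
    have hzero : ∀ m k : ℤ, F (w + m + k * (τ : ℂ)) = 0 := by
      intro m k
      have := periodic_int (f := fun z => F z = 0) (τ := τ) (by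
        intro z
        simp [h1, he₁]) (by
        intro z
        simp [h2, he₂, Complex.exp_ne_zero]) m k w
      rw [this]
      exact hw
    have hθd : Differentiable ℂ fun z => theta1 (z - w) τ :=
      (differentiable_theta1 τ).comp (by fun_prop : Differentiable ℂ fun z => z - w)
    obtain ⟨h, hh, hFh⟩ := exists_entire_quotient (f := F) (g := fun z => theta1 (z - w) τ) hF hθd (by
        intro z hz
        rw [deriv_comp_sub_const (fun z => theta1 z τ)]
        exact deriv_theta1_ne_zero hz) (by
        intro z hz
        obtain ⟨m, k, hmk⟩ := mem_tauLattice.1 (theta1_eq_zero_iff.1 hz)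
        have : z = w + m + k * (τ : ℂ) := by linear_combination hmk
        rw [this, hzero])
    have hθne : theta1 (z₀ - w) τ ≠ 0 := by
      intro h0
      exact hz₀ (by rw [hFh, h0, zero_mul])
    -- Dividing by `θ₁(z - w)` lowers the order by one; the constants are the quotients of the
    -- multipliers.
    obtain ⟨C, κ, x, hC, hx⟩ := ih h (-e₁)
      (-e₂ * Complex.exp (Real.pi * Complex.I * τ - 2 * Real.pi * Complex.I * w)) hh
      ⟨z₀, fun h0 => hz₀ (by rw [hFh, h0, mul_zero])⟩
      (eq_of_mul_eq_mul (f := fun z => h (z + 1)) (hh.comp (by fun_prop)) (by fun_prop) hθd hθne (by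
        intro z
        have := hFh (z + 1)
        rw [h1, hFh] at this
        have e : theta1 (z + 1 - w) τ = -theta1 (z - w) τ := by
          rw [← theta1_add_one]; congr 1; ring
        simp only [e] at this
        linear_combination this))
      (eq_of_mul_eq_mul (f := fun z => h (z + τ)) (hh.comp (by fun_prop)) (by fun_prop) hθd hθne (by
        intro z
        have := hFh (z + τ)
        rw [h2, hFh] at this
        have e : theta1 (z + τ - w) τ =
            -Complex.exp (-(Real.pi * Complex.I * τ) - 2 * Real.pi * Complex.I * (z - w)) *
              theta1 (z - w) τ := by
          rw [← theta1_add_tau]; congr 1; ring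
        simp only [e] at this
        have hexp := Complex.exp_ne_zero (-(Real.pi * Complex.I * τ) - 2 * Real.pi * Complex.I * (z - w))
        apply mul_left_cancel₀ hexp
        have e3 : Complex.exp (-(Real.pi * Complex.I * τ) - 2 * Real.pi * Complex.I * (z - w)) *
            (Complex.exp (Real.pi * Complex.I * τ - 2 * Real.pi * Complex.I * w) *
              Complex.exp (-(2 * Real.pi * Complex.I * N * z))) =
            Complex.exp (-(2 * Real.pi * Complex.I * ((N + 1 : ℕ) : ℂ) * z)) := by
          rw [← Complex.exp_add, ← Complex.exp_add]
          congr 1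
          push_cast
          ring
        linear_combination this + (e₂ * theta1 (z - w) τ * h z) * e3))
    refine ⟨C, κ, Fin.cons w x, hC, fun z => ?_⟩
    rw [hFh, hx, Fin.prod_univ_succ]
    simp only [Fin.cons_zero, Fin.cons_succ]
    ring

end

section

/-! ### Zeros and poles of the superpotential -/

/-- The zeros `vᵢ - vₙ₊₁` of the superpotential. -/
def zerosV {n : ℕ} (v : V n) (i : Fin (n + 1)) : ℂ := v.1.1 i - v.2

/-- The pole `-(n+1) vₙ₊₁` of the superpotential. -/
def poleV {n : ℕ} (v : V n) : ℂ := -(((n : ℂ) + 1) * v.2)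

lemma sum_coe_sumZero {n : ℕ} (v : V n) : ∑ i, v.1.1 i = 0 := v.1.2

/-- Abel's condition for a divisor with poles `n·0 + κ`: this is what the normalisation `∑ vᵢ = 0`
encodes, and it makes λ elliptic. -/
lemma sum_zerosV {n : ℕ} (v : V n) : ∑ i, zerosV v i = poleV v := by
  simp [zerosV, poleV, Finset.sum_sub_distrib, sum_coe_sumZero]

/-- In this shape the form is what the exponents of the theta factors add up to: plus for the zeros
in the numerator, minus for the pole in the denominator. -/
lemma form_eq {n : ℕ} (v w : V n) :
    form v w = ∑ i, zerosV v i * zerosV w i - poleV v * poleV w := by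
  have h : ∀ i, zerosV v i * zerosV w i =
      v.1.1 i * w.1.1 i - w.2 * v.1.1 i - v.2 * w.1.1 i + v.2 * w.2 := by
    intro i; simp only [zerosV]; ring
  simp only [h, Finset.sum_add_distrib, Finset.sum_sub_distrib, ← Finset.mul_sum, sum_coe_sumZero,
    form, poleV]
  simp
  ring

/-- The vector with given zeros. -/
def ofZeros {n : ℕ} (x : Fin (n + 1) → ℂ) : V n :=
  (⟨fun i => x i - (∑ j, x j) / ((n : ℂ) + 1), by
    change ∑ i, (x i - (∑ j, x j) / ((n : ℂ) + 1)) = 0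
    rw [Finset.sum_sub_distrib]
    simp
    field_simp
    ring⟩, -((∑ j, x j) / ((n : ℂ) + 1)))

@[simp] lemma zerosV_ofZeros {n : ℕ} (x : Fin (n + 1) → ℂ) : zerosV (ofZeros x) = x := by
  ext i; simp [zerosV, ofZeros]

@[simp] lemma poleV_ofZeros {n : ℕ} (x : Fin (n + 1) → ℂ) : poleV (ofZeros x) = ∑ i, x i := by
  rw [← sum_zerosV, zerosV_ofZeros]

lemma eq_of_zerosV_eq {n : ℕ} {v w : V n} (h : zerosV v = zerosV w) : v = w := by
  have hp : poleV v = poleV w := by rw [← sum_zerosV, ← sum_zerosV, h]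
  have hn : (n : ℂ) + 1 ≠ 0 := Nat.cast_add_one_ne_zero n
  have h2 : v.2 = w.2 := by
    simp only [poleV, neg_inj] at hp
    exact mul_left_cancel₀ hn hp
  refine Prod.ext (Subtype.ext (funext fun i => ?_)) h2
  have := congrFun h i
  simp only [zerosV, h2] at this
  exact sub_left_injective this

@[simp] lemma ofZeros_zerosV {n : ℕ} (v : V n) : ofZeros (zerosV v) = v :=
  eq_of_zerosV_eq (zerosV_ofZeros _)

/-- The quotient `a / b` as a point of the Riemann sphere. -/
def sphereDiv (a b : ℂ) : OnePoint ℂ :=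
  open Classical in if b = 0 then OnePoint.infty else ((a / b : ℂ) : OnePoint ℂ)

lemma sphereDiv_of_ne {a b : ℂ} (h : b ≠ 0) : sphereDiv a b = ((a / b : ℂ) : OnePoint ℂ) := if_neg h

lemma sphereDiv_zero (a : ℂ) : sphereDiv a 0 = OnePoint.infty := if_pos rfl

lemma sphereDiv_eq_infty {a b : ℂ} : sphereDiv a b = OnePoint.infty ↔ b = 0 := by
  by_cases h : b = 0
  · simp [h, sphereDiv_zero]
  · simp [h, sphereDiv_of_ne]

/-- Equality of points of the projective line in homogeneous coordinates. It turns identities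
between sphere-valued functions into identities between entire functions. -/
lemma sphereDiv_eq_iff {a b c d : ℂ} (h1 : a ≠ 0 ∨ b ≠ 0) (h2 : c ≠ 0 ∨ d ≠ 0) :
    sphereDiv a b = sphereDiv c d ↔ a * d = c * b := by
  by_cases hb : b = 0
  · have ha : a ≠ 0 := h1.resolve_right (by simpa using hb)
    subst hb
    rw [sphereDiv_zero, eq_comm, sphereDiv_eq_infty]
    simp [ha]
  · by_cases hd : d = 0
    · have hc : c ≠ 0 := h2.resolve_right (by simpa using hd)
      subst hd
      rw [sphereDiv_zero, sphereDiv_eq_infty]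
      simp [hc, eq_comm]
    · rw [sphereDiv_of_ne hb, sphereDiv_of_ne hd, OnePoint.coe_eq_coe, div_eq_div_iff hb hd]

lemma sphereHolAt_sphereDiv {E : Type*} [NormedAddCommGroup E] [NormedSpace ℂ E] {a b : E → ℂ} {x : E}
    (ha : HolAt a x) (hb : HolAt b x) (h0 : a x ≠ 0 ∨ b x ≠ 0) :
    SphereHolAt (fun y => sphereDiv (a y) (b y)) x := by
  by_cases hbx : b x = 0
  · have hax : a x ≠ 0 := h0.resolve_right (by simpa using hbx)
    refine Or.inr ⟨fun y => b y / a y, hb.div ha hax, ?_⟩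
    filter_upwards [ha.continuousAt.eventually_ne hax] with y hy
    by_cases hby : b y = 0
    · simp [hby, sphereDiv_zero, recip]
    · simp [sphereDiv_of_ne hby, recip, hby, hy]
  · refine Or.inl ⟨fun y => a y / b y, ha.div hb hbx, ?_⟩
    filter_upwards [hb.continuousAt.eventually_ne hbx] with y hy
    exact sphereDiv_of_ne hy

lemma hasPoleOfOrder_sphereDiv {a b t : ℂ → ℂ} {m : ℕ} {w : ℂ} (hm : m ≠ 0) (ha : HolAt a w)
    (ha0 : a w ≠ 0) (ht : HolAt t w) (ht0 : t w ≠ 0)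
    (hb : ∀ᶠ z in 𝓝 w, b z = (z - w) ^ m * t z) :
    HasPoleOfOrder (fun z => sphereDiv (a z) (b z)) m w := by
  refine ⟨?_, fun z => a z / t z, ha.div ht ht0, div_ne_zero ha0 ht0, ?_⟩
  · rw [sphereDiv_eq_infty, hb.self_of_nhds, sub_self, zero_pow hm, zero_mul]
  · filter_upwards [hb.filter_mono nhdsWithin_le_nhds, self_mem_nhdsWithin,
      (ht.continuousAt.eventually_ne ht0).filter_mono nhdsWithin_le_nhds] with z h1 h2 h3
    have h2' : z - w ≠ 0 := sub_ne_zero.2 h2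
    rw [sphereDiv_of_ne (by rw [h1]; exact mul_ne_zero (pow_ne_zero _ h2') h3), h1]
    congr 1
    field_simp

lemma theta1_factor {τ : ℍ} {w : ℂ} (hw : w ∈ (tauPeriods τ).lattice) :
    ∃ t : ℂ → ℂ, Differentiable ℂ t ∧ t w ≠ 0 ∧ ∀ z, theta1 z τ = (z - w) * t z := by
  have h0 : theta1 w τ = 0 := theta1_eq_zero_iff.2 hw
  refine ⟨dslope (fun z => theta1 z τ) w, ?_, ?_, fun z => ?_⟩
  · rw [← differentiableOn_univ, Complex.differentiableOn_dslope univ_mem]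
    exact (differentiable_theta1 τ).differentiableOn
  · rw [dslope_same]
    exact deriv_theta1_ne_zero h0
  · have := sub_smul_dslope (fun z => theta1 z τ) w z
    simp only [h0, sub_zero, smul_eq_mul] at this
    exact this.symm

variable {n : ℕ}

lemma superNum_eq (p : Omega n) (z : ℂ) : superNum p z =
    Complex.exp (-(2 * Real.pi * Complex.I * p.1)) * ∏ i, theta1 (z - zerosV p.2.1 i) p.2.2 := by
  unfold superNum zerosV
  congr 1
  refine Finset.prod_congr rfl fun i _ => ?_
  congr 1
  ring

lemma superDen_eq (p : Omega n) (z : ℂ) : superDen p z =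
    theta1 z p.2.2 ^ n * theta1 (z - poleV p.2.1) p.2.2 := by
  unfold superDen poleV
  rw [sub_neg_eq_add]

lemma superpotential_eq (p : Omega n) (z : ℂ) :
    superpotential p z = sphereDiv (superNum p z) (superDen p z) := rfl

lemma mem_regularLocus {p : Omega n} : p ∈ regularLocus n ↔
    poleV p.2.1 ∉ (tauPeriods p.2.2).lattice ∧
    ∀ i, zerosV p.2.1 i ∉ (tauPeriods p.2.2).lattice ∧
      zerosV p.2.1 i - poleV p.2.1 ∉ (tauPeriods p.2.2).lattice := by
  have h : ∀ i, p.2.1.1.1 i + (n : ℂ) * p.2.1.2 = zerosV p.2.1 i - poleV p.2.1 := by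
    intro i; simp only [zerosV, poleV]; ring
  have h' : poleV p.2.1 ∈ (tauPeriods p.2.2).lattice ↔
      ((n : ℂ) + 1) * p.2.1.2 ∈ (tauPeriods p.2.2).lattice := by
    rw [poleV, neg_mem_iff]
  rw [h']
  simp only [← h]
  rfl

lemma superNum_eq_zero_iff {p : Omega n} {z : ℂ} : superNum p z = 0 ↔
    ∃ i, z - zerosV p.2.1 i ∈ (tauPeriods p.2.2).lattice := by
  rw [superNum_eq, mul_eq_zero, or_iff_right (Complex.exp_ne_zero _), Finset.prod_eq_zero_iff]
  simp [theta1_eq_zero_iff]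

lemma superDen_eq_zero_iff (hn : 1 ≤ n) {p : Omega n} {z : ℂ} : superDen p z = 0 ↔
    z ∈ (tauPeriods p.2.2).lattice ∨ z - poleV p.2.1 ∈ (tauPeriods p.2.2).lattice := by
  rw [superDen_eq, mul_eq_zero, pow_eq_zero_iff (by omega), theta1_eq_zero_iff, theta1_eq_zero_iff]

/-- The purpose of the regular locus: numerator and denominator have no common zero, so nothing
cancels and the pole orders are exact. -/
lemma superNum_ne_zero_or (hn : 1 ≤ n) {p : Omega n} (hp : p ∈ regularLocus n) (z : ℂ) :
    superNum p z ≠ 0 ∨ superDen p z ≠ 0 := by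
  rw [mem_regularLocus] at hp
  by_contra! hcon
  obtain ⟨h1, h2⟩ := hcon
  obtain ⟨i, hi⟩ := superNum_eq_zero_iff.1 h1
  rcases (superDen_eq_zero_iff hn).1 h2 with h | h
  · exact (hp.2 i).1 (by simpa using sub_mem h hi)
  · exact (hp.2 i).2 (by simpa using sub_mem h hi)

lemma superpotential_eq_superpotential_iff (hn : 1 ≤ n) {p q : Omega n} (hp : p ∈ regularLocus n)
    (hq : q ∈ regularLocus n) (z w : ℂ) : superpotential p z = superpotential q w ↔
      superNum p z * superDen q w = superNum q w * superDen p z :=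
  sphereDiv_eq_iff (superNum_ne_zero_or hn hp z) (superNum_ne_zero_or hn hq w)

lemma differentiable_superNum (p : Omega n) : Differentiable ℂ (superNum p) := by
  have : superNum p = fun z => Complex.exp (-(2 * Real.pi * Complex.I * p.1)) *
      ∏ i, theta1 (z - zerosV p.2.1 i) p.2.2 := funext (superNum_eq p)
  rw [this]
  have h : ∀ i, Differentiable ℂ fun z => theta1 (z - zerosV p.2.1 i) p.2.2 := fun i =>
    (differentiable_theta1 _).comp (by fun_prop : Differentiable ℂ fun z => z - zerosV p.2.1 i)
  exact Differentiable.const_mul (fun z => (HolAt.prod fun i _ =>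
    holAt_of_differentiable (h i) z).differentiableAt) _

lemma differentiable_superDen (p : Omega n) : Differentiable ℂ (superDen p) := by
  have : superDen p = fun z => theta1 z p.2.2 ^ n * theta1 (z - poleV p.2.1) p.2.2 :=
    funext (superDen_eq p)
  rw [this]
  exact ((differentiable_theta1 _).pow n).mul
    ((differentiable_theta1 _).comp (by fun_prop : Differentiable ℂ fun z => z - poleV p.2.1))

lemma thetaFactor_sub (τ : ℂ) (m k : ℤ) (z x : ℂ) : thetaFactor τ m k (z - x) =
    thetaFactor τ m k z * Complex.exp (2 * Real.pi * Complex.I * k * x) := by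
  rw [thetaFactor, thetaFactor, ← Complex.exp_add]
  congr 1
  ring

lemma hasPoleOfOrder_superpotential (hn : 1 ≤ n) {p : Omega n} (hp : p ∈ regularLocus n) :
    HasPoleOfOrder (superpotential p) n 0 ∧ HasPoleOfOrder (superpotential p) 1 (poleV p.2.1) := by
  have hp' := mem_regularLocus.1 hp
  constructor
  · obtain ⟨t, ht, ht0, hθ⟩ := theta1_factor (zero_mem (tauPeriods p.2.2).lattice)
    have hpole : theta1 (0 - poleV p.2.1) p.2.2 ≠ 0 := by
      rw [Ne, theta1_eq_zero_iff, zero_sub, neg_mem_iff]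
      exact hp'.1
    refine hasPoleOfOrder_sphereDiv (t := fun z => t z ^ n * theta1 (z - poleV p.2.1) p.2.2) (by omega)
      (holAt_of_differentiable (differentiable_superNum p) 0) ?_
      (holAt_of_differentiable ((ht.pow n).mul ((differentiable_theta1 _).comp
        (by fun_prop : Differentiable ℂ fun z => z - poleV p.2.1))) 0)
      (mul_ne_zero (pow_ne_zero _ ht0) hpole) (Eventually.of_forall fun z => ?_)
    · refine (superNum_ne_zero_or hn hp 0).resolve_right (not_not.2 ?_)
      rw [superDen_eq_zero_iff hn]
      exact Or.inl (zero_mem _)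
    · rw [superDen_eq, hθ z, mul_pow]
      ring
  · obtain ⟨t, ht, ht0, hθ⟩ := theta1_factor (zero_mem (tauPeriods p.2.2).lattice)
    have hpole : theta1 (poleV p.2.1) p.2.2 ≠ 0 := by
      rw [Ne, theta1_eq_zero_iff]
      exact hp'.1
    refine hasPoleOfOrder_sphereDiv (t := fun z => theta1 z p.2.2 ^ n * t (z - poleV p.2.1)) one_ne_zero
      (holAt_of_differentiable (differentiable_superNum p) _) ?_
      (holAt_of_differentiable (((differentiable_theta1 _).pow n).mul (ht.comp
        (by fun_prop : Differentiable ℂ fun z => z - poleV p.2.1))) _)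
      (mul_ne_zero (pow_ne_zero _ hpole) (by simpa using ht0)) (Eventually.of_forall fun z => ?_)
    · refine (superNum_ne_zero_or hn hp _).resolve_right (not_not.2 ?_)
      rw [superDen_eq_zero_iff hn]
      exact Or.inr (by simp)
    · rw [superDen_eq, hθ (z - _)]
      ring

/-- For regular parameters the superpotential is an elliptic function with the required poles. -/
theorem isHurwitzFunction_superpotential (hn : 1 ≤ n) {p : Omega n} (hp : p ∈ regularLocus n) :
    IsHurwitzFunction n (tauPeriods p.2.2) (superpotential p) := by
  have hp' := mem_regularLocus.1 hp
  refine ⟨fun z => ?_, fun z ω hω => ?_, 0, poleV p.2.1, by simpa using hp'.1,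
    (hasPoleOfOrder_superpotential hn hp).1, (hasPoleOfOrder_superpotential hn hp).2, fun z hz => ?_⟩
  · exact sphereHolAt_sphereDiv (holAt_of_differentiable (differentiable_superNum p) z)
      (holAt_of_differentiable (differentiable_superDen p) z) (superNum_ne_zero_or hn hp z)
  · rw [superpotential_eq_superpotential_iff hn hp hp]
    obtain ⟨m, k, rfl⟩ := mem_tauLattice.1 hω
    have h1 : ∀ x : ℂ, theta1 (z + (m + k * (p.2.2 : ℂ)) - x) p.2.2 =
        thetaFactor p.2.2 m k z * (Complex.exp (2 * Real.pi * Complex.I * k * x) * theta1 (z - x) p.2.2) := by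
      intro x
      rw [add_sub_right_comm, theta1_add_lattice, thetaFactor_sub]
      ring
    have h0 := h1 0
    simp only [sub_zero, mul_zero, Complex.exp_zero, one_mul] at h0
    -- The factors depending on the zeros and on the pole combine to `exp(2πik ∑ xᵢ)` and
    -- `exp(2πikκ)`, which agree by `sum_zerosV`.
    simp only [superNum_eq, superDen_eq, h1, h0, Finset.prod_mul_distrib, ← Complex.exp_sum,
      ← Finset.mul_sum, sum_zerosV, Finset.prod_const, Finset.card_univ, Fintype.card_fin]
    ring
  · rw [superpotential_eq, sphereDiv_eq_infty, superDen_eq_zero_iff hn] at hz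
    simpa using hz

/-! ### Invariance under the Jacobi group -/

/-- `q` lies in the regular locus if and only if `p` does, and then the superpotentials agree up
to a homothety `z ↦ α z` between the lattices. -/
def SuperEquiv (p q : Omega n) : Prop :=
  (p ∈ regularLocus n ↔ q ∈ regularLocus n) ∧ (p ∈ regularLocus n → ∃ α : ℂ, α ≠ 0 ∧
    (∀ z, z ∈ (tauPeriods p.2.2).lattice ↔ α * z ∈ (tauPeriods q.2.2).lattice) ∧
    ∀ z, superpotential q (α * z) = superpotential p z)

lemma SuperEquiv.refl (p : Omega n) : SuperEquiv p p :=
  ⟨Iff.rfl, fun _ => ⟨1, one_ne_zero, by simp, by simp⟩⟩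

lemma SuperEquiv.symm {p q : Omega n} (h : SuperEquiv p q) : SuperEquiv q p := by
  refine ⟨h.1.symm, fun hq => ?_⟩
  obtain ⟨α, h0, h1, h2⟩ := h.2 (h.1.2 hq)
  refine ⟨α⁻¹, inv_ne_zero h0, fun z => ?_, fun z => ?_⟩
  · rw [h1, mul_inv_cancel_left₀ h0]
  · rw [← h2, mul_inv_cancel_left₀ h0]

lemma SuperEquiv.trans {p q r : Omega n} (h : SuperEquiv p q) (h' : SuperEquiv q r) :
    SuperEquiv p r := by
  refine ⟨h.1.trans h'.1, fun hp => ?_⟩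
  obtain ⟨α, h0, h1, h2⟩ := h.2 hp
  obtain ⟨β, h0', h1', h2'⟩ := h'.2 (h.1.1 hp)
  refine ⟨β * α, mul_ne_zero h0' h0, fun z => ?_, fun z => ?_⟩
  · rw [h1, h1', mul_assoc]
  · rw [mul_assoc, h2', h2]

lemma superpotential_weylAct (w : Equiv.Perm (Fin (n + 1))) (p : Omega n) :
    (p ∈ regularLocus n ↔ weylAct w p ∈ regularLocus n) ∧
      ∀ z, superpotential (weylAct w p) z = superpotential p z := by
  have hz : ∀ i, zerosV (permV w p.2.1) i = zerosV p.2.1 (w.symm i) := fun i => rfl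
  have hpole : poleV (permV w p.2.1) = poleV p.2.1 := rfl
  have hreg : p ∈ regularLocus n ↔ weylAct w p ∈ regularLocus n := by
    rw [mem_regularLocus, mem_regularLocus]
    simp only [weylAct, Equiv.coe_fn_mk, hz, hpole]
    refine and_congr_right fun _ => ?_
    exact ⟨fun h i => h (w.symm i), fun h i => by simpa using h (w i)⟩
  refine ⟨hreg, fun z => ?_⟩
  have h1 : superNum (weylAct w p) z = superNum p z := by
    simp only [superNum_eq, weylAct, Equiv.coe_fn_mk, hz]
    congr 1
    exact Equiv.prod_comp w.symm fun i => theta1 (z - zerosV p.2.1 i) p.2.2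
  have h2 : superDen (weylAct w p) z = superDen p z := by
    simp only [superDen_eq, weylAct, Equiv.coe_fn_mk, hpole]
  rw [superpotential_eq, superpotential_eq, h1, h2]

lemma superEquiv_weylAct (w : Equiv.Perm (Fin (n + 1))) (p : Omega n) :
    SuperEquiv p (weylAct w p) :=
  ⟨(superpotential_weylAct w p).1, fun _ => ⟨1, one_ne_zero, fun z => by simp [weylAct], fun z => by
    rw [one_mul, (superpotential_weylAct w p).2]⟩⟩

lemma zerosV_add_smul_add (v l m : V n) (τ : ℂ) (i : Fin (n + 1)) :
    zerosV (v + τ • l + m) i = zerosV v i + (zerosV m i + zerosV l i * τ) := by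
  simp [zerosV]
  ring

lemma poleV_add_smul_add (v l m : V n) (τ : ℂ) :
    poleV (v + τ • l + m) = poleV v + (poleV m + poleV l * τ) := by
  simp [poleV]
  ring

lemma exists_int_of_mem_L (l : L n) : ∃ a : Fin (n + 1) → ℤ, ∃ b : ℤ,
    (∀ i, zerosV l.1 i = a i) ∧ poleV l.1 = b ∧ ∑ i, a i = b := by
  obtain ⟨h1, m, hm⟩ := l.2
  choose a ha using h1
  refine ⟨fun i => a i - m, ∑ i, (a i - m), fun i => ?_, ?_, rfl⟩
  · simp [zerosV, ha, hm]
  · rw [← sum_zerosV]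
    simp [zerosV, ha, hm]

/-- A lattice translation changes each theta factor by a factor of automorphy. The total exponent is
independent of `z`, and the prescribed change of `u` cancels it up to an integral multiple of `2πi`.
-/
lemma superpotential_translationAct (hn : 1 ≤ n) (l m : L n) (k : ℤ) (p : Omega n) :
    (p ∈ regularLocus n ↔ translationAct l m k p ∈ regularLocus n) ∧
      (p ∈ regularLocus n → ∀ z, superpotential (translationAct l m k p) z = superpotential p z) := by
  obtain ⟨a, A, ha, hA, haA⟩ := exists_int_of_mem_L l
  obtain ⟨b, B, hb, hB, hbB⟩ := exists_int_of_mem_L m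
  set q := translationAct l m k p with hq
  have hqτ : q.2.2 = p.2.2 := rfl
  have hz : ∀ i, zerosV q.2.1 i = zerosV p.2.1 i + (b i + a i * (p.2.2 : ℂ)) := by
    intro i
    rw [← ha, ← hb]
    exact zerosV_add_smul_add _ _ _ _ _
  have hpole : poleV q.2.1 = poleV p.2.1 + (B + A * (p.2.2 : ℂ)) := by
    rw [← hA, ← hB]
    exact poleV_add_smul_add _ _ _ _
  have hlat : ∀ b a : ℤ, (b : ℂ) + a * (p.2.2 : ℂ) ∈ (tauPeriods p.2.2).lattice := fun b a =>
    mem_tauLattice.2 ⟨b, a, rfl⟩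
  have hreg : p ∈ regularLocus n ↔ q ∈ regularLocus n := by
    rw [mem_regularLocus, mem_regularLocus, hqτ, hpole]
    refine and_congr (not_congr (add_mem_cancel_right (hlat _ _)).symm) (forall_congr' fun i => ?_)
    rw [hz]
    refine and_congr (not_congr (add_mem_cancel_right (hlat _ _)).symm) (not_congr ?_)
    rw [add_sub_add_comm]
    exact (add_mem_cancel_right (sub_mem (hlat _ _) (hlat _ _))).symm
  refine ⟨hreg, fun hp z => ?_⟩
  rw [superpotential_eq_superpotential_iff hn (hreg.1 hp) hp]
  have hθ : ∀ (x : ℂ) (b a : ℤ), theta1 (z - (x + (b + a * (p.2.2 : ℂ)))) p.2.2 =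
      thetaFactor p.2.2 (-b) (-a) (z - x) * theta1 (z - x) p.2.2 := by
    intro x b a
    rw [← theta1_add_lattice]
    congr 1
    push_cast
    ring
  have hu : q.1 = p.1 - form l.1 p.2.1 - form l.1 l.1 * (p.2.2 : ℂ) / 2 + k := rfl
  have hA' : (A : ℂ) = ∑ i, (a i : ℂ) := by rw [← haA]; push_cast; rfl
  have hB' : (B : ℂ) = ∑ i, (b i : ℂ) := by rw [← hbB]; push_cast; rfl
  -- The terms linear in `z` and the signs cancel because the integers `aᵢ`, `bᵢ` sum to `A`, `B`;
  -- what remains is `⟨λ, v⟩` and `⟨λ, λ⟩τ/2` through `form_eq`.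
  have key : Complex.exp (-(2 * Real.pi * Complex.I * q.1)) *
      ∏ i, thetaFactor p.2.2 (-b i) (-a i) (z - zerosV p.2.1 i) =
      Complex.exp (-(2 * Real.pi * Complex.I * p.1)) *
        thetaFactor p.2.2 (-B) (-A) (z - poleV p.2.1) := by
    have hk : Complex.exp (-k * (2 * Real.pi * Complex.I)) = 1 := by
      have := Complex.exp_int_mul_two_pi_mul_I (-k)
      exact_mod_cast this
    rw [← mul_one (Complex.exp (-(2 * Real.pi * Complex.I * p.1))), ← hk]
    simp only [thetaFactor]
    rw [← Complex.exp_sum, ← Complex.exp_add, ← Complex.exp_add, ← Complex.exp_add]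
    congr 1
    rw [hu, form_eq, form_eq]
    simp only [ha, hA]
    have e : ∀ i, (Real.pi * Complex.I * (((-b i : ℤ) : ℂ) + ((-a i : ℤ) : ℂ)) -
        Real.pi * Complex.I * ((-a i : ℤ) : ℂ) ^ 2 * (p.2.2 : ℂ) -
        2 * Real.pi * Complex.I * ((-a i : ℤ) : ℂ) * (z - zerosV p.2.1 i) : ℂ) =
        (-(Real.pi * Complex.I)) * b i + (-(Real.pi * Complex.I) + 2 * Real.pi * Complex.I * z) * a i -
        (Real.pi * Complex.I * (p.2.2 : ℂ)) * ((a i : ℂ) * a i) -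
        (2 * Real.pi * Complex.I) * ((a i : ℂ) * zerosV p.2.1 i) := by
      intro i; push_cast; ring
    simp only [e, Finset.sum_sub_distrib, Finset.sum_add_distrib, ← Finset.mul_sum, ← hA', ← hB']
    push_cast
    ring
  rw [superNum_eq q, superDen_eq q, superNum_eq p, superDen_eq p, hqτ]
  simp only [hz, hpole, hθ, Finset.prod_mul_distrib]
  linear_combination (theta1 z p.2.2 ^ n * theta1 (z - poleV p.2.1) p.2.2 *
    ∏ i, theta1 (z - zerosV p.2.1 i) p.2.2) * key

lemma superEquiv_translationAct (hn : 1 ≤ n) (l m : L n) (k : ℤ) (p : Omega n) :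
    SuperEquiv p (translationAct l m k p) :=
  ⟨(superpotential_translationAct hn l m k p).1, fun hp => ⟨1, one_ne_zero,
    fun z => by simp [translationAct], fun z => by
      rw [one_mul, (superpotential_translationAct hn l m k p).2 hp]⟩⟩

lemma mem_lattice_smul_iff (γ : SL(2, ℤ)) (τ : ℍ) (z : ℂ) :
    z ∈ (tauPeriods τ).lattice ↔ (cocyc γ τ)⁻¹ * z ∈ (tauPeriods (γ • τ)).lattice := by
  have hJ0 : cocyc γ τ ≠ 0 := cocyc_ne_zero γ τ
  have hτJ := coe_smul_mul_cocyc γ τ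
  have hdet' : ((γ 0 0 : ℤ) : ℂ) * (γ 1 1 : ℤ) - (γ 0 1 : ℤ) * (γ 1 0 : ℤ) = 1 := by
    exact_mod_cast det_eq_one γ
  have hJ : cocyc γ τ = ((γ 1 0 : ℤ) : ℂ) * (τ : ℂ) + ((γ 1 1 : ℤ) : ℂ) := rfl
  rw [mem_tauLattice, mem_tauLattice]
  constructor
  · rintro ⟨m, k, rfl⟩
    refine ⟨m * γ 0 0 - k * γ 0 1, k * γ 1 1 - m * γ 1 0, ?_⟩
    rw [inv_mul_eq_iff_eq_mul₀ hJ0]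
    push_cast
    linear_combination (-(m : ℂ) * γ 0 0 + k * γ 0 1) * hJ + (m * γ 1 0 - k * γ 1 1) * hτJ +
      (-(m : ℂ) - k * τ) * hdet'
  · rintro ⟨m, k, h⟩
    refine ⟨m * γ 1 1 + k * γ 0 1, m * γ 1 0 + k * γ 0 0, ?_⟩
    rw [inv_mul_eq_iff_eq_mul₀ hJ0] at h
    rw [h]
    push_cast
    linear_combination (m : ℂ) * hJ + (k : ℂ) * hτJ

/-- The constant `ε` and the Gaussian factor in `z²` occur `n + 1` times on both sides, and the
terms linear in `z` cancel since the zeros sum to the pole. The remaining exponent is a multiple of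
`⟨v, v⟩`, which the change of `u` absorbs. -/
lemma superEquiv_modularAct (hn : 1 ≤ n) (γ : SL(2, ℤ)) (p : Omega n) :
    SuperEquiv p (modularAct γ p) := by
  set J := cocyc γ p.2.2 with hJ
  have hJ0 : J ≠ 0 := cocyc_ne_zero γ p.2.2
  set q := modularAct γ p with hq
  have hqτ : q.2.2 = γ • p.2.2 := rfl
  have hz : ∀ i, zerosV q.2.1 i = J⁻¹ * zerosV p.2.1 i := by
    intro i
    change J⁻¹ * p.2.1.1.1 i - J⁻¹ * p.2.1.2 = _
    rw [zerosV]; ring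
  have hpole : poleV q.2.1 = J⁻¹ * poleV p.2.1 := by
    change -(((n : ℂ) + 1) * (J⁻¹ * p.2.1.2)) = _
    rw [poleV]; ring
  have hlat : ∀ z, z ∈ (tauPeriods p.2.2).lattice ↔ J⁻¹ * z ∈ (tauPeriods q.2.2).lattice :=
    fun z => mem_lattice_smul_iff γ p.2.2 z
  have hreg : p ∈ regularLocus n ↔ q ∈ regularLocus n := by
    rw [mem_regularLocus, mem_regularLocus, hpole]
    simp only [hz, ← mul_sub, ← hlat]
  refine ⟨hreg, fun hp => ⟨J⁻¹, inv_ne_zero hJ0, hlat, fun z => ?_⟩⟩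
  rw [superpotential_eq_superpotential_iff hn (hreg.1 hp) hp]
  obtain ⟨ε, hε, hθ⟩ := exists_theta1_modular γ p.2.2
  simp only [← hJ] at hθ
  have hu : q.1 = p.1 + ((γ 1 0 : ℤ) : ℂ) * form p.2.1 p.2.1 / (2 * J) := rfl
  have hpv : poleV p.2.1 = ∑ i, zerosV p.2.1 i := (sum_zerosV _).symm
  set c : ℂ := ((γ 1 0 : ℤ) : ℂ) with hc
  have key : Complex.exp (-(2 * Real.pi * Complex.I * q.1)) *
      ∏ i, Complex.exp (Real.pi * Complex.I * c * (z - zerosV p.2.1 i) ^ 2 / J) =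
      Complex.exp (-(2 * Real.pi * Complex.I * p.1)) *
        (Complex.exp (Real.pi * Complex.I * c * z ^ 2 / J) ^ n *
          Complex.exp (Real.pi * Complex.I * c * (z - poleV p.2.1) ^ 2 / J)) := by
    rw [← Complex.exp_sum, ← Complex.exp_nat_mul, ← Complex.exp_add, ← Complex.exp_add, ← Complex.exp_add]
    congr 1
    rw [hu, form_eq]
    have e : ∀ i, Real.pi * Complex.I * c * (z - zerosV p.2.1 i) ^ 2 / J =
        Real.pi * Complex.I * c * z ^ 2 / J - (2 * Real.pi * Complex.I * c * z / J) * zerosV p.2.1 i +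
        (Real.pi * Complex.I * c / J) * (zerosV p.2.1 i * zerosV p.2.1 i) := by
      intro i; ring
    simp only [e, Finset.sum_sub_distrib, Finset.sum_add_distrib, ← Finset.mul_sum, ← hpv,
      Finset.sum_const, Finset.card_univ, Fintype.card_fin, nsmul_eq_mul]
    push_cast
    field_simp
    ring
  rw [superNum_eq q, superDen_eq q, superNum_eq p, superDen_eq p, hqτ]
  simp only [hz, hpole, ← mul_sub, hθ, Finset.prod_mul_distrib, Finset.prod_const, Finset.card_univ,
    Fintype.card_fin]
  linear_combination (ε ^ (n + 1) * theta1 z p.2.2 ^ n * theta1 (z - poleV p.2.1) p.2.2 *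
    ∏ i, theta1 (z - zerosV p.2.1 i) p.2.2) * key

theorem superEquiv_of_mem_jacobiGroup (hn : 1 ≤ n) {g : Equiv.Perm (Omega n)}
    (hg : g ∈ jacobiGroup n) : ∀ p, SuperEquiv p (g p) := by
  unfold jacobiGroup at hg
  induction hg using Subgroup.closure_induction with
  | mem g hg =>
    intro p
    rcases hg with (hg | hg) | hg
    · obtain ⟨w, hw⟩ := hg
      rw [← hw]
      exact superEquiv_weylAct w p
    · obtain ⟨l, m, k, hw⟩ := hg
      rw [hw]
      exact superEquiv_translationAct hn l m k p
    · obtain ⟨γ, hw⟩ := hg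
      rw [← hw]
      exact superEquiv_modularAct hn γ p
  | one => exact fun p => SuperEquiv.refl p
  | mul g h _ _ hg hh =>
    intro p
    rw [Equiv.Perm.mul_apply]
    exact (hh p).trans (hg (h p))
  | inv g _ hg =>
    intro p
    have := (hg (g⁻¹ p)).symm
    rwa [show g (g⁻¹ p) = p from g.apply_symm_apply p] at this

end

section

/-! ### Normal form of an elliptic function with the prescribed poles -/

/-- Local holomorphic extensions patch together. -/
lemma exists_differentiable_of_local {φ : ℂ → ℂ}
    (h : ∀ w, ∃ H, HolAt H w ∧ ∀ᶠ z in 𝓝[≠] w, φ z = H z) :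
    ∃ F : ℂ → ℂ, Differentiable ℂ F ∧
      ∀ w H, HolAt H w → (∀ᶠ z in 𝓝[≠] w, φ z = H z) → ∀ᶠ z in 𝓝 w, F z = H z := by
  -- The patched function takes at `z` the value of the local extension chosen at `z`; limits along
  -- the punctured neighbourhood make this value independent of the choice.
  choose K hK hK' using h
  have key : ∀ w H, HolAt H w → (∀ᶠ z in 𝓝[≠] w, φ z = H z) → K w w = H w := by
    intro w H hH hH'
    have h1 : Tendsto (K w) (𝓝[≠] w) (𝓝 (K w w)) := (hK w).continuousAt.tendsto.mono_left nhdsWithin_le_nhds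
    have h2 : Tendsto H (𝓝[≠] w) (𝓝 (H w)) := hH.continuousAt.tendsto.mono_left nhdsWithin_le_nhds
    refine tendsto_nhds_unique h1 (h2.congr' ?_)
    filter_upwards [hK' w, hH'] with z a b
    rw [← a, b]
  have key2 : ∀ w H, HolAt H w → (∀ᶠ z in 𝓝[≠] w, φ z = H z) → ∀ᶠ z in 𝓝 w, K z z = H z := by
    intro w H hH hH'
    have h1 : ∀ᶠ z in 𝓝[≠] w, K z z = H z := by
      have h2 : ∀ᶠ z in 𝓝[≠] w, ∀ᶠ y in 𝓝 z, φ y = H y := by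
        have := eventually_nhdsWithin_iff.1 hH'
        rw [eventually_nhdsWithin_iff]
        filter_upwards [eventually_eventually_nhds.2 this] with z hz hzw
        filter_upwards [hz, isOpen_ne.mem_nhds hzw] with y a b
        exact a b
      filter_upwards [h2, hH.eventually.filter_mono nhdsWithin_le_nhds] with z a b
      exact key z H b (a.filter_mono nhdsWithin_le_nhds)
    rw [eventually_nhdsWithin_iff] at h1
    filter_upwards [h1] with z hz
    by_cases hzw : z = w
    · rw [hzw]; exact key w H hH hH'
    · exact hz hzw
  refine ⟨fun z => K z z, fun w => ?_, key2⟩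
  exact ((hK w).congr ((key2 w (K w) (hK w) (hK' w)).mono fun z hz => hz.symm)).differentiableAt

lemma SphereHolAt.comp' {E F : Type*} [NormedAddCommGroup E] [NormedSpace ℂ E]
    [NormedAddCommGroup F] [NormedSpace ℂ F] {f : E → OnePoint ℂ} {g : F → E} {x : F}
    (hf : SphereHolAt f (g x)) (hg : HolAt g x) : SphereHolAt (fun y => f (g y)) x := by
  rcases hf with ⟨h, h1, h2⟩ | ⟨h, h1, h2⟩
  · exact Or.inl ⟨fun y => h (g y), h1.comp' hg, hg.continuousAt.eventually h2⟩
  · exact Or.inr ⟨fun y => h (g y), h1.comp' hg, hg.continuousAt.eventually h2⟩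

lemma tendsto_affine_punctured {α : ℂ} (hα : α ≠ 0) (β w : ℂ) :
    Tendsto (fun z => α * z + β) (𝓝[≠] w) (𝓝[≠] (α * w + β)) := by
  refine tendsto_nhdsWithin_iff.2 ⟨?_, ?_⟩
  · exact (Continuous.tendsto (by fun_prop) w).mono_left nhdsWithin_le_nhds
  · filter_upwards [self_mem_nhdsWithin] with z hz
    simpa [hα] using hz

lemma HasPoleOfOrder.comp_affine {f : ℂ → OnePoint ℂ} {m : ℕ} {α β w : ℂ} (hα : α ≠ 0)
    (h : HasPoleOfOrder f m (α * w + β)) : HasPoleOfOrder (fun z => f (α * z + β)) m w := by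
  obtain ⟨h1, g, hg, hg0, hf⟩ := h
  have hd : Differentiable ℂ fun z : ℂ => α * z + β := by fun_prop
  have haff : HolAt (fun z => α * z + β) w := holAt_of_differentiable hd w
  refine ⟨h1, fun z => g (α * z + β) * (α ^ m)⁻¹, (HolAt.comp' (f := fun z => α * z + β) (x := w) hg haff).mul
    (holAt_of_differentiable (differentiable_const _) w),
    mul_ne_zero hg0 (inv_ne_zero (pow_ne_zero _ hα)), ?_⟩
  filter_upwards [(tendsto_affine_punctured hα β w).eventually hf] with z hz
  rw [hz]
  congr 1
  have : α * z + β - (α * w + β) = α * (z - w) := by ring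
  rw [this, mul_pow, div_eq_mul_inv, div_eq_mul_inv, mul_inv]
  ring

lemma HasPoleOfOrder.exists_numerator {g : ℂ → OnePoint ℂ} {m : ℕ} {w : ℂ} {D T : ℂ → ℂ}
    (h : HasPoleOfOrder g m w) (hT : HolAt T w) (hT0 : T w ≠ 0)
    (hD : ∀ z, D z = (z - w) ^ m * T z) :
    ∃ H, HolAt H w ∧ H w ≠ 0 ∧ ∀ᶠ z in 𝓝[≠] w, g z = sphereDiv (H z) (D z) := by
  obtain ⟨h1, G, hG, hG0, hf⟩ := h
  refine ⟨fun z => G z * T z, hG.mul hT, mul_ne_zero hG0 hT0, ?_⟩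
  filter_upwards [hf, self_mem_nhdsWithin,
    (hT.continuousAt.eventually_ne hT0).filter_mono nhdsWithin_le_nhds] with z h1 h2 h3
  have h2' : z - w ≠ 0 := sub_ne_zero.2 h2
  rw [h1, sphereDiv_of_ne (by rw [hD]; exact mul_ne_zero (pow_ne_zero _ h2') h3), hD]
  congr 1
  field_simp

lemma SphereHolAt.exists_numerator {g : ℂ → OnePoint ℂ} {w : ℂ} {D : ℂ → ℂ}
    (h : SphereHolAt g w) (hg : g w ≠ OnePoint.infty) (hD : HolAt D w) (hD0 : D w ≠ 0) :
    ∃ H, HolAt H w ∧ ∀ᶠ z in 𝓝 w, g z = sphereDiv (H z) (D z) := by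
  rcases h with ⟨h, h1, h2⟩ | ⟨h, h1, h2⟩
  · refine ⟨fun z => h z * D z, h1.mul hD, ?_⟩
    filter_upwards [h2, hD.continuousAt.eventually_ne hD0] with z a b
    rw [a, sphereDiv_of_ne b, mul_div_cancel_right₀ _ b]
  · have hw : h w ≠ 0 := by
      intro h0
      apply hg
      rw [h2.self_of_nhds, h0, recip, if_pos rfl]
    refine ⟨fun z => D z / h z, hD.div h1 hw, ?_⟩
    filter_upwards [h2, hD.continuousAt.eventually_ne hD0, h1.continuousAt.eventually_ne hw] with z a b c
    rw [a, sphereDiv_of_ne b, recip, if_neg c]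
    congr 1
    field_simp

lemma sphereDiv_inj {a b c : ℂ} (hb : b ≠ 0) (h : sphereDiv a b = sphereDiv c b) : a = c := by
  rw [sphereDiv_eq_iff (Or.inr hb) (Or.inr hb)] at h
  exact mul_right_cancel₀ hb h

lemma HasPoleOfOrder.add_period {P : PeriodPair} {f : ℂ → OnePoint ℂ} {m : ℕ} {a ω : ℂ}
    (hper : ∀ z, ∀ ω ∈ P.lattice, f (z + ω) = f z) (hω : ω ∈ P.lattice) (h : HasPoleOfOrder f m a) :
    HasPoleOfOrder f m (a + ω) := by
  have h' : HasPoleOfOrder (fun z => f (1 * z + -ω)) m (a + ω) :=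
    HasPoleOfOrder.comp_affine one_ne_zero (by simpa using h)
  have : (fun z => f (1 * z + -ω)) = f := by
    ext z
    rw [one_mul]
    exact hper z (-ω) (neg_mem hω)
  rwa [this] at h'

/-- The numerator of an elliptic function with a pole of order `n` at `0` and a simple one at `κ`. -/
lemma exists_entire_numerator {n : ℕ} (hn : 1 ≤ n) {τ : ℍ} {g : ℂ → OnePoint ℂ} {κ : ℂ}
    (hhol : ∀ z, SphereHolAt g z) (hper : ∀ z, ∀ ω ∈ (tauPeriods τ).lattice, g (z + ω) = g z)
    (hκ : κ ∉ (tauPeriods τ).lattice) (h0 : HasPoleOfOrder g n 0) (h1 : HasPoleOfOrder g 1 κ)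
    (hp : ∀ z, g z = OnePoint.infty → z ∈ (tauPeriods τ).lattice ∨ z - κ ∈ (tauPeriods τ).lattice) :
    ∃ F : ℂ → ℂ, Differentiable ℂ F ∧
      (∀ z, F z ≠ 0 ∨ theta1 z τ ^ n * theta1 (z - κ) τ ≠ 0) ∧
      ∀ z, g z = sphereDiv (F z) (theta1 z τ ^ n * theta1 (z - κ) τ) := by
  set D : ℂ → ℂ := fun z => theta1 z τ ^ n * theta1 (z - κ) τ with hDdef
  have hθκ : Differentiable ℂ fun z => theta1 (z - κ) τ :=
    (differentiable_theta1 _).comp (by fun_prop : Differentiable ℂ fun z => z - κ)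
  have hDd : Differentiable ℂ D := ((differentiable_theta1 τ).pow n).mul hθκ
  have hD0 : ∀ z, D z = 0 ↔ z ∈ (tauPeriods τ).lattice ∨ z - κ ∈ (tauPeriods τ).lattice := by
    intro z
    rw [hDdef]
    simp only
    rw [mul_eq_zero, pow_eq_zero_iff (by omega), theta1_eq_zero_iff, theta1_eq_zero_iff]
  -- Local numerators of `g` over the common denominator `D`. Where `D` vanishes, exactness of the
  -- pole order makes the numerator nonzero.
  have hloc : ∀ w, ∃ H, HolAt H w ∧ (H w ≠ 0 ∨ D w ≠ 0) ∧ (D w ≠ 0 → g w = sphereDiv (H w) (D w)) ∧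
      ∀ᶠ z in 𝓝[≠] w, g z = sphereDiv (H z) (D z) := by
    intro w
    by_cases hw : D w = 0
    · rcases (hD0 w).1 hw with hw' | hw'
      · obtain ⟨t, ht, ht0, hθ⟩ := theta1_factor hw'
        have hpole := h0.add_period hper hw'
        rw [zero_add] at hpole
        obtain ⟨H, hH, hH0, hH'⟩ := hpole.exists_numerator (D := D)
          (T := fun z => t z ^ n * theta1 (z - κ) τ)
          (holAt_of_differentiable ((ht.pow n).mul hθκ) w) (by
            refine mul_ne_zero (pow_ne_zero _ ht0) ?_
            rw [Ne, theta1_eq_zero_iff]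
            exact fun hc => hκ (by simpa using sub_mem hw' hc)) (fun z => by
            rw [hDdef]; simp only [hθ z, mul_pow]; ring)
        exact ⟨H, hH, Or.inl hH0, fun hc => absurd hw hc, hH'⟩
      · obtain ⟨t, ht, ht0, hθ⟩ := theta1_factor hw'
        have hpole := h1.add_period hper hw'
        rw [add_sub_cancel] at hpole
        obtain ⟨H, hH, hH0, hH'⟩ := hpole.exists_numerator (D := D)
          (T := fun z => theta1 z τ ^ n * t (z - κ))
          (holAt_of_differentiable (((differentiable_theta1 τ).pow n).mul
            (ht.comp (by fun_prop : Differentiable ℂ fun z => z - κ))) w) (by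
            refine mul_ne_zero (pow_ne_zero _ ?_) ht0
            rw [Ne, theta1_eq_zero_iff]
            exact fun hc => hκ (by simpa using sub_mem hc hw')) (fun z => by
            rw [hDdef]; simp only [hθ (z - κ)]; ring)
        exact ⟨H, hH, Or.inl hH0, fun hc => absurd hw hc, hH'⟩
    · obtain ⟨H, hH, hH'⟩ := (hhol w).exists_numerator
        (fun hc => hw ((hD0 w).2 (hp w hc))) (holAt_of_differentiable hDd w) hw
      exact ⟨H, hH, Or.inr hw, fun _ => hH'.self_of_nhds, hH'.filter_mono nhdsWithin_le_nhds⟩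
  choose H hH hHD hHg hHe using hloc
  have hDne : ∀ w, ∀ᶠ z in 𝓝[≠] w, D z ≠ 0 := by
    intro w
    -- If `D` vanished at `κ/2`, then `κ/2` or `-κ/2` would be a lattice vector, and hence `κ` as
    -- well.
    obtain ⟨z₁, hz₁⟩ : ∃ z, D z ≠ 0 := by
      by_contra! hcon
      have a1 : (1 / 2 : ℂ) * (κ) ∈ (tauPeriods τ).lattice ∨ (1 / 2 : ℂ) * κ - κ ∈ (tauPeriods τ).lattice :=
        (hD0 _).1 (hcon _)
      apply hκ
      rcases a1 with a | a
      · have := add_mem a a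
        ring_nf at this
        exact this
      · have := neg_mem (add_mem a a)
        ring_nf at this
        exact this
    have han : AnalyticAt ℂ D w := hDd.analyticAt w
    rcases han.eventually_eq_zero_or_eventually_ne_zero with hz | hz
    · exact absurd (congrFun (AnalyticOnNhd.eq_of_eventuallyEq (fun w _ => hDd.analyticAt w)
        (fun w _ => (analyticAt_const : AnalyticAt ℂ (fun _ => (0:ℂ)) w)) hz) z₁) hz₁
    · exact hz
  obtain ⟨F, hF, hF'⟩ := exists_differentiable_of_local (φ := fun z => H z z) (fun w => ⟨H w, hH w, by
    have h2 : ∀ᶠ z in 𝓝[≠] w, g z = sphereDiv (H w z) (D z) := hHe w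
    filter_upwards [h2, hDne w] with z a b
    exact sphereDiv_inj b ((hHg z b).symm.trans a)⟩)
  have hFH : ∀ w, F w = H w w := by
    intro w
    refine (hF' w (H w) (hH w) ?_).self_of_nhds
    filter_upwards [hHe w, hDne w] with z a b
    exact sphereDiv_inj b ((hHg z b).symm.trans a)
  refine ⟨F, hF, fun z => by rw [hFH]; exact hHD z, fun z => ?_⟩
  change g z = sphereDiv (F z) (D z)
  by_cases hz : D z = 0
  · rw [hz, sphereDiv_zero]
    rcases (hD0 z).1 hz with hz | hz
    · have := hper 0 z hz
      rw [zero_add] at this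
      rw [this, h0.1]
    · have := hper κ _ hz
      rw [add_sub_cancel] at this
      rw [this, h1.1]
  · rw [hFH, hHg z hz]

/-- The numerator `F` of `g` is a theta function of order `n + 1` with the multipliers of the
denominator. Factoring it and comparing multipliers gives Abel's condition modulo the lattice, which
a lattice shift of one zero makes exact. -/
theorem exists_superpotential_of_poles {n : ℕ} (hn : 1 ≤ n) {τ : ℍ} {g : ℂ → OnePoint ℂ} {κ : ℂ}
    (hhol : ∀ z, SphereHolAt g z) (hper : ∀ z, ∀ ω ∈ (tauPeriods τ).lattice, g (z + ω) = g z)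
    (hκ : κ ∉ (tauPeriods τ).lattice) (h0 : HasPoleOfOrder g n 0) (h1 : HasPoleOfOrder g 1 κ)
    (hp : ∀ z, g z = OnePoint.infty → z ∈ (tauPeriods τ).lattice ∨ z - κ ∈ (tauPeriods τ).lattice) :
    ∃ q ∈ regularLocus n, q.2.2 = τ ∧ ∀ z, g z = superpotential q z := by
  obtain ⟨F, hF, hFD, hg⟩ := exists_entire_numerator hn hhol hper hκ h0 h1 hp
  set D : ℂ → ℂ := fun z => theta1 z τ ^ n * theta1 (z - κ) τ with hDdef
  have hθκ : Differentiable ℂ fun z => theta1 (z - κ) τ :=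
    (differentiable_theta1 _).comp (by fun_prop : Differentiable ℂ fun z => z - κ)
  have hDd : Differentiable ℂ D := ((differentiable_theta1 τ).pow n).mul hθκ
  have hF0 : F 0 ≠ 0 := by
    refine (hFD 0).resolve_right (not_not.2 ?_)
    rw [theta1_zero, zero_pow (by omega), zero_mul]
  obtain ⟨z₁, hz₁⟩ : ∃ z, D z ≠ 0 := by
    refine ⟨κ / 2, mul_ne_zero (pow_ne_zero _ ?_) ?_⟩ <;> rw [Ne, theta1_eq_zero_iff] <;> intro a <;>
      apply hκ
    · have := add_mem a a
      ring_nf at this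
      exact this
    · have := neg_mem (add_mem a a)
      ring_nf at this
      exact this
  have hcross : ∀ z, ∀ ω ∈ (tauPeriods τ).lattice, F (z + ω) * D z = F z * D (z + ω) := by
    intro z ω hω
    have := hper z ω hω
    rw [hg, hg z] at this
    exact (sphereDiv_eq_iff (hFD _) (hFD _)).1 this
  have hDτ : ∀ (m k : ℤ) z, D (z + (m + k * (τ : ℂ))) =
      thetaFactor τ m k z ^ n * thetaFactor τ m k (z - κ) * D z := by
    intro m k z
    simp only [hDdef, add_sub_right_comm, theta1_add_lattice]
    ring
  -- Since `F/D` is periodic, `F` inherits the multipliers of `D`; the factor `D` is cancelled by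
  -- the identity theorem.
  have hFτ : ∀ (m k : ℤ) z, F (z + (m + k * (τ : ℂ))) =
      thetaFactor τ m k z ^ n * thetaFactor τ m k (z - κ) * F z := by
    intro m k z
    have hfac : Differentiable ℂ (thetaFactor τ m k) := by unfold thetaFactor; fun_prop
    refine eq_of_mul_eq_mul (f := fun z => F (z + (m + k * (τ : ℂ))))
      (g := fun z => thetaFactor τ m k z ^ n * thetaFactor τ m k (z - κ) * F z)
      (hF.comp (by fun_prop : Differentiable ℂ fun z : ℂ => z + (m + k * (τ : ℂ))))
      (((hfac.pow n).mul (hfac.comp (by fun_prop : Differentiable ℂ fun z => z - κ))).mul hF)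
      hDd hz₁ (fun z => ?_) z
    have := hcross z _ (mem_tauLattice.2 ⟨m, k, rfl⟩)
    rw [hDτ] at this
    linear_combination this
  obtain ⟨C, ρ, x, hC, hFx⟩ := exists_theta_factorization τ (n + 1) F
    ((-1) ^ (n + 1))
    (Complex.exp ((n + 1) * (Real.pi * Complex.I - Real.pi * Complex.I * τ) + 2 * Real.pi * Complex.I * κ))
    hF ⟨0, hF0⟩ (fun z => by
      have := hFτ 1 0 z
      simp only [Int.cast_one, Int.cast_zero, zero_mul, add_zero] at this
      rw [this]
      simp [thetaFactor, Complex.exp_pi_mul_I]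
      ring) (fun z => by
      have := hFτ 0 1 z
      simp only [Int.cast_one, Int.cast_zero, one_mul, zero_add] at this
      rw [this]
      congr 1
      simp only [thetaFactor, ← Complex.exp_nat_mul, ← Complex.exp_add]
      congr 1
      push_cast
      ring)
  -- compare the factors of automorphy
  have hprod : ∀ (m k : ℤ) z, ∏ i, theta1 (z + (m + k * (τ : ℂ)) - x i) τ =
      thetaFactor τ m k z ^ (n + 1) * Complex.exp (2 * Real.pi * Complex.I * k * ∑ i, x i) *
        ∏ i, theta1 (z - x i) τ := by
    intro m k z
    simp only [add_sub_right_comm, theta1_add_lattice, thetaFactor_sub, Finset.prod_mul_distrib,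
      Finset.prod_const, Finset.card_univ, Fintype.card_fin, Finset.mul_sum, Complex.exp_sum]
  -- Evaluation at `0`, where `F` does not vanish. The shift by `1` gives `ρ ∈ 2πiℤ`; the shift by
  -- `τ` gives `∑ xᵢ ≡ κ`.
  have hfac : ∀ m k : ℤ, Complex.exp (ρ * (m + k * (τ : ℂ))) *
      Complex.exp (2 * Real.pi * Complex.I * k * ∑ i, x i) =
      Complex.exp (2 * Real.pi * Complex.I * k * κ) := by
    intro m k
    have h2 := hFτ m k 0
    have h3 := hFx (0 + (m + k * (τ : ℂ)))
    rw [hprod, h2, thetaFactor_sub] at h3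
    have h4 := hFx 0
    rw [mul_zero, Complex.exp_zero, mul_one] at h4
    have hne : thetaFactor τ m k 0 ^ (n + 1) * F 0 ≠ 0 :=
      mul_ne_zero (pow_ne_zero _ (thetaFactor_ne_zero _ _ _ _)) hF0
    apply mul_left_cancel₀ hne
    rw [zero_add] at h3
    calc thetaFactor τ m k 0 ^ (n + 1) * F 0 * (Complex.exp (ρ * (m + k * (τ : ℂ))) *
          Complex.exp (2 * Real.pi * Complex.I * k * ∑ i, x i))
        = C * Complex.exp (ρ * (m + k * (τ : ℂ))) * (thetaFactor τ m k 0 ^ (n + 1) *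
          Complex.exp (2 * Real.pi * Complex.I * k * ∑ i, x i) * ∏ i, theta1 (0 - x i) τ) := by
          rw [h4]; ring
      _ = _ := by rw [← h3]; ring
  obtain ⟨m, hm⟩ : ∃ m : ℤ, ρ = m * (2 * Real.pi * Complex.I) := by
    have := hfac 1 0
    simp only [Int.cast_one, Int.cast_zero, zero_mul, mul_zero, add_zero, mul_one, Complex.exp_zero] at this
    exact Complex.exp_eq_one_iff.1 this
  obtain ⟨l, hl⟩ : ∃ l : ℤ, ρ * τ + 2 * Real.pi * Complex.I * (∑ i, x i) = 2 * Real.pi * Complex.I * κ + l * (2 * Real.pi * Complex.I) := by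
    have := hfac 0 1
    simp only [Int.cast_one, Int.cast_zero, one_mul, zero_add, mul_one, ← Complex.exp_add] at this
    exact Complex.exp_eq_exp_iff_exists_int.1 this
  have hpi : (2 * Real.pi * Complex.I : ℂ) ≠ 0 := Complex.two_pi_I_ne_zero
  have hsum : ∑ i, x i = κ + (l - m * (τ : ℂ)) := by
    apply mul_left_cancel₀ hpi
    rw [hm] at hl
    linear_combination hl
  -- The lattice defect of the sum is moved into the first zero; the resulting factor of automorphy
  -- has exactly the exponential `e^{ρz}` to be removed.
  set y : Fin (n + 1) → ℂ := fun i => if i = 0 then x 0 - (l - m * (τ : ℂ)) else x i with hy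
  have hysum : ∑ i, y i = κ := by
    rw [Fin.sum_univ_succ] at hsum ⊢
    simp only [hy, Fin.succ_ne_zero, if_true, if_false]
    linear_combination hsum
  obtain ⟨C', hC', hFy⟩ : ∃ C', C' ≠ 0 ∧ ∀ z, F z = C' * ∏ i, theta1 (z - y i) τ := by
    refine ⟨C * (Complex.exp (Real.pi * Complex.I * (l - m) - Real.pi * Complex.I * m ^ 2 * τ +
      2 * Real.pi * Complex.I * m * (-x 0)))⁻¹, mul_ne_zero hC (inv_ne_zero (Complex.exp_ne_zero _)), fun z => ?_⟩
    rw [hFx, Fin.prod_univ_succ, Fin.prod_univ_succ (fun i => theta1 (z - y i) τ)]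
    simp only [hy, Fin.succ_ne_zero, if_true, if_false]
    have e1 : z - (x 0 - (l - m * (τ : ℂ))) = (z - x 0) + ((l : ℤ) + ((-m : ℤ) : ℂ) * (τ : ℂ)) := by
      push_cast; ring
    rw [e1, theta1_add_lattice]
    have e2 : thetaFactor τ l (-m) (z - x 0) = Complex.exp (Real.pi * Complex.I * (l - m) -
        Real.pi * Complex.I * m ^ 2 * τ + 2 * Real.pi * Complex.I * m * (-x 0)) * Complex.exp (ρ * z) := by
      rw [thetaFactor, ← Complex.exp_add, hm]
      congr 1
      push_cast
      ring
    rw [e2]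
    field_simp [Complex.exp_ne_zero]
  obtain ⟨s, hs⟩ : ∃ s, Complex.exp s = C' := ⟨Complex.log C', Complex.exp_log hC'⟩
  -- The coordinate `u` is a logarithm of the remaining constant, since `e^{-2πiu} = C'`.
  set q : Omega n := (-s / (2 * Real.pi * Complex.I), ofZeros y, τ) with hq
  have hqpole : poleV q.2.1 = κ := by rw [hq, poleV_ofZeros, hysum]
  have hqz : zerosV q.2.1 = y := zerosV_ofZeros y
  have hqN : ∀ z, superNum q z = F z := by
    intro z
    rw [superNum_eq, hqz, hFy, ← hs]
    congr 2
    simp only [hq]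
    field_simp
  have hqD : ∀ z, superDen q z = D z := by
    intro z
    rw [superDen_eq, hqpole]
  refine ⟨q, ?_, rfl, fun z => ?_⟩
  · rw [mem_regularLocus, hqpole, hqz]
    refine ⟨hκ, fun i => ?_⟩
    have hFi : F (y i) = 0 := by
      rw [hFy, Finset.prod_eq_zero (Finset.mem_univ i), mul_zero]
      rw [sub_self, theta1_zero]
    have hDi := (hFD (y i)).resolve_left (not_not.2 hFi)
    rw [mul_ne_zero_iff, pow_ne_zero_iff (by omega), Ne, Ne, theta1_eq_zero_iff, theta1_eq_zero_iff] at hDi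
    exact hDi
  · rw [superpotential_eq, hqN, hqD, hg]

/-- Every elliptic function with the prescribed poles is a superpotential, after an affine change
of the coordinate. -/
theorem exists_superpotential_eq {n : ℕ} (hn : 1 ≤ n) {P : PeriodPair} {f : ℂ → OnePoint ℂ} {a b : ℂ}
    (hhol : ∀ z, SphereHolAt f z) (hper : ∀ z, ∀ ω ∈ P.lattice, f (z + ω) = f z)
    (hab : a - b ∉ P.lattice) (ha : HasPoleOfOrder f n a) (hb : HasPoleOfOrder f 1 b)
    (hp : ∀ z, f z = OnePoint.infty → z - a ∈ P.lattice ∨ z - b ∈ P.lattice)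
    {τ : ℍ} {α : ℂ} (hα : α ≠ 0) (hΛ : ∀ z, z ∈ (tauPeriods τ).lattice ↔ α * z ∈ P.lattice) :
    ∃ q ∈ regularLocus n, q.2.2 = τ ∧ ∀ z, f (α * z + a) = superpotential q z := by
  have hκ : α * ((b - a) / α) + a = b := by field_simp; ring
  have hd : Differentiable ℂ fun z : ℂ => α * z + a := by fun_prop
  refine exists_superpotential_of_poles hn (g := fun z => f (α * z + a)) (κ := (b - a) / α)
    (fun z => SphereHolAt.comp' (g := fun z => α * z + a) (hhol _) (holAt_of_differentiable hd z))
    (fun z ω hω => ?_) ?_ (HasPoleOfOrder.comp_affine hα (by simpa using ha))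
    (HasPoleOfOrder.comp_affine hα (by rwa [hκ])) (fun z hz => ?_)
  · rw [← hper (α * z + a) (α * ω) ((hΛ ω).1 hω)]
    congr 1; ring
  · rw [hΛ, mul_div_cancel₀ _ hα, ← neg_mem_iff, neg_sub]
    exact hab
  · rw [hΛ, hΛ]
    have e2 : α * (z - (b - a) / α) = α * z + a - b := by field_simp; ring
    rw [e2]
    have := hp _ hz
    rwa [add_sub_cancel_right] at this

lemma exists_tau_of_pair {ω₁ ω₂ : ℂ} (h1 : ω₁ ≠ 0) (him : 0 < (ω₂ / ω₁).im) :
    ∃ τ : ℍ, ∀ z, z ∈ (tauPeriods τ).lattice ↔ ∃ m k : ℤ, ω₁ * z = m * ω₁ + k * ω₂ := by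
  refine ⟨⟨ω₂ / ω₁, him⟩, fun z => ?_⟩
  rw [mem_tauLattice]
  refine exists_congr fun m => exists_congr fun k => ?_
  change z = m + k * (ω₂ / ω₁) ↔ _
  rw [← mul_right_inj' h1]
  have : ω₁ * (m + k * (ω₂ / ω₁)) = m * ω₁ + k * ω₂ := by field_simp
  rw [this]

/-- Every lattice is homothetic to one of the form `ℤ + ℤ τ`. -/
lemma exists_tau (P : PeriodPair) : ∃ (τ : ℍ) (α : ℂ), α ≠ 0 ∧
    ∀ z, z ∈ (tauPeriods τ).lattice ↔ α * z ∈ P.lattice := by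
  have h1 : P.ω₁ ≠ 0 := P.indep.ne_zero 0
  have h2 : P.ω₂ ≠ 0 := P.indep.ne_zero 1
  have him : (P.ω₂ / P.ω₁).im ≠ 0 := by
    intro him
    have hreal : ((P.ω₂ / P.ω₁).re : ℂ) = P.ω₂ / P.ω₁ := by
      apply Complex.ext <;> simp [him]
    have := LinearIndependent.pair_iff.1 P.indep ((P.ω₂ / P.ω₁).re) (-1) (by
      rw [Complex.real_smul, hreal]
      simp [div_mul_cancel₀ _ h1])
    simpa using this.2
  rcases lt_or_gt_of_ne him with him | him
  · have him' : 0 < (P.ω₁ / P.ω₂).im := by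
      rw [← inv_div, Complex.inv_im]
      exact div_pos (by linarith) (Complex.normSq_pos.2 (div_ne_zero h2 h1))
    obtain ⟨τ, hτ⟩ := exists_tau_of_pair h2 him'
    refine ⟨τ, P.ω₂, h2, fun z => ?_⟩
    rw [hτ, PeriodPair.mem_lattice]
    exact ⟨fun ⟨m, k, h⟩ => ⟨k, m, by rw [h]; ring⟩, fun ⟨m, k, h⟩ => ⟨k, m, by rw [← h]; ring⟩⟩
  · obtain ⟨τ, hτ⟩ := exists_tau_of_pair h1 him
    refine ⟨τ, P.ω₁, h1, fun z => ?_⟩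
    rw [hτ, PeriodPair.mem_lattice]
    exact ⟨fun ⟨m, k, h⟩ => ⟨m, k, h.symm⟩, fun ⟨m, k, h⟩ => ⟨m, k, h.symm⟩⟩

end

section

/-! ### Holomorphic maps between complex tori are affine -/

/-- A lattice is discrete, so a continuous function with values in it is locally constant. -/
lemma eventually_eq_of_mem_lattice (P : PeriodPair) {X : Type*} [TopologicalSpace X] {f : X → ℂ} {x : X}
    (hf : ContinuousAt f x) (h : ∀ᶠ y in 𝓝 x, f y ∈ P.lattice) : ∀ᶠ y in 𝓝 x, f y = f x := by
  filter_upwards [hf.eventually (P.compl_lattice_sdiff_singleton_mem_nhds (f x)), h] with y h1 h2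
  by_contra h3
  exact h1 ⟨h2, h3⟩

lemma exists_eq_const_of_lattice_periodic (P : PeriodPair) {f : ℂ → ℂ} (hf : Differentiable ℂ f)
    (h : ∀ z, ∀ ω ∈ P.lattice, f (z + ω) = f z) : ∃ C, ∀ z, f z = C := by
  obtain ⟨τ, α, hα, hΛ⟩ := exists_tau P
  have h1 : (1 : ℂ) ∈ (tauPeriods τ).lattice := mem_tauLattice.2 ⟨1, 0, by simp⟩
  have h2 : (τ : ℂ) ∈ (tauPeriods τ).lattice := mem_tauLattice.2 ⟨0, 1, by simp⟩
  obtain ⟨C, hC⟩ := exists_eq_const_of_periodic (τ := τ) (f := fun z => f (α * z))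
    (hf.comp (by fun_prop : Differentiable ℂ fun z => α * z))
    (fun z => by simp only [mul_add]; exact h _ _ ((hΛ 1).1 h1))
    (fun z => by simp only [mul_add]; exact h _ _ ((hΛ τ).1 h2))
  refine ⟨C, fun z => ?_⟩
  have := hC (z / α)
  simpa only [mul_div_cancel₀ _ hα] using this

lemma mkQ_eq_iff {P : PeriodPair} {z w : ℂ} : P.lattice.mkQ z = P.lattice.mkQ w ↔ z - w ∈ P.lattice :=
  Submodule.Quotient.eq P.lattice

/-- Holomorphic local lifts with congruent values have the same derivative. -/
lemma eventually_deriv_eq {Q : PeriodPair} {G H : ℂ → ℂ} {w : ℂ} (hG : HolAt G w) (hH : HolAt H w)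
    (h : ∀ᶠ z in 𝓝 w, Q.lattice.mkQ (G z) = Q.lattice.mkQ (H z)) : deriv G w = deriv H w := by
  have h1 := eventually_eq_of_mem_lattice Q (f := fun z => G z - H z) (hG.sub hH).continuousAt
    (h.mono fun z hz => mkQ_eq_iff.1 hz)
  have h2 : deriv (fun z => G z - H z) w = 0 := by
    have : (fun z => G z - H z) =ᶠ[𝓝 w] fun _ => G w - H w := h1
    rw [this.deriv_eq]; simp
  rw [deriv_fun_sub hG.differentiableAt hH.differentiableAt] at h2
  exact sub_eq_zero.1 h2

/-- Two local lifts differ by lattice vectors, so their derivatives glue to an entire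
lattice-periodic function, a constant `α`. Then `F(z) - αz` is locally constant on the connected
plane. -/
lemma TorusHol.exists_affine {P Q : PeriodPair} {F : ℂ ⧸ P.lattice → ℂ ⧸ Q.lattice} (hF : TorusHol F) :
    ∃ α β : ℂ, ∀ z, F (P.lattice.mkQ z) = Q.lattice.mkQ (α * z + β) := by
  choose G hG hG' using hF
  have hloc : ∀ w, ∀ᶠ z in 𝓝 w, deriv (G z) z = deriv (G w) z := by
    intro w
    filter_upwards [(hG w).eventually, eventually_eventually_nhds.2 (hG' w)] with z h1 h2
    refine eventually_deriv_eq (Q := Q) (hG z) h1 ?_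
    filter_upwards [h2, hG' z] with y h3 h4
    rw [← h3, ← h4]
  have hD : Differentiable ℂ fun z => deriv (G z) z := by
    intro w
    have : DifferentiableAt ℂ (deriv (G w)) w := (holAt_iff_analyticAt.1 (hG w)).deriv.differentiableAt
    exact this.congr_of_eventuallyEq (hloc w)
  obtain ⟨α, hα⟩ := exists_eq_const_of_lattice_periodic P hD (fun z ω hω => by
    have hd : Differentiable ℂ fun y : ℂ => y + ω := by fun_prop
    have h1 : HolAt (fun y => G (z + ω) (y + ω)) z :=
      HolAt.comp' (f := fun y => y + ω) (hG (z + ω)) (holAt_of_differentiable hd z)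
    have h2 := eventually_deriv_eq (Q := Q) h1 (hG z) (by
      have h3 : ∀ᶠ y in 𝓝 z, F (P.lattice.mkQ (y + ω)) = Q.lattice.mkQ (G (z + ω) (y + ω)) :=
        (hd.continuous.continuousAt (x := z)).eventually (hG' (z + ω))
      filter_upwards [h3, hG' z] with y h4 h5
      rw [← h4, ← h5]
      congr 1
      rw [mkQ_eq_iff]
      simpa using hω)
    rw [← h2]
    exact (deriv_comp_add_const (G (z + ω)) ω z).symm)
  have hlc : IsLocallyConstant fun z => F (P.lattice.mkQ z) - Q.lattice.mkQ (α * z) := by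
    rw [IsLocallyConstant.iff_eventually_eq]
    intro w
    have h1 : ∀ᶠ z in 𝓝 w, G w z - α * z = G w w - α * w := by
      obtain ⟨r, hr, hb⟩ := Metric.eventually_nhds_iff_ball.1 ((hG w).and (hloc w))
      filter_upwards [Metric.ball_mem_nhds w hr] with z hz
      refine Metric.isOpen_ball.is_const_of_deriv_eq_zero (𝕜 := ℂ) (convex_ball w r).isPreconnected
        (f := fun z => G w z - α * z) ?_ ?_ hz (Metric.mem_ball_self hr)
      · intro y hy
        exact ((hb y hy).1.sub (by fun_prop)).differentiableWithinAt
      · intro y hy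
        have h2 := (hb y hy).2
        rw [hα] at h2
        rw [deriv_fun_sub (hb y hy).1 (by fun_prop), ← h2]
        simp
    filter_upwards [h1, hG' w] with z h2 h3
    rw [h3, (hG' w).self_of_nhds, ← map_sub, ← map_sub, h2]
  obtain ⟨β, hβ⟩ := Submodule.mkQ_surjective _ (F (P.lattice.mkQ 0))
  refine ⟨α, β, fun z => ?_⟩
  have := hlc.apply_eq_of_preconnectedSpace z 0
  simp only [mul_zero, map_zero, sub_zero] at this
  rw [sub_eq_iff_eq_add] at this
  rw [map_add, hβ, map_zero, this, add_comm]

/-! ### Hurwitz equivalence through affine maps -/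

lemma IsHurwitzFunction.exists_notMem {n : ℕ} {P : PeriodPair} {f : ℂ → OnePoint ℂ}
    (h : IsHurwitzFunction n P f) : ∃ z, z ∉ P.lattice :=
  let ⟨a, b, hab, _⟩ := h.poles
  ⟨a - b, hab⟩

/-- Isomorphisms of complex tori lift to affine maps. Injectivity shows that `α` carries one lattice
exactly onto the other, and `α ≠ 0` because a lattice is not all of `ℂ`. -/
theorem hurwitzEquivalent_iff {n : ℕ} {A B : HurwitzPair n} : HurwitzEquivalent A B ↔
    ∃ α β : ℂ, α ≠ 0 ∧ (∀ z, z ∈ A.periods.lattice ↔ α * z ∈ B.periods.lattice) ∧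
      ∀ z, B.fn (α * z + β) = A.fn z := by
  constructor
  · rintro ⟨F, hF, -, hfn⟩
    obtain ⟨α, β, hαβ⟩ := hF.exists_affine
    have hmem : ∀ z, z ∈ A.periods.lattice ↔ α * z ∈ B.periods.lattice := by
      intro z
      have h1 : A.periods.lattice.mkQ z = A.periods.lattice.mkQ 0 ↔
          F (A.periods.lattice.mkQ z) = F (A.periods.lattice.mkQ 0) := F.injective.eq_iff.symm
      rw [hαβ, hαβ, mkQ_eq_iff, mkQ_eq_iff] at h1
      simpa using h1
    refine ⟨α, β, ?_, hmem, fun z => hfn z _ (hαβ z)⟩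
    rintro rfl
    obtain ⟨z, hz⟩ := A.isHurwitz.exists_notMem
    exact hz ((hmem z).2 (by simp))
  · rintro ⟨α, β, hα, hmem, hfn⟩
    have hmap : A.periods.lattice ≤ B.periods.lattice.comap ((LinearMap.mulLeft ℤ α) : ℂ →ₗ[ℤ] ℂ) :=
      fun z hz => (hmem z).1 hz
    have hmap' : B.periods.lattice ≤ A.periods.lattice.comap ((LinearMap.mulLeft ℤ α⁻¹) : ℂ →ₗ[ℤ] ℂ) := by
      intro z hz
      change α⁻¹ * z ∈ A.periods.lattice
      rw [hmem, mul_inv_cancel_left₀ hα]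
      exact hz
    set F : (ℂ ⧸ A.periods.lattice) → (ℂ ⧸ B.periods.lattice) := fun x =>
      Submodule.mapQ _ _ _ hmap x + B.periods.lattice.mkQ β with hFdef
    set F' : (ℂ ⧸ B.periods.lattice) → (ℂ ⧸ A.periods.lattice) := fun x =>
      Submodule.mapQ _ _ _ hmap' (x - B.periods.lattice.mkQ β) with hF'def
    have e1 : ∀ z, F (A.periods.lattice.mkQ z) = B.periods.lattice.mkQ (α * z + β) := by
      intro z
      simp only [hFdef]
      rw [map_add]
      rfl
    have e2 : ∀ z, F' (B.periods.lattice.mkQ z) = A.periods.lattice.mkQ (α⁻¹ * z - α⁻¹ * β) := by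
      intro z
      simp only [hF'def]
      rw [← map_sub, ← mul_sub]
      rfl
    refine ⟨⟨F, F', ?_, ?_⟩, ?_, ?_, ?_⟩
    · intro x
      obtain ⟨z, rfl⟩ := Submodule.mkQ_surjective _ x
      rw [e1, e2]
      congr 1
      field_simp
      ring
    · intro x
      obtain ⟨z, rfl⟩ := Submodule.mkQ_surjective _ x
      rw [e2, e1]
      congr 1
      field_simp
      ring
    · exact fun z => ⟨fun w => α * w + β, holAt_of_differentiable (by fun_prop) z,
        Eventually.of_forall e1⟩
    · exact fun z => ⟨fun w => α⁻¹ * w - α⁻¹ * β, holAt_of_differentiable (by fun_prop) z,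
        Eventually.of_forall e2⟩
    · intro z w h
      have h' : B.periods.lattice.mkQ (α * z + β) = B.periods.lattice.mkQ w := (e1 z).symm.trans h
      rw [← hfn z]
      have := B.isHurwitz.periodic w _ (mkQ_eq_iff.1 h')
      rw [add_sub_cancel] at this
      exact this.symm

lemma HurwitzSpace.mk_eq_iff {n : ℕ} {A B : HurwitzPair n} :
    HurwitzSpace.mk A = HurwitzSpace.mk B ↔ HurwitzEquivalent A B :=
  Quotient.eq (r := hurwitzSetoid n)

/-! ### The pair attached to a regular point -/

/-- The pair `(ℂ / (ℤ + τ ℤ), λ)` of a regular point. -/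
def superPair {n : ℕ} (hn : 1 ≤ n) {p : Omega n} (hp : p ∈ regularLocus n) : HurwitzPair n :=
  ⟨tauPeriods p.2.2, superpotential p, isHurwitzFunction_superpotential hn hp⟩

variable {n : ℕ}

lemma hurwitzEquivalent_of_superEquiv (hn : 1 ≤ n) {p q : Omega n} (hp : p ∈ regularLocus n)
    (hq : q ∈ regularLocus n) (h : SuperEquiv p q) :
    HurwitzEquivalent (superPair hn hp) (superPair hn hq) := by
  obtain ⟨α, h0, h1, h2⟩ := h.2 hp
  exact hurwitzEquivalent_iff.2 ⟨α, 0, h0, h1, fun z => by rw [add_zero]; exact h2 z⟩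

/-- Every pair is equivalent to that of a regular point. -/
theorem exists_hurwitzEquivalent_superPair (hn : 1 ≤ n) (A : HurwitzPair n) :
    ∃ (p : Omega n) (hp : p ∈ regularLocus n), HurwitzEquivalent (superPair hn hp) A := by
  obtain ⟨τ, α, hα, hΛ⟩ := exists_tau A.periods
  obtain ⟨a, b, hab, ha, hb, hpol⟩ := A.isHurwitz.poles
  obtain ⟨q, hq, rfl, hf⟩ := exists_superpotential_eq hn A.isHurwitz.hol A.isHurwitz.periodic hab ha hb
    hpol hα hΛ
  exact ⟨q, hq, hurwitzEquivalent_iff.2 ⟨α, a, hα, hΛ, hf⟩⟩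

/-! ### Orders of poles -/

lemma HasPoleOfOrder.unique {f : ℂ → OnePoint ℂ} {m k : ℕ} {w : ℂ} (h : HasPoleOfOrder f m w)
    (h' : HasPoleOfOrder f k w) : m = k := by
  have key : ∀ {m k : ℕ}, HasPoleOfOrder f m w → HasPoleOfOrder f k w → ¬ m < k := by
    rintro m k ⟨-, g, hg, hg0, hf⟩ ⟨-, g', hg', hg0', hf'⟩ hmk
    have h1 : Tendsto (fun z => g z * (z - w) ^ (k - m)) (𝓝[≠] w) (𝓝 (g w * (w - w) ^ (k - m))) := by
      refine Tendsto.mono_left ?_ nhdsWithin_le_nhds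
      exact hg.continuousAt.mul (Continuous.continuousAt (by fun_prop))
    have h2 : Tendsto g' (𝓝[≠] w) (𝓝 (g' w)) := hg'.continuousAt.tendsto.mono_left nhdsWithin_le_nhds
    have h3 : g' w = g w * (w - w) ^ (k - m) := by
      refine tendsto_nhds_unique h2 (h1.congr' ?_)
      filter_upwards [hf, hf', self_mem_nhdsWithin] with z a b c
      have c' : z - w ≠ 0 := sub_ne_zero.2 c
      rw [a, OnePoint.coe_eq_coe, div_eq_div_iff (pow_ne_zero _ c') (pow_ne_zero _ c')] at b
      have e : (z - w) ^ k = (z - w) ^ (k - m) * (z - w) ^ m := by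
        rw [← pow_add]; congr 1; omega
      rw [e] at b
      apply mul_right_cancel₀ (pow_ne_zero m c')
      linear_combination b
    rw [sub_self, zero_pow (by omega), mul_zero] at h3
    exact hg0' h3
  rcases lt_trichotomy m k with h1 | h1 | h1
  · exact absurd h1 (key h h')
  · exact h1
  · exact absurd h1 (key h' h)

/-- Scaling about a simple pole divides its residue by `α`. This excludes nontrivial homotheties
preserving both the function and the pole. -/
lemma HasPoleOfOrder.eq_one_of_comp {f : ℂ → OnePoint ℂ} {w α : ℂ} (hα : α ≠ 0)
    (h : HasPoleOfOrder f 1 w) (hf : ∀ z, f (α * (z - w) + w) = f z) : α = 1 := by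
  obtain ⟨-, g, hg, hg0, hfg⟩ := h
  have ht : Tendsto (fun z => α * (z - w) + w) (𝓝[≠] w) (𝓝[≠] w) := by
    have := tendsto_affine_punctured hα (w - α * w) w
    have e : α * w + (w - α * w) = w := by ring
    rw [e] at this
    refine this.congr fun z => by ring
  have h1 : Tendsto (fun z => g (α * (z - w) + w)) (𝓝[≠] w) (𝓝 (g w)) :=
    (hg.continuousAt.tendsto.mono_left nhdsWithin_le_nhds).comp ht
  have h2 : Tendsto (fun z => α * g z) (𝓝[≠] w) (𝓝 (α * g w)) :=
    (hg.continuousAt.tendsto.mono_left nhdsWithin_le_nhds).const_mul α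
  have h3 : g w = α * g w := by
    refine tendsto_nhds_unique h1 (h2.congr' ?_)
    filter_upwards [hfg, ht.eventually hfg, self_mem_nhdsWithin] with z a b c
    have c' : z - w ≠ 0 := sub_ne_zero.2 c
    rw [hf, a, OnePoint.coe_eq_coe, pow_one, pow_one, add_sub_cancel_right,
      div_eq_div_iff c' (mul_ne_zero hα c')] at b
    apply mul_right_cancel₀ c'
    linear_combination b
  exact (mul_right_cancel₀ hg0 (by rw [one_mul, ← h3])).symm

end

section

/-! ### Continuity in the parameters -/

lemma continuous_theta1 : Continuous fun x : ℂ × ℍ => theta1 x.1 x.2 := by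
  rw [continuous_iff_continuousAt]
  rintro ⟨z, τ⟩
  exact ContinuousAt.comp (g := fun p : ℂ × ℂ => theta1 p.1 p.2) (f := fun x : ℂ × ℍ => (x.1, (x.2 : ℂ)))
    (differentiableAt_theta1 z τ.im_pos).continuousAt
    (by fun_prop)

variable {n : ℕ}

lemma continuous_zerosV (i : Fin (n + 1)) : Continuous fun v : V n => zerosV v i :=
  ((continuous_apply i).comp (continuous_subtype_val.comp continuous_fst)).sub continuous_snd

lemma continuous_poleV : Continuous fun v : V n => poleV v := by
  unfold poleV
  fun_prop

lemma continuous_superNum : Continuous fun x : Omega n × ℂ => superNum x.1 x.2 := by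
  simp only [superNum_eq]
  refine Continuous.mul (by fun_prop) (continuous_finsetProd _ fun i _ => ?_)
  exact continuous_theta1.comp (f := fun x : Omega n × ℂ => (x.2 - zerosV x.1.2.1 i, x.1.2.2))
    ((continuous_snd.sub ((continuous_zerosV i).comp (by fun_prop))).prodMk (by fun_prop))

lemma continuous_superDen : Continuous fun x : Omega n × ℂ => superDen x.1 x.2 := by
  simp only [superDen_eq]
  refine Continuous.mul (Continuous.pow ?_ n) ?_
  · exact continuous_theta1.comp (f := fun x : Omega n × ℂ => (x.2, x.1.2.2)) (by fun_prop)
  · exact continuous_theta1.comp (f := fun x : Omega n × ℂ => (x.2 - poleV x.1.2.1, x.1.2.2))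
      ((continuous_snd.sub (continuous_poleV.comp (by fun_prop))).prodMk (by fun_prop))

lemma isOpen_notMem_lattice {X : Type*} [TopologicalSpace X] {f : X → ℂ} {τ : X → ℍ}
    (hf : Continuous f) (hτ : Continuous τ) : IsOpen {x | f x ∉ (tauPeriods (τ x)).lattice} := by
  have : {x | f x ∉ (tauPeriods (τ x)).lattice} = {x | theta1 (f x) (τ x) ≠ 0} := by
    ext x
    simp [theta1_eq_zero_iff]
  rw [this]
  exact isOpen_ne_fun (continuous_theta1.comp (f := fun x => (f x, τ x)) (hf.prodMk hτ)) continuous_const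

lemma isOpen_regularLocus : IsOpen (regularLocus n) := by
  have : regularLocus n = {p | poleV p.2.1 ∉ (tauPeriods p.2.2).lattice} ∩
      ⋂ i, ({p | zerosV p.2.1 i ∉ (tauPeriods p.2.2).lattice} ∩
        {p | zerosV p.2.1 i - poleV p.2.1 ∉ (tauPeriods p.2.2).lattice}) := by
    ext p
    rw [mem_regularLocus]
    simp
  rw [this]
  have h1 : Continuous fun p : Omega n => poleV p.2.1 := continuous_poleV.comp (by fun_prop)
  have h2 : ∀ i, Continuous fun p : Omega n => zerosV p.2.1 i := fun i =>
    (continuous_zerosV i).comp (by fun_prop)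
  exact (isOpen_notMem_lattice h1 (by fun_prop)).inter (isOpen_iInter_of_finite fun i =>
    (isOpen_notMem_lattice (h2 i) (by fun_prop)).inter
      (isOpen_notMem_lattice ((h2 i).sub h1) (by fun_prop)))

/-! ### Lattice points in families -/

/-- For `k = 0` the vector is a nonzero integer; otherwise its imaginary part is at least `Im τ` in
absolute value. The bound stays away from zero near a given `τ`. -/
lemma min_le_norm_of_mem_lattice {τ : ℍ} {w : ℂ} (hw : w ∈ (tauPeriods τ).lattice) (h0 : w ≠ 0) :
    min 1 τ.im ≤ ‖w‖ := by
  obtain ⟨m, k, rfl⟩ := mem_tauLattice.1 hw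
  by_cases hk : k = 0
  · subst hk
    have hm : m ≠ 0 := by rintro rfl; simp at h0
    refine (min_le_left _ _).trans ?_
    simp only [Int.cast_zero, zero_mul, add_zero, Complex.norm_intCast]
    exact_mod_cast Int.one_le_abs hm
  · refine (min_le_right _ _).trans ((?_ : τ.im ≤ |k * τ.im|).trans ?_)
    · rw [abs_mul, abs_of_pos τ.im_pos]
      have : (1 : ℝ) ≤ |(k : ℝ)| := by exact_mod_cast Int.one_le_abs hk
      nlinarith [τ.im_pos]
    · have := Complex.abs_im_le_norm ((m : ℂ) + k * (τ : ℂ))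
      simpa using this

/-- Lattice points near `m + k τ₀` are of the form `m + k τ`. -/
lemma eventually_eq_of_mem_tauLattice {X : Type*} {l : Filter X} {w : X → ℂ} {τ : X → ℍ} {τ₀ : ℍ}
    (m k : ℤ) (hw : Tendsto w l (𝓝 (m + k * (τ₀ : ℂ)))) (hτ : Tendsto τ l (𝓝 τ₀)) :
    ∀ᶠ x in l, w x ∈ (tauPeriods (τ x)).lattice → w x = m + k * (τ x : ℂ) := by
  have hτ' : Tendsto (fun x => (τ x : ℂ)) l (𝓝 τ₀) :=
    (UpperHalfPlane.continuous_coe.tendsto τ₀).comp hτ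
  have him : Tendsto (fun x => (τ x).im) l (𝓝 τ₀.im) :=
    (UpperHalfPlane.continuous_im.tendsto τ₀).comp hτ
  have h1 : Tendsto (fun x => ‖w x - (m + k * (τ x : ℂ))‖) l (𝓝 0) := by
    have := (hw.sub ((hτ'.const_mul (k : ℂ)).const_add (m : ℂ))).norm
    simpa using this
  have hmin : Tendsto (fun x => min 1 (τ x).im) l (𝓝 (min 1 τ₀.im)) := tendsto_const_nhds.min him
  have hlt : (0 : ℝ) < min 1 τ₀.im := lt_min one_pos τ₀.im_pos
  filter_upwards [h1.eventually_lt hmin hlt] with x hx hmem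
  by_contra hne
  have := min_le_norm_of_mem_lattice (sub_mem hmem (mem_tauLattice.2 ⟨m, k, rfl⟩)) (sub_ne_zero.2 hne)
  linarith

/-- Membership is the closed condition `θ₁ = 0`, which is jointly continuous in `(z, τ)`. -/
lemma mem_lattice_of_tendsto {X : Type*} {l : Filter X} [l.NeBot] {w : X → ℂ} {τ : X → ℍ} {τ₀ : ℍ}
    {w₀ : ℂ} (hw : Tendsto w l (𝓝 w₀)) (hτ : Tendsto τ l (𝓝 τ₀))
    (h : ∀ᶠ x in l, w x ∈ (tauPeriods (τ x)).lattice) : w₀ ∈ (tauPeriods τ₀).lattice := by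
  rw [← theta1_eq_zero_iff]
  have h1 := (continuous_theta1.tendsto (w₀, τ₀)).comp (hw.prodMk_nhds hτ)
  refine tendsto_nhds_unique h1 (tendsto_const_nhds.congr' ?_)
  filter_upwards [h] with x hx
  exact (theta1_eq_zero_iff.2 hx).symm

/-! ### The zeros of a product of theta functions -/

lemma theta1_eq_mul_of_sub_mem {τ : ℍ} {x y : ℂ} (h : x - y ∈ (tauPeriods τ).lattice) :
    ∃ E : ℂ → ℂ, Differentiable ℂ E ∧ (∀ z, E z ≠ 0) ∧
      ∀ z, theta1 (z - y) τ = E z * theta1 (z - x) τ := by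
  obtain ⟨m, k, hmk⟩ := mem_tauLattice.1 h
  refine ⟨fun z => thetaFactor τ m k (z - x), ?_, fun z => thetaFactor_ne_zero _ _ _ _, fun z => ?_⟩
  · unfold thetaFactor; fun_prop
  · rw [← theta1_add_lattice, ← hmk]
    congr 1; ring

/-- The zero `x 0` of the left side is congruent to some `y j`; cancel this pair and induct. The
unit `E` absorbs the exponential factors that arise when congruent points are exchanged. -/
theorem exists_perm_of_prod_theta1_eq (τ : ℍ) (N : ℕ) : ∀ (E : ℂ → ℂ) (x y : Fin N → ℂ),
    Differentiable ℂ E → (∀ z, E z ≠ 0) →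
    (∀ z, E z * ∏ i, theta1 (z - x i) τ = ∏ i, theta1 (z - y i) τ) →
    ∃ σ : Equiv.Perm (Fin N), ∀ i, y (σ i) - x i ∈ (tauPeriods τ).lattice := by
  induction N with
  | zero => exact fun _ _ _ _ _ _ => ⟨1, fun i => i.elim0⟩
  | succ N ih =>
    intro E x y hE hE0 h
    obtain ⟨j, -, hj⟩ := Finset.prod_eq_zero_iff.1 (by
      rw [← h (x 0), Fin.prod_univ_succ, sub_self, theta1_zero, zero_mul, mul_zero] :
      ∏ i, theta1 (x 0 - y i) τ = 0)
    rw [theta1_eq_zero_iff] at hj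
    set y' : Fin N → ℂ := fun i => y (Equiv.swap 0 j i.succ) with hy'
    have hprod : ∀ z, ∏ i, theta1 (z - y i) τ = theta1 (z - y j) τ * ∏ i, theta1 (z - y' i) τ := by
      intro z
      rw [← Equiv.prod_comp (Equiv.swap 0 j), Fin.prod_univ_succ, Equiv.swap_apply_left]
    obtain ⟨K, hK, hK0, hKθ⟩ := theta1_eq_mul_of_sub_mem (τ := τ) (x := y j) (y := x 0)
      (by simpa using neg_mem hj)
    have hθd : ∀ a : ℂ, Differentiable ℂ fun z => theta1 (z - a) τ := fun a =>
      (differentiable_theta1 _).comp (by fun_prop : Differentiable ℂ fun z => z - a)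
    have hprodd : ∀ x : Fin N → ℂ, Differentiable ℂ fun z => ∏ i, theta1 (z - x i) τ := fun x z =>
      (HolAt.prod fun i _ => holAt_of_differentiable (hθd (x i)) z).differentiableAt
    obtain ⟨z₀, hz₀⟩ := exists_theta1_ne_zero τ
    obtain ⟨σ, hσ⟩ := ih (fun z => E z * K z) (fun i => x i.succ) y' (hE.mul hK)
      (fun z => mul_ne_zero (hE0 z) (hK0 z)) (eq_of_mul_eq_mul ((hE.mul hK).mul (hprodd _)) (hprodd _)
        (hθd (y j)) (z₀ := z₀ + y j) (by simpa using hz₀) fun z => by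
          rw [← hprod, ← h, Fin.prod_univ_succ, hKθ]
          ring)
    refine ⟨Equiv.Perm.decomposeFin.symm (j, σ), fun i => ?_⟩
    refine Fin.cases ?_ (fun i => ?_) i
    · rw [Equiv.Perm.decomposeFin_symm_apply_zero]
      simpa using neg_mem hj
    · rw [Equiv.Perm.decomposeFin_symm_apply_succ]
      exact hσ i

/-! ### Points with the same superpotential -/

lemma exp_mul_superNum (p : Omega n) (z : ℂ) : ∏ i, theta1 (z - zerosV p.2.1 i) p.2.2 =
    Complex.exp (2 * Real.pi * Complex.I * p.1) * superNum p z := by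
  rw [superNum_eq, ← mul_assoc, ← Complex.exp_add]
  simp

lemma orbitSpace_mk_eq {g : Equiv.Perm (Omega n)} (hg : g ∈ jacobiGroup n) (p : Omega n) :
    OrbitSpace.mk (g p) = OrbitSpace.mk p :=
  Quotient.sound (s := MulAction.orbitRel (jacobiGroup n) (Omega n)) ⟨⟨g, hg⟩, rfl⟩

lemma weylAct_mem (w : Equiv.Perm (Fin (n + 1))) : weylAct w ∈ jacobiGroup n :=
  Subgroup.subset_closure (Or.inl (Or.inl ⟨w, rfl⟩))

lemma translationAct_mem (l m : L n) (k : ℤ) : translationAct l m k ∈ jacobiGroup n :=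
  Subgroup.subset_closure (Or.inl (Or.inr ⟨l, m, k, rfl⟩))

lemma ofZeros_mem_L {a : Fin (n + 1) → ℤ} (h : ∑ i, a i = 0) :
    ofZeros (fun i => (a i : ℂ)) ∈ L n := by
  have h' : ∑ i, (a i : ℂ) = 0 := by exact_mod_cast congrArg (Int.cast (R := ℂ)) h
  refine ⟨fun i => ⟨a i, ?_⟩, 0, ?_⟩
  · simp [ofZeros, h']
  · simp [ofZeros, h']

/-- The zeros agree up to a permutation and lattice shifts. As the poles agree exactly, the shifts
sum to zero and come from a translation in `L` with last coordinate `0`. After both moves only `u`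
can differ, by an integer. -/
lemma orbitSpace_mk_eq_of_superpotential_eq (hn : 1 ≤ n) {p q : Omega n} (hp : p ∈ regularLocus n)
    (hq : q ∈ regularLocus n) (hτ : q.2.2 = p.2.2) (hκ : poleV q.2.1 = poleV p.2.1)
    (h : ∀ z, superpotential q z = superpotential p z) : OrbitSpace.mk q = OrbitSpace.mk p := by
  have hden : ∀ z, superDen q z = superDen p z := fun z => by rw [superDen_eq, superDen_eq, hτ, hκ]
  have hne : ∀ r : Omega n, r ∈ regularLocus n → superDen r (zerosV r.2.1 0) ≠ 0 := by
    intro r hr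
    refine (superNum_ne_zero_or hn hr _).resolve_left (not_not.2 ?_)
    rw [superNum_eq_zero_iff]
    exact ⟨0, by simp⟩
  have hnum : ∀ z, superNum q z = superNum p z :=
    eq_of_mul_eq_mul (differentiable_superNum q) (differentiable_superNum p) (differentiable_superDen p)
      (hne p hp) fun z => by
        have := (superpotential_eq_superpotential_iff hn hq hp z z).1 (h z)
        rw [hden z] at this
        linear_combination this
  obtain ⟨σ, hσ⟩ := exists_perm_of_prod_theta1_eq p.2.2 (n + 1)
    (fun _ => Complex.exp (2 * Real.pi * Complex.I * q.1) * Complex.exp (-(2 * Real.pi * Complex.I * p.1)))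
    (zerosV p.2.1) (zerosV q.2.1) (differentiable_const _)
    (fun _ => mul_ne_zero (Complex.exp_ne_zero _) (Complex.exp_ne_zero _)) (fun z => by
      have h2 := exp_mul_superNum q z
      rw [hτ, hnum] at h2
      rw [h2, mul_assoc, ← superNum_eq])
  choose b a hab using fun i => mem_tauLattice.1 (hσ i)
  have hsum : (∑ i, b i : ℤ) + (∑ i, a i : ℤ) * (p.2.2 : ℂ) = 0 := by
    have h1 : ∑ i, (zerosV q.2.1 (σ i) - zerosV p.2.1 i) = 0 := by
      rw [Finset.sum_sub_distrib, Equiv.sum_comp σ, sum_zerosV, sum_zerosV, hκ, sub_self]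
    simp only [hab, Finset.sum_add_distrib, ← Finset.sum_mul] at h1
    exact_mod_cast h1
  have hA : ∑ i, a i = 0 := by
    have := congrArg Complex.im hsum
    have h2 : (∑ i, (a i : ℝ)) = 0 := by simpa [p.2.2.im_pos.ne'] using this
    exact_mod_cast h2
  have hB : ∑ i, b i = 0 := by
    rw [hA] at hsum
    exact_mod_cast (by simpa using hsum : ((∑ i, b i : ℤ) : ℂ) = 0)
  set r : Omega n := weylAct σ (translationAct ⟨_, ofZeros_mem_L hA⟩ ⟨_, ofZeros_mem_L hB⟩ 0 p) with hr
  have hrτ : r.2.2 = p.2.2 := rfl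
  have hrp : OrbitSpace.mk r = OrbitSpace.mk p := by
    rw [hr, orbitSpace_mk_eq (weylAct_mem _), orbitSpace_mk_eq (translationAct_mem _ _ _)]
  have hrz : r.2.1 = q.2.1 := by
    apply eq_of_zerosV_eq
    ext i
    change zerosV (p.2.1 + (p.2.2 : ℂ) • ofZeros (fun i => (a i : ℂ)) + ofZeros (fun i => (b i : ℂ))) (σ.symm i) = _
    rw [zerosV_add_smul_add, zerosV_ofZeros, zerosV_ofZeros, ← hab, add_sub_cancel, Equiv.apply_symm_apply]
  have ht := superpotential_translationAct hn ⟨_, ofZeros_mem_L hA⟩ ⟨_, ofZeros_mem_L hB⟩ 0 p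
  have hw := superpotential_weylAct σ (translationAct ⟨_, ofZeros_mem_L hA⟩ ⟨_, ofZeros_mem_L hB⟩ 0 p)
  have hrreg : r ∈ regularLocus n := hw.1.1 (ht.1.1 hp)
  have hrf : ∀ z, superpotential r z = superpotential p z := fun z => by rw [hw.2, ht.2 hp]
  -- compare the first coordinates
  have h0 : Complex.exp (-(2 * Real.pi * Complex.I * r.1)) = Complex.exp (-(2 * Real.pi * Complex.I * q.1)) := by
    have hNq : superNum q 0 ≠ 0 := by
      refine (superNum_ne_zero_or hn hq 0).resolve_right (not_not.2 ?_)
      rw [superDen_eq_zero_iff hn]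
      exact Or.inl (zero_mem _)
    have hnum' : ∀ z, superNum r z = superNum q z :=
      eq_of_mul_eq_mul (differentiable_superNum r) (differentiable_superNum q) (differentiable_superDen q)
        (hne q hq) fun z => by
          have := (superpotential_eq_superpotential_iff hn hrreg hq z z).1 (by rw [hrf, h])
          have hd : superDen r z = superDen q z := by rw [superDen_eq, superDen_eq, hrz, hrτ, hτ]
          rw [hd] at this
          linear_combination this
    have h2 := hnum' 0
    rw [superNum_eq, superNum_eq q, hrz, hrτ, hτ] at h2
    rw [superNum_eq, hτ] at hNq
    exact mul_right_cancel₀ (right_ne_zero_of_mul hNq) h2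
  obtain ⟨k, hk⟩ := Complex.exp_eq_exp_iff_exists_int.1 h0
  have hk' : q.1 = r.1 + k := by
    apply mul_left_cancel₀ Complex.two_pi_I_ne_zero
    linear_combination hk
  have hqr : q = translationAct 0 0 k r := by
    refine Prod.ext ?_ (Prod.ext ?_ ?_)
    · change q.1 = r.1 - form (0 : V n) r.2.1 - form (0 : V n) 0 * (r.2.2 : ℂ) / 2 + k
      simp [form, hk']
    · change q.2.1 = r.2.1 + (r.2.2 : ℂ) • (0 : V n) + 0
      simp [hrz]
    · exact hτ
  rw [hqr, orbitSpace_mk_eq (translationAct_mem _ _ _), hrp]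

end

section

/-! ### Local injectivity -/

/-- `θ₁(-z)` has the multipliers of `θ₁(z)` and vanishes at `0`, hence is a multiple of it; the
derivatives at `0` give the factor `-1`. -/
lemma theta1_neg (z : ℂ) (τ : ℍ) : theta1 (-z) τ = -theta1 z τ := by
  obtain ⟨C, hC⟩ := IsThetaLike.exists_eq_mul (τ := τ) (f := fun z => theta1 (-z) τ)
    (p := fun z => theta1 z τ) ⟨(differentiable_theta1 τ).comp differentiable_neg, fun z => by
      have h := theta1_add_one (-(z + 1)) τ
      rw [show -(z + 1) + 1 = -z by ring] at h
      rw [h, neg_neg], fun z => by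
      have h := theta1_add_tau (-(z + τ)) τ
      rw [show -(z + τ) + (τ : ℂ) = -z by ring] at h
      rw [h, ← mul_assoc, neg_mul_neg, ← Complex.exp_add]
      rw [show (-(Real.pi * Complex.I * τ) - 2 * Real.pi * Complex.I * z +
        (-(Real.pi * Complex.I * τ) - 2 * Real.pi * Complex.I * -(z + τ)) : ℂ) = 0 by ring]
      simp⟩ (isThetaLike_theta1 τ) (by simp [theta1_zero]) (fun z hz => theta1_eq_zero_iff.1 hz)
    (theta1_zero τ) (deriv_theta1_ne_zero (theta1_zero τ)) (exists_theta1_ne_zero τ)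
  have hd := congrArg (fun f => deriv f 0) (funext hC)
  simp only [deriv_const_mul_field] at hd
  rw [deriv_comp_neg (f := fun z => theta1 z τ)] at hd
  have h0 := deriv_theta1_ne_zero (theta1_zero τ)
  simp only [neg_zero] at hd
  have hC1 : C = -1 := mul_right_cancel₀ h0 (by rw [← hd]; ring)
  rw [hC, hC1]; ring

variable {n : ℕ}

lemma superpotential_eq_infty_iff (hn : 1 ≤ n) {p : Omega n} {z : ℂ} :
    superpotential p z = OnePoint.infty ↔
      z ∈ (tauPeriods p.2.2).lattice ∨ z - poleV p.2.1 ∈ (tauPeriods p.2.2).lattice := by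
  rw [superpotential_eq, sphereDiv_eq_infty, superDen_eq_zero_iff hn]

lemma superpotential_add_lattice (hn : 1 ≤ n) {p : Omega n} (hp : p ∈ regularLocus n) {ω : ℂ}
    (hω : ω ∈ (tauPeriods p.2.2).lattice) (z : ℂ) : superpotential p (z + ω) = superpotential p z :=
  (isHurwitzFunction_superpotential hn hp).periodic z ω hω

/-- For `n = 1` both poles are simple, and `z ↦ κ - z` exchanges the two zeros and the two poles. It
corrects equivalences that interchange the poles. -/
lemma superpotential_reflect {p : Omega 1} (hp : p ∈ regularLocus 1) (z : ℂ) :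
    superpotential p (poleV p.2.1 - z) = superpotential p z := by
  rw [superpotential_eq_superpotential_iff le_rfl hp hp]
  have hs : zerosV p.2.1 0 + zerosV p.2.1 1 = poleV p.2.1 := by
    rw [← sum_zerosV, Fin.sum_univ_two]
  have h0 : poleV p.2.1 - z - zerosV p.2.1 0 = -(z - zerosV p.2.1 1) := by rw [← hs]; ring
  have h1 : poleV p.2.1 - z - zerosV p.2.1 1 = -(z - zerosV p.2.1 0) := by rw [← hs]; ring
  have h2 : poleV p.2.1 - z = -(z - poleV p.2.1) := by ring
  have h3 : poleV p.2.1 - z - poleV p.2.1 = -z := by ring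
  have hprod : ∀ g : Fin (1 + 1) → ℂ, ∏ i, g i = g 0 * g 1 := Fin.prod_univ_two
  simp only [superNum_eq, superDen_eq, hprod, h0, h1, pow_one, h3]
  rw [h2]
  simp only [theta1_neg]
  ring

/-- An equivalence between the pairs of two regular points can be taken to fix the origin. -/
lemma exists_homothety_of_equivalent (hn : 1 ≤ n) {p q : Omega n} (hp : p ∈ regularLocus n)
    (hq : q ∈ regularLocus n) (h : HurwitzEquivalent (superPair hn hp) (superPair hn hq)) :
    ∃ α : ℂ, α ≠ 0 ∧ (∀ z, z ∈ (tauPeriods p.2.2).lattice ↔ α * z ∈ (tauPeriods q.2.2).lattice) ∧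
      (∀ z, superpotential q (α * z) = superpotential p z) ∧
      α * poleV p.2.1 - poleV q.2.1 ∈ (tauPeriods q.2.2).lattice := by
  have hp' := mem_regularLocus.1 hp
  obtain ⟨α, hα, hΛ, hf⟩ : ∃ α : ℂ, α ≠ 0 ∧
      (∀ z, z ∈ (tauPeriods p.2.2).lattice ↔ α * z ∈ (tauPeriods q.2.2).lattice) ∧
      (∀ z, superpotential q (α * z) = superpotential p z) := by
    obtain ⟨α, β, hα, hΛ, hf⟩ := hurwitzEquivalent_iff.1 h
    have hf' : ∀ z, superpotential q (α * z + β) = superpotential p z := hf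
    have hΛ' : ∀ z, z ∈ (tauPeriods p.2.2).lattice ↔ α * z ∈ (tauPeriods q.2.2).lattice := hΛ
    have hβ : superpotential q β = OnePoint.infty := by
      have := hf' 0
      rw [mul_zero, zero_add] at this
      rw [this, superpotential_eq_infty_iff hn]
      exact Or.inl (zero_mem _)
    rcases (superpotential_eq_infty_iff hn).1 hβ with hβ | hβ
    · exact ⟨α, hα, hΛ', fun z => by rw [← hf', superpotential_add_lattice hn hq hβ]⟩
    -- The equivalence sends the pole at `0` to the other pole: impossible for `n ≥ 2` by the
    -- orders, repaired by the reflection for `n = 1`.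
    · rcases Nat.lt_or_ge 1 n with h2 | h2
      · exfalso
        have h1 := (hasPoleOfOrder_superpotential hn hq).2.add_period
          (isHurwitzFunction_superpotential hn hq).periodic hβ
        rw [add_sub_cancel] at h1
        have h3 : HasPoleOfOrder (fun z => superpotential q (α * z + β)) 1 0 :=
          HasPoleOfOrder.comp_affine hα (by simpa using h1)
        rw [show (fun z => superpotential q (α * z + β)) = superpotential p from funext hf'] at h3
        have := h3.unique (hasPoleOfOrder_superpotential hn hp).1
        omega
      · obtain rfl : n = 1 := le_antisymm h2 hn
        refine ⟨-α, neg_ne_zero.2 hα, fun z => by rw [hΛ', neg_mul, neg_mem_iff], fun z => ?_⟩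
        rw [← hf', ← superpotential_reflect hq, ← superpotential_add_lattice hn hq hβ]
        congr 1
        ring
  refine ⟨α, hα, hΛ, hf, ?_⟩
  have hpole : superpotential q (α * poleV p.2.1) = OnePoint.infty := by
    rw [hf, superpotential_eq_infty_iff hn]
    exact Or.inr (by simp)
  exact ((superpotential_eq_infty_iff hn).1 hpole).resolve_left fun hc => hp'.1 ((hΛ _).2 hc)

/-- A compactness argument. If equivalent pairs in different orbits accumulated at `(p₀, p₀)`, their
homotheties would converge to one preserving `λ_{p₀}` and its simple pole, hence to `1`.
Discreteness then makes the homothety, the lattice and the pole agree exactly, so the orbits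
coincide. -/
theorem eventually_mk_eq_of_equivalent (hn : 1 ≤ n) {p₀ : Omega n} (hp₀ : p₀ ∈ regularLocus n) :
    ∀ᶠ x : Omega n × Omega n in 𝓝 (p₀, p₀), ∀ (hp : x.1 ∈ regularLocus n) (hq : x.2 ∈ regularLocus n),
      HurwitzEquivalent (superPair hn hp) (superPair hn hq) → OrbitSpace.mk x.1 = OrbitSpace.mk x.2 := by
  classical
  by_contra hcon
  set bad : Set (Omega n × Omega n) := {x | ¬ ∀ (hp : x.1 ∈ regularLocus n) (hq : x.2 ∈ regularLocus n),
    HurwitzEquivalent (superPair hn hp) (superPair hn hq) → OrbitSpace.mk x.1 = OrbitSpace.mk x.2} with hbad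
  have hne : (𝓝 (p₀, p₀) ⊓ 𝓟 bad).NeBot := frequently_mem_iff_neBot.1 (not_eventually.1 hcon)
  -- The ultrafilter plays the role of a convergent subsequence of bad pairs.
  set U := Ultrafilter.of (𝓝 (p₀, p₀) ⊓ 𝓟 bad) with hU
  have hU0 : (U : Filter (Omega n × Omega n)) ≤ 𝓝 (p₀, p₀) ⊓ 𝓟 bad := Ultrafilter.of_le _
  have hU1 : Tendsto (fun x : Omega n × Omega n => x) U (𝓝 (p₀, p₀)) := hU0.trans inf_le_left
  have hU2 : ∀ᶠ x in (U : Filter (Omega n × Omega n)), x ∈ bad := le_principal_iff.1 (hU0.trans inf_le_right)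
  have hex : ∀ x : Omega n × Omega n, ∃ α : ℂ, x ∈ bad → x.1 ∈ regularLocus n ∧ x.2 ∈ regularLocus n ∧
      OrbitSpace.mk x.1 ≠ OrbitSpace.mk x.2 ∧ α ≠ 0 ∧
      (∀ z, z ∈ (tauPeriods x.1.2.2).lattice ↔ α * z ∈ (tauPeriods x.2.2.2).lattice) ∧
      (∀ z, superpotential x.2 (α * z) = superpotential x.1 z) ∧
      α * poleV x.1.2.1 - poleV x.2.2.1 ∈ (tauPeriods x.2.2.2).lattice := by
    intro x
    by_cases hx : x ∈ bad
    · have hx' := hx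
      simp only [hbad, mem_ofPred_eq, not_forall] at hx'
      obtain ⟨hp, hq, he, hneq⟩ := hx'
      obtain ⟨α, h1, h2, h3, h4⟩ := exists_homothety_of_equivalent hn hp hq he
      exact ⟨α, fun _ => ⟨hp, hq, hneq, h1, h2, h3, h4⟩⟩
    · exact ⟨0, fun h => absurd h hx⟩
  choose α hα using hex
  -- limits of the two points
  have hP : Tendsto (fun x : Omega n × Omega n => x.1) U (𝓝 p₀) := (continuous_fst.tendsto (p₀, p₀)).comp hU1
  have hQ : Tendsto (fun x : Omega n × Omega n => x.2) U (𝓝 p₀) := (continuous_snd.tendsto (p₀, p₀)).comp hU1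
  have hPτ : Tendsto (fun x : Omega n × Omega n => x.1.2.2) U (𝓝 p₀.2.2) :=
    (continuous_snd.snd.tendsto p₀).comp hP
  have hQτ : Tendsto (fun x : Omega n × Omega n => x.2.2.2) U (𝓝 p₀.2.2) :=
    (continuous_snd.snd.tendsto p₀).comp hQ
  have hPκ : Tendsto (fun x : Omega n × Omega n => poleV x.1.2.1) U (𝓝 (poleV p₀.2.1)) :=
    ((continuous_poleV.comp continuous_snd.fst).tendsto p₀).comp hP
  have hQκ : Tendsto (fun x : Omega n × Omega n => poleV x.2.2.1) U (𝓝 (poleV p₀.2.1)) :=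
    ((continuous_poleV.comp continuous_snd.fst).tendsto p₀).comp hQ
  have one_mem : ∀ τ : ℍ, (1 : ℂ) ∈ (tauPeriods τ).lattice := fun τ => mem_tauLattice.2 ⟨1, 0, by simp⟩
  have tau_mem : ∀ τ : ℍ, (τ : ℂ) ∈ (tauPeriods τ).lattice := fun τ => mem_tauLattice.2 ⟨0, 1, by simp⟩
  -- A lower bound for nonzero lattice vectors near `p₀`. Both `α` and `α⁻¹` are such vectors, so `d
  -- ≤ ‖α‖ ≤ d⁻¹`.
  set d : ℝ := min 1 (p₀.2.2.im / 2) with hd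
  have hd0 : 0 < d := lt_min one_pos (half_pos p₀.2.2.im_pos)
  have him : ∀ τ : Omega n × Omega n → ℍ, Tendsto τ U (𝓝 p₀.2.2) →
      ∀ᶠ x in (U : Filter (Omega n × Omega n)), d ≤ min 1 (τ x).im := by
    intro τ hτ
    have := (UpperHalfPlane.continuous_im.tendsto p₀.2.2).comp hτ
    filter_upwards [this.eventually (lt_mem_nhds (half_lt_self p₀.2.2.im_pos))] with x hx
    exact min_le_min le_rfl hx.le
  have hαlow : ∀ᶠ x in (U : Filter (Omega n × Omega n)), d ≤ ‖α x‖ := by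
    filter_upwards [hU2, him _ hQτ] with x hx h1
    obtain ⟨-, -, -, h2, h3, -⟩ := hα x hx
    have := (h3 1).1 (one_mem _)
    rw [mul_one] at this
    exact h1.trans (min_le_norm_of_mem_lattice this h2)
  have hαup : ∀ᶠ x in (U : Filter (Omega n × Omega n)), α x ∈ Metric.closedBall (0 : ℂ) d⁻¹ := by
    filter_upwards [hU2, him _ hPτ] with x hx h1
    obtain ⟨-, -, -, h2, h3, -⟩ := hα x hx
    have h4 : (α x)⁻¹ ∈ (tauPeriods x.1.2.2).lattice := by
      rw [h3, mul_inv_cancel₀ h2]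
      exact one_mem _
    have h5 := h1.trans (min_le_norm_of_mem_lattice h4 (inv_ne_zero h2))
    rw [norm_inv] at h5
    rw [mem_closedBall_zero_iff]
    rwa [le_inv_comm₀ hd0 (norm_pos_iff.2 h2)] at h5
  obtain ⟨a, -, ha⟩ := (isCompact_closedBall (0 : ℂ) d⁻¹).ultrafilter_le_nhds (U.map α)
    (le_principal_iff.2 hαup)
  have hαa : Tendsto α U (𝓝 a) := ha
  have ha0 : a ≠ 0 := by
    have := ge_of_tendsto hαa.norm hαlow
    exact norm_pos_iff.1 (hd0.trans_le this)
  have hfa : ∀ z, superpotential p₀ (a * z) = superpotential p₀ z := by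
    intro z
    rw [superpotential_eq_superpotential_iff hn hp₀ hp₀]
    have t1 : ∀ {f : Omega n × ℂ → ℂ}, Continuous f → Tendsto (fun x : Omega n × Omega n => f (x.1, z)) U (𝓝 (f (p₀, z))) :=
      fun hf => (hf.tendsto (p₀, z)).comp (hP.prodMk_nhds tendsto_const_nhds)
    have t2 : ∀ {f : Omega n × ℂ → ℂ}, Continuous f →
        Tendsto (fun x : Omega n × Omega n => f (x.2, α x * z)) U (𝓝 (f (p₀, a * z))) :=
      fun hf => (hf.tendsto (p₀, a * z)).comp (hQ.prodMk_nhds (hαa.mul_const z))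
    refine tendsto_nhds_unique ((t2 continuous_superNum).mul (t1 continuous_superDen))
      (((t1 continuous_superNum).mul (t2 continuous_superDen)).congr' ?_)
    filter_upwards [hU2] with x hx
    obtain ⟨h1, h2, -, -, -, h3, -⟩ := hα x hx
    exact ((superpotential_eq_superpotential_iff hn h2 h1 _ _).1 (h3 z)).symm
  have hκa : a * poleV p₀.2.1 - poleV p₀.2.1 ∈ (tauPeriods p₀.2.2).lattice := by
    refine mem_lattice_of_tendsto ((hαa.mul hPκ).sub hQκ) hQτ ?_
    filter_upwards [hU2] with x hx
    exact (hα x hx).2.2.2.2.2.2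
  have ha1 : a = 1 := by
    refine (hasPoleOfOrder_superpotential hn hp₀).2.eq_one_of_comp ha0 fun z => ?_
    rw [← hfa z, ← superpotential_add_lattice hn hp₀ hκa]
    congr 1
    ring
  subst ha1
  -- `α` is a lattice vector of the second point tending to `1`, so it equals `1`. The same
  -- discreteness identifies `τ` and the poles.
  have hα1 : ∀ᶠ x in (U : Filter (Omega n × Omega n)), α x = 1 := by
    filter_upwards [hU2, eventually_eq_of_mem_tauLattice 1 0 (by simpa using hαa) hQτ] with x hx h1
    have := ((hα x hx).2.2.2.2.1 1).1 (one_mem _)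
    rw [mul_one] at this
    simpa using h1 this
  have hτ1 : ∀ᶠ x in (U : Filter (Omega n × Omega n)), x.2.2.2 = x.1.2.2 := by
    have hPτ' : Tendsto (fun x : Omega n × Omega n => (x.1.2.2 : ℂ)) U (𝓝 p₀.2.2) :=
      (UpperHalfPlane.continuous_coe.tendsto _).comp hPτ
    filter_upwards [hU2, hα1, eventually_eq_of_mem_tauLattice 0 1 (by simpa using hPτ') hQτ] with x hx h1 h2
    have := ((hα x hx).2.2.2.2.1 _).1 (tau_mem _)
    rw [h1, one_mul] at this
    have := h2 this
    rw [Int.cast_zero, zero_add, Int.cast_one, one_mul] at this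
    exact UpperHalfPlane.ext this.symm
  have hκ1 : ∀ᶠ x in (U : Filter (Omega n × Omega n)), poleV x.2.2.1 = poleV x.1.2.1 := by
    have ht := (hαa.mul hPκ).sub hQκ
    rw [one_mul, sub_self] at ht
    filter_upwards [hU2, hα1, eventually_eq_of_mem_tauLattice 0 0 (by simpa using ht) hQτ] with x hx h1 h2
    have := h2 (hα x hx).2.2.2.2.2.2
    rw [h1] at this
    simp only [Int.cast_zero, zero_mul, one_mul, add_zero] at this
    exact (sub_eq_zero.1 this).symm
  obtain ⟨x, hx, h1, h2, h3⟩ := (hU2.and (hα1.and (hτ1.and hκ1))).exists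
  obtain ⟨g1, g2, g3, -, -, g4, -⟩ := hα x hx
  refine g3 (orbitSpace_mk_eq_of_superpotential_eq hn g1 g2 h2 h3 fun z => ?_).symm
  rw [← g4 z, h1, one_mul]

end

section

/-! ### Holomorphic choice of the period ratio -/

/-- A homothety onto a lattice `P` is given by an invertible integral matrix. -/
lemma exists_int_matrix (P : PeriodPair) {τ : ℍ} {α : ℂ} (hα : α ≠ 0)
    (hΛ : ∀ z, z ∈ (tauPeriods τ).lattice ↔ α * z ∈ P.lattice) :
    ∃ m₁ k₁ m₂ k₂ a b c d : ℤ, α = m₁ * P.ω₁ + k₁ * P.ω₂ ∧ α * τ = m₂ * P.ω₁ + k₂ * P.ω₂ ∧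
      a * m₁ + b * m₂ = 1 ∧ a * k₁ + b * k₂ = 0 ∧ c * m₁ + d * m₂ = 0 ∧ c * k₁ + d * k₂ = 1 := by
  have hind : ∀ x y : ℤ, (x : ℂ) * P.ω₁ + y * P.ω₂ = 0 → x = 0 ∧ y = 0 := by
    intro x y h
    have := LinearIndependent.pair_iff.1 P.indep x y (by simpa using h)
    exact ⟨by exact_mod_cast this.1, by exact_mod_cast this.2⟩
  obtain ⟨m₁, k₁, h1⟩ := PeriodPair.mem_lattice.1 ((hΛ 1).1 (mem_tauLattice.2 ⟨1, 0, by simp⟩))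
  obtain ⟨m₂, k₂, h2⟩ := PeriodPair.mem_lattice.1 ((hΛ τ).1 (mem_tauLattice.2 ⟨0, 1, by simp⟩))
  rw [mul_one] at h1
  obtain ⟨a, b, h3⟩ := mem_tauLattice.1 ((hΛ (α⁻¹ * P.ω₁)).2 (by
    rw [mul_inv_cancel_left₀ hα]; exact P.ω₁_mem_lattice))
  obtain ⟨c, d, h4⟩ := mem_tauLattice.1 ((hΛ (α⁻¹ * P.ω₂)).2 (by
    rw [mul_inv_cancel_left₀ hα]; exact P.ω₂_mem_lattice))
  rw [inv_mul_eq_iff_eq_mul₀ hα] at h3 h4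
  have e1 := hind (a * m₁ + b * m₂ - 1) (a * k₁ + b * k₂) (by
    push_cast
    linear_combination (a : ℂ) * h1 + (b : ℂ) * h2 - h3)
  have e2 := hind (c * m₁ + d * m₂) (c * k₁ + d * k₂ - 1) (by
    push_cast
    linear_combination (c : ℂ) * h1 + (d : ℂ) * h2 - h4)
  exact ⟨m₁, k₁, m₂, k₂, a, b, c, d, h1.symm, h2.symm, by linarith [e1.1], e1.2, e2.1, by linarith [e2.2]⟩

/-- Converse of `exists_int_matrix`: the matrix found at one member of a family serves for its
neighbours, which makes `τ` and `α` explicit functions of the periods. -/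
lemma mem_lattice_iff_of_int_matrix {P : PeriodPair} {τ : ℍ} {α : ℂ} (hα : α ≠ 0)
    {m₁ k₁ m₂ k₂ a b c d : ℤ} (h1 : α = m₁ * P.ω₁ + k₁ * P.ω₂) (h2 : α * τ = m₂ * P.ω₁ + k₂ * P.ω₂)
    (e1 : a * m₁ + b * m₂ = 1) (e2 : a * k₁ + b * k₂ = 0) (e3 : c * m₁ + d * m₂ = 0)
    (e4 : c * k₁ + d * k₂ = 1) (z : ℂ) : z ∈ (tauPeriods τ).lattice ↔ α * z ∈ P.lattice := by
  have e1' : (a : ℂ) * m₁ + b * m₂ = 1 := by exact_mod_cast e1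
  have e2' : (a : ℂ) * k₁ + b * k₂ = 0 := by exact_mod_cast e2
  have e3' : (c : ℂ) * m₁ + d * m₂ = 0 := by exact_mod_cast e3
  have e4' : (c : ℂ) * k₁ + d * k₂ = 1 := by exact_mod_cast e4
  rw [mem_tauLattice, PeriodPair.mem_lattice]
  constructor
  · rintro ⟨m, k, rfl⟩
    refine ⟨m * m₁ + k * m₂, m * k₁ + k * k₂, ?_⟩
    push_cast
    linear_combination -(m : ℂ) * h1 - (k : ℂ) * h2
  · rintro ⟨m, k, h⟩
    refine ⟨m * a + k * c, m * b + k * d, ?_⟩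
    apply mul_left_cancel₀ hα
    push_cast
    linear_combination -h - ((m : ℂ) * a + k * c) * h1 - ((m : ℂ) * b + k * d) * h2 -
      (m : ℂ) * P.ω₁ * e1' - (m : ℂ) * P.ω₂ * e2' - (k : ℂ) * P.ω₁ * e3' - (k : ℂ) * P.ω₂ * e4'

/-! ### Poles in families -/

variable {E : Type*} [NormedAddCommGroup E] [NormedSpace ℂ E]

lemma recip_eq_infty {w : ℂ} : recip w = OnePoint.infty ↔ w = 0 := by
  unfold recip
  split_ifs with h <;> simp [h]

lemma recip_eq_coe {w v : ℂ} (hv : v ≠ 0) : recip w = ((v⁻¹ : ℂ) : OnePoint ℂ) ↔ w = v := by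
  unfold recip
  split_ifs with h
  · subst h; simp [hv.symm]
  · simp

/-- Near the pole the finite chart is excluded, so the family is the reciprocal of a holomorphic
function whose slice vanishes to exact order `m`. The poles can then be followed as roots. -/
lemma HasPoleOfOrder.exists_recip {f : E × ℂ → OnePoint ℂ} {e₀ : E} {c : ℂ} {m : ℕ} (hm : m ≠ 0)
    (hf : SphereHolAt f (e₀, c)) (hp : HasPoleOfOrder (fun z => f (e₀, z)) m c) :
    ∃ φ : E × ℂ → ℂ, HolAt φ (e₀, c) ∧ (∀ᶠ y in 𝓝 (e₀, c), f y = recip (φ y)) ∧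
      ∃ g : ℂ → ℂ, HolAt g c ∧ g c ≠ 0 ∧ ∀ᶠ z in 𝓝 c, φ (e₀, z) = (z - c) ^ m * g z := by
  obtain ⟨hinf, G, hG, hG0, hfG⟩ := hp
  rcases hf with ⟨φ, hφ, hfφ⟩ | ⟨φ, hφ, hfφ⟩
  · have := hfφ.self_of_nhds
    simp only at hinf
    rw [hinf] at this
    exact absurd this (by simp)
  · refine ⟨φ, hφ, hfφ, fun z => (G z)⁻¹, hG.inv hG0, inv_ne_zero hG0, ?_⟩
    have h1 : ∀ᶠ z in 𝓝 c, f (e₀, z) = recip (φ (e₀, z)) :=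
      (Continuous.tendsto (by fun_prop : Continuous fun z : ℂ => (e₀, z)) c).eventually hfφ
    have h2 := eventually_nhdsWithin_iff.1 hfG
    filter_upwards [h1, h2, hG.continuousAt.eventually_ne hG0] with z a b d
    by_cases hz : z = c
    · subst hz
      simp only at hinf
      rw [hinf] at a
      rw [recip_eq_infty.1 a.symm, sub_self, zero_pow hm, zero_mul]
    · have hz' : z - c ≠ 0 := sub_ne_zero.2 hz
      have hb := b hz
      rw [a] at hb
      have hv : (z - c) ^ m * (G z)⁻¹ ≠ 0 := mul_ne_zero (pow_ne_zero _ hz') (inv_ne_zero d)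
      rw [← recip_eq_coe hv, hb]
      congr 1
      rw [mul_inv, inv_inv, div_eq_mul_inv, mul_comm]

/-- In a holomorphic family a pole of order `m` splits into `m` poles. -/
lemma exists_pole_roots {f : E × ℂ → OnePoint ℂ} {e₀ : E} {c : ℂ} {m : ℕ} (hm : m ≠ 0)
    (hf : SphereHolAt f (e₀, c)) (hp : HasPoleOfOrder (fun z => f (e₀, z)) m c) :
    ∃ x : E → Fin m → ℂ, Tendsto x (𝓝 e₀) (𝓝 fun _ => c) ∧ HolAt (fun e => ∑ i, x e i) e₀ ∧
      ∀ᶠ e in 𝓝 e₀, (∀ i, f (e, x e i) = OnePoint.infty) ∧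
        ∀ w, (∀ i, x e i = w) → HasPoleOfOrder (fun z => f (e, z)) m w := by
  obtain ⟨φ, hφ, hfφ, g, hg, hg0, hord⟩ := hp.exists_recip hm hf
  obtain ⟨x, hx, hps, r, hr, hroots⟩ := exists_roots (ι := Fin m) hφ hg hg0 (by simpa using hord)
  refine ⟨x, hx, by simpa using hps 1, ?_⟩
  obtain ⟨U, hU, V, hV, hUV⟩ := mem_nhds_prod_iff.1 hfφ
  obtain ⟨s, hs, hsV⟩ := Metric.mem_nhds_iff.1 hV
  set t := min r s with ht
  have ht0 : 0 < t := lt_min hr hs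
  have hxt : ∀ᶠ e in 𝓝 e₀, ∀ i, x e i ∈ Metric.ball c t := by
    rw [eventually_all]
    exact fun i => (tendsto_pi_nhds.1 hx i).eventually (Metric.ball_mem_nhds c ht0)
  filter_upwards [hxt, hroots, hU] with e h1 h2 h3
  obtain ⟨h, hh, hh0, hφh⟩ := h2
  have hfe : ∀ z ∈ Metric.ball c t, f (e, z) = recip (φ (e, z)) := fun z hz =>
    hUV (mk_mem_prod h3 (hsV (Metric.ball_subset_ball (min_le_right _ _) hz)))
  have hinf : ∀ i, f (e, x e i) = OnePoint.infty := by
    intro i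
    rw [hfe _ (h1 i), recip_eq_infty, hφh, Finset.prod_eq_zero (Finset.mem_univ i) (sub_self _), zero_mul]
  refine ⟨hinf, fun w hw => ?_⟩
  have hwt : w ∈ Metric.ball c t := by
    rw [← hw ⟨0, Nat.pos_of_ne_zero hm⟩]; exact h1 _
  have hwr : w ∈ Metric.closedBall c r :=
    Metric.ball_subset_closedBall (Metric.ball_subset_ball (min_le_left _ _) hwt)
  refine ⟨?_, fun z => (h z)⁻¹, (holAt_iff_analyticAt.2 (hh w hwr)).inv (hh0 w hwr),
    inv_ne_zero (hh0 w hwr), ?_⟩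
  · rw [← hw ⟨0, Nat.pos_of_ne_zero hm⟩]; exact hinf _
  · filter_upwards [self_mem_nhdsWithin, (Metric.isOpen_ball.mem_nhds hwt : _ ∈ 𝓝 w) |> mem_nhdsWithin_of_mem_nhds] with z hz hzt
    have hz' : z - w ≠ 0 := sub_ne_zero.2 hz
    have hhz : h z ≠ 0 := hh0 z (Metric.ball_subset_closedBall (Metric.ball_subset_ball (min_le_left _ _) hzt))
    rw [hfe z hzt, hφh]
    simp only [hw, Finset.prod_const, Finset.card_univ, Fintype.card_fin]
    rw [recip, if_neg (mul_ne_zero (pow_ne_zero _ hz') hhz)]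
    congr 1
    rw [mul_inv, div_eq_mul_inv, mul_comm]

/-! ### Normalisation of a family of pairs -/

lemma tendsto_coe_upperHalfPlane {X : Type*} {l : Filter X} {τ : X → ℍ} {τ₀ : ℍ} :
    Tendsto τ l (𝓝 τ₀) ↔ Tendsto (fun x => (τ x : ℂ)) l (𝓝 τ₀) :=
  UpperHalfPlane.isOpenEmbedding_coe.isInducing.tendsto_nhds_iff

lemma eventually_notMem_lattice {X : Type*} {l : Filter X} {w : X → ℂ} {τ : X → ℍ} {τ₀ : ℍ} {w₀ : ℂ}
    (hw : Tendsto w l (𝓝 w₀)) (hτ : Tendsto τ l (𝓝 τ₀)) (h : w₀ ∉ (tauPeriods τ₀).lattice) :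
    ∀ᶠ x in l, w x ∉ (tauPeriods (τ x)).lattice := by
  rw [← theta1_eq_zero_iff] at h
  have h1 := (continuous_theta1.tendsto (w₀, τ₀)).comp (hw.prodMk_nhds hτ)
  filter_upwards [h1.eventually_ne h] with x hx hmem
  exact hx (theta1_eq_zero_iff.2 hmem)

lemma eventually_eq_zero_of_mem_lattice {X : Type*} {l : Filter X} {w : X → ℂ} {τ : X → ℍ} {τ₀ : ℍ}
    (hw : Tendsto w l (𝓝 0)) (hτ : Tendsto τ l (𝓝 τ₀)) :
    ∀ᶠ x in l, w x ∈ (tauPeriods (τ x)).lattice → w x = 0 := by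
  filter_upwards [eventually_eq_of_mem_tauLattice 0 0 (by simpa using hw) hτ] with x hx h
  simpa using hx h

variable {n k : ℕ}

/-- Near a point equivalent to `λ_{p₀}`, a holomorphic family of pairs can be normalised so that its
members are superpotentials. -/
theorem exists_normalized_family (hn : 1 ≤ n) (A : HurwitzFamily n k) {b₀ : Fin k → ℂ}
    (hb₀ : b₀ ∈ A.base) {p₀ : Omega n} (hp₀ : p₀ ∈ regularLocus n)
    (heq : HurwitzEquivalent (superPair hn hp₀) (A.member b₀)) :
    ∃ (τ : (Fin k → ℂ) → ℂ) (F : (Fin k → ℂ) × ℂ → OnePoint ℂ), HolAt τ b₀ ∧ τ b₀ = p₀.2.2 ∧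
      (∀ z, SphereHolAt F (b₀, z)) ∧ (∀ z, F (b₀, z) = superpotential p₀ z) ∧
      ∀ᶠ b in 𝓝 b₀, ∃ (q : Omega n) (hq : q ∈ regularLocus n), (q.2.2 : ℂ) = τ b ∧
        (∀ z, F (b, z) = superpotential q z) ∧ HurwitzEquivalent (superPair hn hq) (A.member b) := by
  obtain ⟨α₀, β₀, hα₀, hΛ₀, hf₀⟩ := hurwitzEquivalent_iff.1 heq
  -- The integral change of basis is found at `b₀` and kept fixed, so that the normalised period
  -- ratio varies holomorphically.
  obtain ⟨m₁, k₁, m₂, k₂, a, b, c, d, h1, h2, e1, e2, e3, e4⟩ := exists_int_matrix _ hα₀ hΛ₀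
  have hbase : ∀ᶠ b in 𝓝 b₀, b ∈ A.base := A.isOpen_base.mem_nhds hb₀
  have hω₁ : HolAt (fun b => (A.member b).periods.ω₁) b₀ := by
    filter_upwards [hbase] with b hb
    exact A.hol_period₁.differentiableAt (A.isOpen_base.mem_nhds hb)
  have hω₂ : HolAt (fun b => (A.member b).periods.ω₂) b₀ := by
    filter_upwards [hbase] with b hb
    exact A.hol_period₂.differentiableAt (A.isOpen_base.mem_nhds hb)
  have hconst : ∀ x : ℂ, HolAt (fun _ : Fin k → ℂ => x) b₀ := fun x =>
    holAt_of_differentiable (differentiable_const x) b₀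
  set α : (Fin k → ℂ) → ℂ := fun b => m₁ * (A.member b).periods.ω₁ + k₁ * (A.member b).periods.ω₂ with hα
  set τ : (Fin k → ℂ) → ℂ := fun b =>
    (m₂ * (A.member b).periods.ω₁ + k₂ * (A.member b).periods.ω₂) / α b with hτ
  have hαb₀ : α b₀ = α₀ := h1.symm
  have hαhol : HolAt α b₀ := ((hconst _).mul hω₁).add ((hconst _).mul hω₂)
  have hτhol : HolAt τ b₀ := (((hconst _).mul hω₁).add ((hconst _).mul hω₂)).div hαhol (by rwa [hαb₀])
  have hτb₀ : τ b₀ = p₀.2.2 := by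
    simp only [hτ]
    rw [hαb₀, ← h2, mul_div_cancel_left₀ _ hα₀]
  have hα0 : ∀ᶠ b in 𝓝 b₀, α b ≠ 0 := hαhol.continuousAt.eventually_ne (by rwa [hαb₀])
  have him : ∀ᶠ b in 𝓝 b₀, 0 < (τ b).im := by
    have := Complex.continuous_im.continuousAt.comp hτhol.continuousAt
    exact this.eventually (lt_mem_nhds (by simp only [Function.comp, hτb₀]; exact p₀.2.2.im_pos))
  set T : (Fin k → ℂ) → ℍ := fun b => UpperHalfPlane.ofComplex (τ b) with hT
  have hTτ : ∀ᶠ b in 𝓝 b₀, (T b : ℂ) = τ b := by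
    filter_upwards [him] with b hb
    simp only [hT, UpperHalfPlane.ofComplex_apply_of_im_pos hb]
  have hTlim : Tendsto T (𝓝 b₀) (𝓝 p₀.2.2) := by
    rw [tendsto_coe_upperHalfPlane, ← hτb₀]
    exact hτhol.continuousAt.tendsto.congr' (hTτ.mono fun b hb => hb.symm)
  have hΛ : ∀ᶠ b in 𝓝 b₀, ∀ z, z ∈ (tauPeriods (T b)).lattice ↔ α b * z ∈ (A.member b).periods.lattice := by
    filter_upwards [hα0, hTτ] with b hb hb' z
    refine mem_lattice_iff_of_int_matrix hb rfl ?_ e1 e2 e3 e4 z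
    rw [hb', hτ, mul_div_cancel₀ _ hb]
  -- the family in the coordinate `z`
  set h : (Fin k → ℂ) × ℂ → OnePoint ℂ := fun y => (A.member y.1).fn (α y.1 * y.2 + β₀) with hh
  have hfst : ∀ z : ℂ, HolAt (fun y : (Fin k → ℂ) × ℂ => y.1) (b₀, z) := fun z =>
    holAt_of_differentiable differentiable_fst _
  have hsnd : ∀ z : ℂ, HolAt (fun y : (Fin k → ℂ) × ℂ => y.2) (b₀, z) := fun z =>
    holAt_of_differentiable differentiable_snd _
  have hhol : ∀ z, SphereHolAt h (b₀, z) := by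
    intro z
    have h3 : HolAt (fun y : (Fin k → ℂ) × ℂ => α y.1) (b₀, z) :=
      HolAt.comp' (f := fun y : (Fin k → ℂ) × ℂ => y.1) (x := (b₀, z)) hαhol (hfst z)
    exact SphereHolAt.comp' (f := fun x : (Fin k → ℂ) × ℂ => (A.member x.1).fn x.2)
      (g := fun y : (Fin k → ℂ) × ℂ => (y.1, α y.1 * y.2 + β₀)) (x := (b₀, z)) (A.hol_fn b₀ hb₀ _)
      ((hfst z).prodMk ((h3.mul (hsnd z)).add (holAt_of_differentiable (differentiable_const β₀) _)))
  have hhb₀ : ∀ z, h (b₀, z) = superpotential p₀ z := by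
    intro z
    simp only [hh, hαb₀]
    exact hf₀ z
  have hhb₀' : (fun z => h (b₀, z)) = superpotential p₀ := funext hhb₀
  obtain ⟨x, hxlim, hxhol, hx⟩ := exists_pole_roots (m := n) (by omega) (hhol 0)
    (by rw [hhb₀']; exact (hasPoleOfOrder_superpotential hn hp₀).1)
  obtain ⟨y, hylim, -, hy⟩ := exists_pole_roots (m := 1) one_ne_zero (hhol (poleV p₀.2.1))
    (by rw [hhb₀']; exact (hasPoleOfOrder_superpotential hn hp₀).2)
  have hxi := fun i => tendsto_pi_nhds.1 hxlim i
  have hy0 := tendsto_pi_nhds.1 hylim 0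
  have hxy : ∀ᶠ b in 𝓝 b₀, ∀ i, x b i - y b 0 ∉ (tauPeriods (T b)).lattice := by
    rw [eventually_all]
    intro i
    refine eventually_notMem_lattice ((hxi i).sub hy0) hTlim ?_
    rw [zero_sub, neg_mem_iff]
    exact (mem_regularLocus.1 hp₀).1
  have hxx : ∀ᶠ b in 𝓝 b₀, ∀ i j, x b i - x b j ∈ (tauPeriods (T b)).lattice → x b i - x b j = 0 := by
    rw [eventually_all]
    intro i
    rw [eventually_all]
    intro j
    exact eventually_eq_zero_of_mem_lattice (by simpa using (hxi i).sub (hxi j)) hTlim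
  -- The mean of the `n` poles near `0` is holomorphic because their sum is; as all of them turn out
  -- to coincide, it is the position of the pole of order `n`.
  set xm : (Fin k → ℂ) → ℂ := fun b => (∑ i, x b i) / n with hxm
  have hn0 : (n : ℂ) ≠ 0 := by exact_mod_cast (by omega : n ≠ 0)
  have hxmhol : HolAt xm b₀ := hxhol.div (hconst _) hn0
  have hxm0 : xm b₀ = 0 := by
    refine tendsto_nhds_unique hxmhol.continuousAt.tendsto ?_
    have : Tendsto (fun b => (∑ i, x b i) / (n : ℂ)) (𝓝 b₀) (𝓝 ((∑ i : Fin n, (0 : ℂ)) / n)) :=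
      (tendsto_finsetSum _ fun i _ => hxi i).div_const _
    simpa using this
  refine ⟨τ, fun w => h (w.1, w.2 + xm w.1), hτhol, hτb₀, fun z => ?_, fun z => ?_, ?_⟩
  · have h3 : HolAt (fun w : (Fin k → ℂ) × ℂ => xm w.1) (b₀, z) :=
      HolAt.comp' (f := fun y : (Fin k → ℂ) × ℂ => y.1) (x := (b₀, z)) hxmhol (hfst z)
    exact SphereHolAt.comp' (g := fun w : (Fin k → ℂ) × ℂ => (w.1, w.2 + xm w.1)) (hhol _)
      ((hfst z).prodMk ((hsnd z).add h3))
  · simp only [hxm0, add_zero, hhb₀]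
  · filter_upwards [hα0, hTτ, hΛ, hx, hy, hxy, hxx] with b hb hTb hΛb hxb hyb hxyb hxxb
    have hhper : ∀ z, ∀ ω ∈ (tauPeriods (T b)).lattice, h (b, z + ω) = h (b, z) := by
      intro z ω hω
      have := (A.member b).isHurwitz.periodic (α b * z + β₀) _ ((hΛb ω).1 hω)
      refine Eq.trans ?_ this
      simp only [hh]
      congr 1
      ring
    have hhhol : ∀ z, SphereHolAt (fun z => h (b, z)) z := by
      intro z
      exact SphereHolAt.comp' (g := fun z : ℂ => α b * z + β₀) ((A.member b).isHurwitz.hol _)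
        (holAt_of_differentiable (by fun_prop) z)
    obtain ⟨P, Q, hPQ⟩ : ∃ P Q : ℂ, ∀ z, h (b, z) = OnePoint.infty →
        z - P ∈ (tauPeriods (T b)).lattice ∨ z - Q ∈ (tauPeriods (T b)).lattice := by
      obtain ⟨P, Q, -, -, -, hPQ⟩ := (A.member b).isHurwitz.poles
      refine ⟨(P - β₀) / α b, (Q - β₀) / α b, fun z hz => ?_⟩
      rw [hΛb, hΛb]
      have := hPQ _ hz
      rwa [mul_sub, mul_sub, mul_div_cancel₀ _ hb, mul_div_cancel₀ _ hb, ← sub_add, ← sub_add,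
        ← add_sub_right_comm, ← add_sub_right_comm]
    set Λ := (tauPeriods (T b)).lattice with hΛdef
    set i₀ : Fin n := ⟨0, by omega⟩ with hi₀
    -- Each member has only two classes of poles, and the poles near `0` and near `κ` lie in
    -- different ones. So all `x b i` are congruent and, being close together, equal.
    have hcong : ∀ z, h (b, z) = OnePoint.infty → z - x b i₀ ∈ Λ ∨ z - y b 0 ∈ Λ := by
      have hsub : ∀ {u v w : ℂ}, u - w ∈ Λ → v - w ∈ Λ → u - v ∈ Λ := fun {u v w} hu hv => by
        simpa using sub_mem hu hv
      intro z hz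
      rcases hPQ _ (hxb.1 i₀) with hp | hp <;> rcases hPQ _ (hyb.1 0) with hq | hq
      · exact absurd (hsub hp hq) (hxyb i₀)
      · exact (hPQ z hz).imp (fun h => hsub h hp) fun h => hsub h hq
      · exact (hPQ z hz).symm.imp (fun h => hsub h hp) fun h => hsub h hq
      · exact absurd (hsub hp hq) (hxyb i₀)
    have hxeq : ∀ i, x b i = x b i₀ := fun i =>
      sub_eq_zero.1 (hxxb i i₀ ((hcong _ (hxb.1 i)).resolve_right (hxyb i)))
    have hxmb : xm b = x b i₀ := by
      simp only [hxm, hxeq]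
      simp [hn0]
    obtain ⟨q, hq, hqT, hqf⟩ := exists_superpotential_eq (α := 1) hn hhhol hhper (hxyb i₀)
      (hxb.2 _ hxeq) (hyb.2 (y b 0) fun i => by rw [Subsingleton.elim i 0]) hcong one_ne_zero
      (fun z => by rw [one_mul])
    have hqf' : ∀ z, h (b, z + xm b) = superpotential q z := by
      intro z
      rw [hxmb, ← hqf, one_mul]
    refine ⟨q, hq, by rw [hqT, hTb], hqf', hurwitzEquivalent_iff.2 ⟨α b, α b * xm b + β₀, hb, ?_, fun z => ?_⟩⟩
    · intro z
      rw [← hΛb]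
      change z ∈ (tauPeriods q.2.2).lattice ↔ _
      rw [hqT]
    · change _ = superpotential q z
      rw [← hqf']
      simp only [hh]
      congr 1
      ring

end

section

/-! ### Counting zeros of theta products -/

open Classical in
lemma exists_prod_theta1_eq_pow_mul {ι : Type*} [Fintype ι] (τ : ℍ) (y : ι → ℂ) (a : ℂ) :
    ∃ g : ℂ → ℂ, Differentiable ℂ g ∧ g a ≠ 0 ∧ ∀ z, ∏ i, theta1 (z - y i) τ =
      (z - a) ^ (Finset.univ.filter fun i => y i - a ∈ (tauPeriods τ).lattice).card * g z := by
  have h : ∀ i, ∃ g : ℂ → ℂ, Differentiable ℂ g ∧ g a ≠ 0 ∧ ∀ z, theta1 (z - y i) τ =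
      (if y i - a ∈ (tauPeriods τ).lattice then z - a else 1) * g z := by
    intro i
    by_cases hi : y i - a ∈ (tauPeriods τ).lattice
    · obtain ⟨t, ht, ht0, hθ⟩ := theta1_factor (w := a - y i) (by simpa using neg_mem hi)
      refine ⟨fun z => t (z - y i), ht.comp (by fun_prop : Differentiable ℂ fun z => z - y i), ht0,
        fun z => ?_⟩
      rw [if_pos hi, hθ]
      ring
    · refine ⟨fun z => theta1 (z - y i) τ,
        (differentiable_theta1 τ).comp (by fun_prop : Differentiable ℂ fun z => z - y i), ?_, fun z => ?_⟩
      · rw [Ne, theta1_eq_zero_iff, ← neg_mem_iff, neg_sub]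
        exact hi
      · rw [if_neg hi, one_mul]
  choose g hg hg0 hgθ using h
  refine ⟨fun z => ∏ i, g i z, fun z => (HolAt.prod fun i _ =>
    holAt_of_differentiable (hg i) z).differentiableAt, Finset.prod_ne_zero_iff.2 fun i _ => hg0 i,
    fun z => ?_⟩
  simp only [hgθ, Finset.prod_mul_distrib, Finset.prod_ite, Finset.prod_const, one_pow, mul_one]

lemma eq_of_pow_mul_eq {a b : ℕ} {f g h : ℂ → ℂ} {w : ℂ} (hg : HolAt g w) (hg0 : g w ≠ 0)
    (hh : HolAt h w) (hh0 : h w ≠ 0) (hfg : ∀ᶠ z in 𝓝 w, f z = (z - w) ^ a * g z)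
    (hfh : ∀ᶠ z in 𝓝 w, f z = (z - w) ^ b * h z) : a = b := by
  have hpow : HolAt (fun z : ℂ => (z - w) ^ a) w :=
    holAt_of_differentiable (g := fun z : ℂ => (z - w) ^ a) (by fun_prop) w
  have hf : AnalyticAt ℂ f w := holAt_iff_analyticAt.1
    ((hpow.mul hg).congr (hfg.mono fun z hz => hz.symm))
  have h1 := hf.analyticOrderAt_eq_natCast.2 ⟨g, holAt_iff_analyticAt.1 hg, hg0, hfg⟩
  have h2 := hf.analyticOrderAt_eq_natCast.2 ⟨h, holAt_iff_analyticAt.1 hh, hh0, hfh⟩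
  rw [h1] at h2
  exact_mod_cast h2

open Classical in
-- Fibres of equal size are matched by bijections. This compares two lists of zeros modulo the
-- lattice through multiplicities.
lemma exists_perm_of_card_eq {ι α : Type*} [Fintype ι] {f g : ι → α}
    (h : ∀ i, (Finset.univ.filter fun j => f j = f i).card =
      (Finset.univ.filter fun j => g j = f i).card) : ∃ σ : Equiv.Perm ι, ∀ i, g (σ i) = f i := by
  have hcount : ∀ (f : ι → α) (C : α), Multiset.count C (Finset.univ.val.map f) =
      (Finset.univ.filter fun j => f j = C).card := by
    intro f C
    rw [Multiset.count_map]
    simp only [eq_comm (a := C)]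
    rfl
  have hle : Finset.univ.val.map f ≤ Finset.univ.val.map g := by
    rw [Multiset.le_iff_count]
    intro C
    rw [hcount, hcount]
    by_cases hC : ∃ i, f i = C
    · obtain ⟨i, rfl⟩ := hC
      exact (h i).le
    · push Not at hC
      simp [hC]
  have heq := Multiset.eq_of_le_of_card_le hle (by simp)
  have hcard : ∀ C, Nonempty ({a // f a = C} ≃ {b // g b = C}) := by
    intro C
    rw [← Fintype.card_eq, Fintype.card_subtype, Fintype.card_subtype, ← hcount, ← hcount, heq]
  have e : ∀ C, {a // f a = C} ≃ {b // g b = C} := fun C => (hcard C).some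
  exact ⟨Equiv.ofFiberEquiv e, fun i => Equiv.ofFiberEquiv_map e i⟩

lemma SphereHolAt.exists_coe {E : Type*} [NormedAddCommGroup E] [NormedSpace ℂ E] {f : E → OnePoint ℂ}
    {x : E} (hf : SphereHolAt f x) (h : f x ≠ OnePoint.infty) :
    ∃ φ : E → ℂ, HolAt φ x ∧ ∀ᶠ y in 𝓝 x, f y = ((φ y : ℂ) : OnePoint ℂ) := by
  rcases hf with h | ⟨φ, h1, h2⟩
  · exact h
  · have h0 : φ x ≠ 0 := fun h0 => h (by rw [h2.self_of_nhds, recip_eq_infty, h0])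
    refine ⟨fun y => (φ y)⁻¹, h1.inv h0, ?_⟩
    filter_upwards [h2, h1.continuousAt.eventually_ne h0] with y a b
    rw [a, recip, if_neg b]

variable {n : ℕ}

open Classical in
/-- If `λ_q` has locally the zeros `x i`, these are the zeros of `λ_q` modulo the lattice. -/
lemma exists_perm_of_local_zeros {q : Omega n} {c x : Fin (n + 1) → ℂ}
    (hsep : ∀ i j, x j - x i ∈ (tauPeriods q.2.2).lattice → c j = c i ∧ x j = x i)
    (hloc : ∀ i, ∃ h : ℂ → ℂ, HolAt h (x i) ∧ h (x i) ≠ 0 ∧ ∀ᶠ z in 𝓝 (x i),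
      superpotential q z = (((∏ j with c j = c i, (z - x j)) * h z : ℂ) : OnePoint ℂ)) :
    ∃ σ : Equiv.Perm (Fin (n + 1)), ∀ i, zerosV q.2.1 (σ i) - x i ∈ (tauPeriods q.2.2).lattice := by
  suffices ∃ σ : Equiv.Perm (Fin (n + 1)), ∀ i, (tauPeriods q.2.2).lattice.mkQ (zerosV q.2.1 (σ i)) =
      (tauPeriods q.2.2).lattice.mkQ (x i) by
    obtain ⟨σ, hσ⟩ := this
    exact ⟨σ, fun i => mkQ_eq_iff.1 (hσ i)⟩
  refine exists_perm_of_card_eq (f := fun i => (tauPeriods q.2.2).lattice.mkQ (x i))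
    (g := fun i => (tauPeriods q.2.2).lattice.mkQ (zerosV q.2.1 i)) fun i => ?_
  simp only [mkQ_eq_iff]
  obtain ⟨h, hh, hh0, hF⟩ := hloc i
  obtain ⟨g, hg, hg0, hgθ⟩ := exists_prod_theta1_eq_pow_mul q.2.2 (zerosV q.2.1) (x i)
  have hden : superDen q (x i) ≠ 0 := by
    intro h0
    have := hF.self_of_nhds
    rw [superpotential_eq, h0, sphereDiv_zero] at this
    exact absurd this (by simp)
  -- The factors of the cluster which do not vanish at `x i`; the rest give the exact order of the
  -- zero, to be compared with the order read off from the theta product.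
  set r : ℂ → ℂ := fun z => ∏ j with c j = c i,
    (if x j - x i ∈ (tauPeriods q.2.2).lattice then 1 else z - x j) with hr
  have hrd : Differentiable ℂ r := by
    intro z
    refine (HolAt.prod fun j _ => ?_).differentiableAt
    split_ifs
    · exact holAt_of_differentiable (differentiable_const _) z
    · exact holAt_of_differentiable (g := fun z => z - x j) (by fun_prop) z
  have hr0 : r (x i) ≠ 0 := by
    refine Finset.prod_ne_zero_iff.2 fun j _ => ?_
    split_ifs with hj
    · exact one_ne_zero
    · refine fun h0 => hj ?_
      rw [← neg_sub, h0]
      simp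
  have hprod : ∀ z, ∏ j with c j = c i, (z - x j) =
      (z - x i) ^ (Finset.univ.filter fun j => x j - x i ∈ (tauPeriods q.2.2).lattice).card * r z := by
    intro z
    have e : ∀ j, z - x j = (if x j - x i ∈ (tauPeriods q.2.2).lattice then z - x i else 1) *
        (if x j - x i ∈ (tauPeriods q.2.2).lattice then 1 else z - x j) := by
      intro j
      split_ifs with hj
      · rw [(hsep i j hj).2, mul_one]
      · rw [one_mul]
    rw [Finset.prod_congr rfl fun j _ => e j, Finset.prod_mul_distrib, Finset.prod_ite,
      Finset.prod_const, Finset.prod_const_one, mul_one, Finset.filter_filter]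
    congr 3
    ext j
    simp only [Finset.mem_filter, Finset.mem_univ, true_and, and_iff_right_iff_imp]
    exact fun hj => (hsep i j hj).1
  refine eq_of_pow_mul_eq (f := superNum q) (w := x i)
    (g := fun z => r z * h z * superDen q z)
    (h := fun z => Complex.exp (-(2 * Real.pi * Complex.I * q.1)) * g z)
    (((holAt_of_differentiable hrd _).mul hh).mul (holAt_of_differentiable (differentiable_superDen q) _))
    (mul_ne_zero (mul_ne_zero hr0 hh0) hden)
    (holAt_of_differentiable (hg.const_mul _) _) (mul_ne_zero (Complex.exp_ne_zero _) hg0) ?_ ?_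
  · filter_upwards [hF, (differentiable_superDen q).continuous.continuousAt.eventually_ne hden] with z a b
    rw [superpotential_eq, sphereDiv_of_ne b, OnePoint.coe_eq_coe, div_eq_iff b, hprod] at a
    rw [a]; ring
  · refine Eventually.of_forall fun z => ?_
    rw [superNum_eq, hgθ]; ring

/-! ### Congruent zeros give proportional superpotentials -/

/-- Shifting the zeros by lattice vectors creates an exponential whose dependence on `z` involves
only the sum of the shifts. Shifting the pole by that sum creates the same one, so the quotients
differ by a constant. -/
lemma exists_mul_of_congruent {ι : Type*} [Fintype ι] {τ : ℍ} {x y : ι → ℂ} (σ : Equiv.Perm ι)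
    (h : ∀ i, y (σ i) - x i ∈ (tauPeriods τ).lattice) : ∃ C : ℂ, C ≠ 0 ∧ ∀ z,
      (∏ i, theta1 (z - y i) τ) * theta1 (z - ∑ i, x i) τ =
        C * ((∏ i, theta1 (z - x i) τ) * theta1 (z - ∑ i, y i) τ) := by
  choose m k hmk using fun i => mem_tauLattice.1 (h i)
  have hy : ∀ i, y (σ i) = x i + (m i + k i * (τ : ℂ)) := fun i => by rw [← hmk]; ring
  have hθ : ∀ (a : ℂ) (m k : ℤ) (z : ℂ), theta1 (z - (a + (m + k * (τ : ℂ)))) τ =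
      thetaFactor τ (-m) (-k) (z - a) * theta1 (z - a) τ := by
    intro a m k z
    rw [← theta1_add_lattice]
    congr 1
    push_cast
    ring
  have hsum : ∑ i, y i = ∑ i, x i + ((∑ i, m i : ℤ) + (∑ i, k i : ℤ) * (τ : ℂ)) := by
    rw [← Equiv.sum_comp σ]
    simp only [hy, Finset.sum_add_distrib, Finset.sum_mul, Int.cast_sum]
  refine ⟨Complex.exp (∑ i, (Real.pi * Complex.I * (-m i - k i) - Real.pi * Complex.I * k i ^ 2 * τ -
      2 * Real.pi * Complex.I * k i * x i) - (Real.pi * Complex.I * (-(∑ i, m i : ℤ) - (∑ i, k i : ℤ)) -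
      Real.pi * Complex.I * (∑ i, k i : ℤ) ^ 2 * τ - 2 * Real.pi * Complex.I * (∑ i, k i : ℤ) * ∑ i, x i)),
    Complex.exp_ne_zero _, fun z => ?_⟩
  rw [hsum, hθ, ← Equiv.prod_comp σ]
  simp only [hy, hθ, Finset.prod_mul_distrib]
  simp only [thetaFactor, ← Complex.exp_sum]
  have e : ∀ i, (Real.pi * Complex.I * (((-m i : ℤ) : ℂ) + ((-k i : ℤ) : ℂ)) -
      Real.pi * Complex.I * ((-k i : ℤ) : ℂ) ^ 2 * (τ : ℂ) -
      2 * Real.pi * Complex.I * ((-k i : ℤ) : ℂ) * (z - x i) : ℂ) =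
      (Real.pi * Complex.I * (-m i - k i) - Real.pi * Complex.I * k i ^ 2 * τ -
      2 * Real.pi * Complex.I * k i * x i) + 2 * Real.pi * Complex.I * z * k i := by
    intro i; push_cast; ring
  simp only [e, Finset.sum_add_distrib, ← Finset.mul_sum]
  set S := ∑ i, (Real.pi * Complex.I * (-m i - k i) - Real.pi * Complex.I * k i ^ 2 * τ -
      2 * Real.pi * Complex.I * k i * x i) with hS
  have key : Complex.exp (S + 2 * Real.pi * Complex.I * z * ∑ i, (k i : ℂ)) =
      Complex.exp (S - (Real.pi * Complex.I * (-(∑ i, m i : ℤ) - (∑ i, k i : ℤ)) -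
      Real.pi * Complex.I * (∑ i, k i : ℤ) ^ 2 * τ - 2 * Real.pi * Complex.I * (∑ i, k i : ℤ) * ∑ i, x i)) *
      Complex.exp (Real.pi * Complex.I * (((-∑ i, m i : ℤ) : ℂ) + ((-∑ i, k i : ℤ) : ℂ)) -
        Real.pi * Complex.I * ((-∑ i, k i : ℤ) : ℂ) ^ 2 * (τ : ℂ) -
        2 * Real.pi * Complex.I * ((-∑ i, k i : ℤ) : ℂ) * (z - ∑ i, x i)) := by
    rw [← Complex.exp_add]
    congr 1
    push_cast
    ring
  rw [key]
  ring

/-- Two points with congruent zeros whose superpotentials agree at one regular value have the same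
superpotential. -/
lemma superpotential_eq_of_congruent (hn : 1 ≤ n) {p q : Omega n} (hp : p ∈ regularLocus n)
    (hτ : q.2.2 = p.2.2) (σ : Equiv.Perm (Fin (n + 1)))
    (h : ∀ i, zerosV q.2.1 (σ i) - zerosV p.2.1 i ∈ (tauPeriods p.2.2).lattice) {w v : ℂ} (hv : v ≠ 0)
    (hpv : superpotential p w = ((v : ℂ) : OnePoint ℂ)) (hqv : superpotential q w = ((v : ℂ) : OnePoint ℂ)) :
    q ∈ regularLocus n ∧ ∀ z, superpotential q z = superpotential p z := by
  have hp' := mem_regularLocus.1 hp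
  have hκ : poleV q.2.1 - poleV p.2.1 ∈ (tauPeriods p.2.2).lattice := by
    rw [← sum_zerosV, ← sum_zerosV, ← Equiv.sum_comp σ, ← Finset.sum_sub_distrib]
    exact sum_mem fun i _ => h i
  have hq : q ∈ regularLocus n := by
    rw [mem_regularLocus, hτ]
    refine ⟨fun hc => hp'.1 (by simpa using sub_mem hc hκ), fun i => ?_⟩
    have hi := h (σ.symm i)
    rw [Equiv.apply_symm_apply] at hi
    refine ⟨fun hc => (hp'.2 (σ.symm i)).1 (by simpa using sub_mem hc hi), fun hc => (hp'.2 (σ.symm i)).2 ?_⟩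
    have := add_mem (sub_mem hc hi) hκ
    convert this using 1
    ring
  refine ⟨hq, fun z => ?_⟩
  obtain ⟨C, hC, hCθ⟩ := exists_mul_of_congruent σ h
  simp only [sum_zerosV] at hCθ
  obtain ⟨D, hD⟩ : ∃ D : ℂ, ∀ z, superNum q z * superDen p z = D * (superNum p z * superDen q z) := by
    refine ⟨Complex.exp (-(2 * Real.pi * Complex.I * q.1)) * C * (Complex.exp (-(2 * Real.pi * Complex.I * p.1)))⁻¹,
      fun z => ?_⟩
    rw [superNum_eq, superNum_eq p, superDen_eq, superDen_eq, hτ]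
    have := hCθ z
    field_simp [Complex.exp_ne_zero]
    linear_combination theta1 z p.2.2 ^ n * this
  have hne : ∀ r : Omega n, superpotential r w = ((v : ℂ) : OnePoint ℂ) → superDen r w ≠ 0 ∧
      superNum r w = v * superDen r w := by
    intro r hr
    have hd : superDen r w ≠ 0 := by
      intro h0
      rw [superpotential_eq, h0, sphereDiv_zero] at hr
      exact absurd hr (by simp)
    rw [superpotential_eq, sphereDiv_of_ne hd, OnePoint.coe_eq_coe, div_eq_iff hd] at hr
    exact ⟨hd, hr⟩
  obtain ⟨d1, n1⟩ := hne p hpv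
  obtain ⟨d2, n2⟩ := hne q hqv
  -- The ratio of the two superpotentials is the constant `D`; the common finite nonzero value at
  -- `w` forces it to be `1`.
  have hD1 : D = 1 := by
    have := hD w
    rw [n1, n2] at this
    have h3 : v * superDen q w * superDen p w ≠ 0 := mul_ne_zero (mul_ne_zero hv d2) d1
    apply mul_right_cancel₀ h3
    linear_combination -this
  rw [superpotential_eq_superpotential_iff hn hq hp, hD, hD1, one_mul]

end

section

variable {n : ℕ} {E : Type*} [NormedAddCommGroup E] [NormedSpace ℂ E]

/-! ### Following the zeros in a family -/

open Classical in
-- Zeros congruent at `e₀` share a centre, and each distinct centre is treated by `exists_roots`.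
-- Only one zero per index is followed, in a neighbourhood of its centre, and power sums over all
-- indices are sums over the clusters.
lemma exists_zero_roots (hn : 1 ≤ n) {F : E × ℂ → OnePoint ℂ} {e₀ : E} {p₀ : Omega n}
    (hp₀ : p₀ ∈ regularLocus n) (hF : ∀ z, SphereHolAt F (e₀, z))
    (hF0 : ∀ z, F (e₀, z) = superpotential p₀ z) {c : Fin (n + 1) → ℂ}
    (hc : ∀ i, zerosV p₀.2.1 i - c i ∈ (tauPeriods p₀.2.2).lattice)
    (hcc : ∀ i j, c j - c i ∈ (tauPeriods p₀.2.2).lattice → c j = c i) :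
    ∃ x : E → Fin (n + 1) → ℂ, Tendsto x (𝓝 e₀) (𝓝 c) ∧
      HolAt (fun e => powerSums (n + 1) (x e)) e₀ ∧
      ∀ᶠ e in 𝓝 e₀, ∀ i, ∃ h : ℂ → ℂ, HolAt h (x e i) ∧ h (x e i) ≠ 0 ∧ ∀ᶠ z in 𝓝 (x e i),
        F (e, z) = (((∏ j with c j = c i, (z - x e j)) * h z : ℂ) : OnePoint ℂ) := by
  have hden : ∀ i, superDen p₀ (c i) ≠ 0 := by
    intro i h0
    have hp' := (mem_regularLocus.1 hp₀).2 i
    rcases (superDen_eq_zero_iff hn).1 h0 with h | h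
    · exact hp'.1 (by simpa using add_mem (hc i) h)
    · exact hp'.2 (by simpa using add_mem (hc i) h)
  have hcluster : ∀ a : Set.range c, ∃ x : E → {i // Set.rangeFactorization c i = a} → ℂ,
      Tendsto x (𝓝 e₀) (𝓝 fun _ => (a : ℂ)) ∧ (∀ k : ℕ, HolAt (fun e => ∑ i, x e i ^ k) e₀) ∧
      ∀ᶠ e in 𝓝 e₀, ∀ w, (∃ i, x e i = w) → ∃ h : ℂ → ℂ, HolAt h w ∧ h w ≠ 0 ∧
        ∀ᶠ z in 𝓝 w, F (e, z) = (((∏ j, (z - x e j)) * h z : ℂ) : OnePoint ℂ) := by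
    rintro ⟨a, i₀, rfl⟩
    have hfin : F (e₀, c i₀) ≠ OnePoint.infty := by
      rw [hF0, superpotential_eq, Ne, sphereDiv_eq_infty]
      exact hden i₀
    obtain ⟨φ, hφ, hFφ⟩ := (hF (c i₀)).exists_coe hfin
    obtain ⟨g, hg, hg0, hgθ⟩ := exists_prod_theta1_eq_pow_mul p₀.2.2 (zerosV p₀.2.1) (c i₀)
    -- The order of vanishing at a centre is the number of indices assigned to it.
    have hcard : (Finset.univ.filter fun i => zerosV p₀.2.1 i - c i₀ ∈ (tauPeriods p₀.2.2).lattice).card =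
        Fintype.card {i // Set.rangeFactorization c i = ⟨c i₀, i₀, rfl⟩} := by
      rw [Fintype.card_subtype]
      congr 1
      ext i
      have hiff : Set.rangeFactorization c i = ⟨c i₀, i₀, rfl⟩ ↔ c i = c i₀ := Subtype.ext_iff
      simp only [Finset.mem_filter, Finset.mem_univ, true_and, hiff]
      constructor
      · exact fun h => hcc i₀ i (by simpa using sub_mem h (hc i))
      · exact fun h => by rw [← h]; exact hc i
    rw [hcard] at hgθ
    obtain ⟨x, hx, hps, r, hr, hroots⟩ := exists_roots (ι := {i // Set.rangeFactorization c i = ⟨c i₀, i₀, rfl⟩})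
      (g := fun z => Complex.exp (-(2 * Real.pi * Complex.I * p₀.1)) * g z / superDen p₀ z) hφ
      ((holAt_of_differentiable (hg.const_mul _) (c i₀)).div
        (holAt_of_differentiable (differentiable_superDen p₀) (c i₀)) (hden i₀))
      (div_ne_zero (mul_ne_zero (Complex.exp_ne_zero _) hg0) (hden i₀)) (by
        have h1 : ∀ᶠ z in 𝓝 (c i₀), F (e₀, z) = ((φ (e₀, z) : ℂ) : OnePoint ℂ) :=
          (Continuous.tendsto (by fun_prop : Continuous fun z : ℂ => (e₀, z)) (c i₀)).eventually hFφ
        filter_upwards [h1, (differentiable_superDen p₀).continuous.continuousAt.eventually_ne (hden i₀)]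
          with z a b
        rw [hF0, superpotential_eq, sphereDiv_of_ne b, OnePoint.coe_eq_coe] at a
        rw [← a, superNum_eq, hgθ]
        ring)
    refine ⟨x, hx, hps, ?_⟩
    obtain ⟨U, hU, V, hV, hUV⟩ := mem_nhds_prod_iff.1 hFφ
    obtain ⟨s, hs, hsV⟩ := Metric.mem_nhds_iff.1 hV
    set t := min r s with ht
    have ht0 : 0 < t := lt_min hr hs
    have hxt : ∀ᶠ e in 𝓝 e₀, ∀ i, x e i ∈ Metric.ball (c i₀) t := by
      rw [eventually_all]
      exact fun i => (tendsto_pi_nhds.1 hx i).eventually (Metric.ball_mem_nhds _ ht0)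
    filter_upwards [hxt, hroots, hU] with e h1 h2 h3
    obtain ⟨h, hh, hh0, hφh⟩ := h2
    rintro w ⟨i, rfl⟩
    have hwr : x e i ∈ Metric.closedBall (c i₀) r :=
      Metric.ball_subset_closedBall (Metric.ball_subset_ball (min_le_left _ _) (h1 i))
    refine ⟨h, holAt_iff_analyticAt.2 (hh _ hwr), hh0 _ hwr, ?_⟩
    filter_upwards [Metric.isOpen_ball.mem_nhds (h1 i)] with z hz
    rw [← hφh]
    exact hUV (mk_mem_prod h3 (hsV (Metric.ball_subset_ball (min_le_right _ _) hz)))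
  choose X hX hXps hXloc using hcluster
  refine ⟨fun e i => X (Set.rangeFactorization c i) e ⟨i, rfl⟩, ?_, ?_, ?_⟩
  · rw [tendsto_pi_nhds]
    exact fun i => tendsto_pi_nhds.1 (hX (Set.rangeFactorization c i)) ⟨i, rfl⟩
  · refine holAt_pi fun j => ?_
    have : (fun e => powerSums (n + 1) (fun i => X (Set.rangeFactorization c i) e ⟨i, rfl⟩) j) =
        fun e => ∑ a : Set.range c, ∑ i, X a e i ^ (j.1 + 1) := by
      ext e
      unfold powerSums
      rw [← Fintype.sum_fiberwise (Set.rangeFactorization c)]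
      refine Finset.sum_congr rfl fun a _ => Finset.sum_congr rfl fun i _ => ?_
      obtain ⟨i, rfl⟩ := i
      rfl
    rw [this]
    exact HolAt.sum fun a _ => hXps a _
  · have hall : ∀ᶠ e in 𝓝 e₀, ∀ a, ∀ w, (∃ i, X a e i = w) → ∃ h : ℂ → ℂ, HolAt h w ∧ h w ≠ 0 ∧
        ∀ᶠ z in 𝓝 w, F (e, z) = (((∏ j, (z - X a e j)) * h z : ℂ) : OnePoint ℂ) :=
      eventually_all.2 hXloc
    filter_upwards [hall] with e he i
    obtain ⟨h, h1, h2, h3⟩ := he (Set.rangeFactorization c i) _ ⟨⟨i, rfl⟩, rfl⟩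
    refine ⟨h, h1, h2, h3.mono fun z hz => ?_⟩
    rw [hz]
    congr 2
    rw [← Finset.prod_subtype_eq_prod_filter, Finset.subtype_univ]
    refine Fintype.prod_equiv (Equiv.subtypeEquivRight fun j => by
      simp [Set.rangeFactorization, Subtype.ext_iff]) _ _ ?_
    rintro ⟨j, hj⟩
    simp only [Equiv.subtypeEquivRight_apply_coe]
    congr 1
    have : ∀ (a : Set.range c) (hj : Set.rangeFactorization c j = a),
        X a e ⟨j, hj⟩ = X (Set.rangeFactorization c j) e ⟨j, rfl⟩ := by
      rintro a rfl; rfl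
    exact this _ hj

/-! ### Coordinates on `Ω` -/

/-- The point of `Ω` with the given coordinates. -/
def toOmega (x : ℂ × V n × ℂ) : Omega n := (x.1, x.2.1, UpperHalfPlane.ofComplex x.2.2)

/-- The coordinates of a point of `Ω`. -/
def omegaCoord (p : Omega n) : ℂ × V n × ℂ := (p.1, p.2.1, (p.2.2 : ℂ))

@[simp] lemma toOmega_omegaCoord (p : Omega n) : toOmega (omegaCoord p) = p := by
  simp [toOmega, omegaCoord]

lemma coe_toOmega {x : ℂ × V n × ℂ} (h : 0 < x.2.2.im) : ((toOmega x).2.2 : ℂ) = x.2.2 := by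
  simp [toOmega, UpperHalfPlane.ofComplex_apply_of_im_pos h]

lemma continuous_omegaCoord : Continuous (omegaCoord (n := n)) := by
  unfold omegaCoord
  fun_prop

lemma continuousAt_toOmega {x : ℂ × V n × ℂ} (h : 0 < x.2.2.im) : ContinuousAt (toOmega (n := n)) x := by
  have h2 : ContinuousAt (fun x : ℂ × V n × ℂ => (UpperHalfPlane.ofComplex x.2.2 : ℍ)) x := by
    rw [ContinuousAt, tendsto_coe_upperHalfPlane]
    have h1 : ContinuousAt (fun x : ℂ × V n × ℂ => x.2.2) x := by fun_prop
    have hev : ∀ᶠ y : ℂ × V n × ℂ in 𝓝 x, 0 < y.2.2.im :=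
      (Complex.continuous_im.continuousAt.comp h1).eventually (lt_mem_nhds h)
    rw [UpperHalfPlane.ofComplex_apply_of_im_pos h]
    exact h1.tendsto.congr' (hev.mono fun y hy => by
      simp only [UpperHalfPlane.ofComplex_apply_of_im_pos hy])
  exact ContinuousAt.prodMk (by fun_prop) (ContinuousAt.prodMk (by fun_prop) h2)

lemma differentiable_ofZeros : Differentiable ℂ (ofZeros (n := n)) := by
  have h : IsLinearMap ℂ (ofZeros (n := n)) := by
    refine ⟨fun x y => eq_of_zerosV_eq ?_, fun a x => eq_of_zerosV_eq ?_⟩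
    · ext i
      rw [zerosV_ofZeros]
      have : ∀ v w : V n, zerosV (v + w) i = zerosV v i + zerosV w i := fun v w => by
        simp [zerosV]; ring
      rw [this, zerosV_ofZeros, zerosV_ofZeros]
      rfl
    · ext i
      rw [zerosV_ofZeros]
      have : ∀ v : V n, zerosV (a • v) i = a * zerosV v i := fun v => by
        simp [zerosV]; ring
      rw [this, zerosV_ofZeros]
      rfl
  exact (LinearMap.toContinuousLinearMap (IsLinearMap.mk' _ h)).differentiable

lemma holAt_theta1 {z τ : ℂ} (hτ : 0 < τ.im) : HolAt (fun p : ℂ × ℂ => theta1 p.1 p.2) (z, τ) := by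
  have h : ∀ᶠ p : ℂ × ℂ in 𝓝 (z, τ), 0 < p.2.im :=
    (by fun_prop : Continuous fun p : ℂ × ℂ => p.2.im).continuousAt.eventually (lt_mem_nhds hτ)
  exact h.mono fun p hp => differentiableAt_theta1 p.1 hp

lemma HolAt.theta1 {z τ : E → ℂ} {e : E} (hz : HolAt z e) (hτ : HolAt τ e) (h : 0 < (τ e).im) :
    HolAt (fun y => theta1 (z y) (τ y)) e :=
  HolAt.comp' (g := fun p : ℂ × ℂ => JacobiHurwitz.theta1 p.1 p.2) (f := fun y => (z y, τ y)) (x := e)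
    (holAt_theta1 h) (hz.prodMk hτ)

end

/-! ### Lifting a family of superpotentials to `Ω`. -/

section

variable {n : ℕ}

lemma exists_regular_value (hn : 1 ≤ n) {p : Omega n} (hp : p ∈ regularLocus n) :
    ∃ w, superNum p w ≠ 0 ∧ superDen p w ≠ 0 := by
  by_contra! hcon
  have hN0 : superNum p 0 ≠ 0 := by
    refine (superNum_ne_zero_or hn hp 0).resolve_right (not_not.2 ?_)
    rw [superDen_eq_zero_iff hn]
    exact Or.inl (zero_mem _)
  have hz : ∀ z, superDen p z = 0 := eq_of_mul_eq_mul (g := fun _ => 0) (differentiable_superDen p)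
    (differentiable_const _) (differentiable_superNum p) hN0 fun z => by
      by_cases h : superNum p z = 0
      · rw [h, zero_mul, zero_mul]
      · rw [hcon z h, mul_zero]
  have := superNum_eq_zero_iff.2 ⟨0, (sub_self (zerosV p.2.1 0)).symm ▸ zero_mem (tauPeriods p.2.2).lattice⟩
  exact (superNum_ne_zero_or hn hp _).elim (fun h => h this) fun h => h (hz _)

/-- Representatives of the zeros modulo the lattice. -/
lemma exists_cluster_centers (p : Omega n) : ∃ c : Fin (n + 1) → ℂ,
    (∀ i, zerosV p.2.1 i - c i ∈ (tauPeriods p.2.2).lattice) ∧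
    ∀ i j, c j - c i ∈ (tauPeriods p.2.2).lattice → c j = c i := by
  -- One representative for each class, so that congruent zeros get literally the same centre.
  choose s hs using Submodule.mkQ_surjective (tauPeriods p.2.2).lattice
  refine ⟨fun i => s ((tauPeriods p.2.2).lattice.mkQ (zerosV p.2.1 i)), fun i => ?_, fun i j h => ?_⟩
  · rw [← mkQ_eq_iff, hs]
  · rw [← mkQ_eq_iff, hs, hs] at h
    simp only [h]

variable {E : Type*} [NormedAddCommGroup E] [NormedSpace ℂ E]

/-- A family of superpotentials lifts, up to the order of the zeros, to a holomorphic family of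
points of `Ω`. -/
theorem exists_lift (hn : 1 ≤ n) {F : E × ℂ → OnePoint ℂ} {τ : E → ℂ} {e₀ : E} {p₀ : Omega n}
    (hp₀ : p₀ ∈ regularLocus n) (hτ : HolAt τ e₀) (hτ0 : τ e₀ = p₀.2.2)
    (hF : ∀ z, SphereHolAt F (e₀, z)) (hF0 : ∀ z, F (e₀, z) = superpotential p₀ z)
    (hq : ∀ᶠ e in 𝓝 e₀, ∃ q ∈ regularLocus n, (q.2.2 : ℂ) = τ e ∧ ∀ z, F (e, z) = superpotential q z) :
    ∃ (c : Fin (n + 1) → ℂ) (P : (Fin (n + 1) → ℂ) × E → ℂ × V n × ℂ) (x : E → Fin (n + 1) → ℂ),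
      HolAt P (c, e₀) ∧ P (c, e₀) = omegaCoord p₀ ∧ Tendsto x (𝓝 e₀) (𝓝 c) ∧
      HolAt (fun e => powerSums (n + 1) (x e)) e₀ ∧
      (∀ w : Equiv.Perm (Fin (n + 1)), c ∘ w = c → ∀ᶠ y in 𝓝 (c, e₀),
        (toOmega (P (y.1 ∘ w, y.2))).2.2 = (toOmega (P y)).2.2 ∧
        ∀ z, superpotential (toOmega (P (y.1 ∘ w, y.2))) z = superpotential (toOmega (P y)) z) ∧
      ∀ᶠ e in 𝓝 e₀, ((toOmega (P (x e, e))).2.2 : ℂ) = τ e ∧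
        ∀ z, superpotential (toOmega (P (x e, e))) z = F (e, z) := by
  obtain ⟨c, hc, hcc⟩ := exists_cluster_centers p₀
  choose m k hmk using fun i => mem_tauLattice.1 (hc i)
  obtain ⟨x, hx, hxps, hxloc⟩ := exists_zero_roots hn hp₀ hF hF0 hc hcc
  -- The zeros determine λ only up to a constant; its finite nonzero value at `w₀` will fix `u`.
  obtain ⟨w₀, hw₀N, hw₀D⟩ := exists_regular_value hn hp₀
  have hfin : F (e₀, w₀) ≠ OnePoint.infty := by
    rwa [hF0, superpotential_eq, Ne, sphereDiv_eq_infty]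
  obtain ⟨φ, hφ, hFφ⟩ := (hF w₀).exists_coe hfin
  -- the value at `w₀`
  have hsl : Continuous fun e : E => (e, w₀) := by fun_prop
  set φ₀ : E → ℂ := fun e => φ (e, w₀) with hφ₀
  have hφ₀hol : HolAt φ₀ e₀ := HolAt.comp' (g := φ) (f := fun e : E => (e, w₀)) (x := e₀) hφ
    (holAt_of_differentiable (by fun_prop) _)
  have hFφ₀ : ∀ᶠ e in 𝓝 e₀, F (e, w₀) = ((φ₀ e : ℂ) : OnePoint ℂ) := (hsl.tendsto e₀).eventually hFφ
  have hφ₀val : superNum p₀ w₀ = φ₀ e₀ * superDen p₀ w₀ := by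
    have := hFφ₀.self_of_nhds
    rw [hF0, superpotential_eq, sphereDiv_of_ne hw₀D, OnePoint.coe_eq_coe, div_eq_iff hw₀D] at this
    exact this
  have hφ₀ne : φ₀ e₀ ≠ 0 := by
    intro h
    rw [h, zero_mul] at hφ₀val
    exact hw₀N hφ₀val
  -- the zeros
  set Y : (Fin (n + 1) → ℂ) × E → Fin (n + 1) → ℂ := fun y i => y.1 i + (m i + k i * τ y.2) with hY
  have hτ' : HolAt (fun y : (Fin (n + 1) → ℂ) × E => τ y.2) (c, e₀) :=
    HolAt.comp' (g := τ) (f := fun y : (Fin (n + 1) → ℂ) × E => y.2) (x := (c, e₀)) hτ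
      (holAt_of_differentiable differentiable_snd _)
  have hφ' : HolAt (fun y : (Fin (n + 1) → ℂ) × E => φ₀ y.2) (c, e₀) :=
    HolAt.comp' (g := φ₀) (f := fun y : (Fin (n + 1) → ℂ) × E => y.2) (x := (c, e₀)) hφ₀hol
      (holAt_of_differentiable differentiable_snd _)
  have hconst : ∀ v : ℂ, HolAt (fun _ : (Fin (n + 1) → ℂ) × E => v) (c, e₀) := fun v =>
    holAt_of_differentiable (differentiable_const v) _
  have hYi : ∀ i, HolAt (fun y => Y y i) (c, e₀) := fun i =>
    (holAt_of_differentiable (g := fun y : (Fin (n + 1) → ℂ) × E => y.1 i) (by fun_prop) _).add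
      ((hconst _).add ((hconst _).mul hτ'))
  have hYhol : HolAt Y (c, e₀) := holAt_pi hYi
  have hY0 : Y (c, e₀) = zerosV p₀.2.1 := by
    ext i
    simp only [hY, hτ0, ← hmk]
    ring
  have him0 : 0 < (τ e₀).im := by rw [hτ0]; exact p₀.2.2.im_pos
  set N : (Fin (n + 1) → ℂ) × E → ℂ := fun y => ∏ i, theta1 (w₀ - Y y i) (τ y.2) with hN
  set D : (Fin (n + 1) → ℂ) × E → ℂ := fun y =>
    theta1 w₀ (τ y.2) ^ n * theta1 (w₀ - ∑ i, Y y i) (τ y.2) with hD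
  have hNhol : HolAt N (c, e₀) := HolAt.prod fun i _ => ((hconst w₀).sub (hYi i)).theta1 hτ' him0
  have hDhol : HolAt D (c, e₀) := (((hconst w₀).theta1 hτ' him0).pow n).mul
    (((hconst w₀).sub (HolAt.sum fun i _ => hYi i)).theta1 hτ' him0)
  set v₀ : ℂ := Complex.exp (-(2 * Real.pi * Complex.I * p₀.1)) with hv₀
  have hv₀ne : v₀ ≠ 0 := Complex.exp_ne_zero _
  have hN0 : v₀ * N (c, e₀) = superNum p₀ w₀ := by
    rw [superNum_eq]
    simp only [hN, hY0, hτ0, hv₀]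
  have hD0 : D (c, e₀) = superDen p₀ w₀ := by
    rw [superDen_eq]
    simp only [hD, hY0, hτ0, sum_zerosV]
  have hNne : N (c, e₀) ≠ 0 := fun h => hw₀N (by rw [← hN0, h, mul_zero])
  have hDne : D (c, e₀) ≠ 0 := by rwa [hD0]
  -- The factor by which `e^{-2πiu}` must change to give the value `φ₀` at `w₀`. It equals `1` at
  -- the base point, so its principal logarithm is holomorphic nearby.
  set R : (Fin (n + 1) → ℂ) × E → ℂ := fun y => φ₀ y.2 * D y / (N y * v₀) with hR
  have hRhol : HolAt R (c, e₀) := (hφ'.mul hDhol).div (hNhol.mul (hconst v₀)) (mul_ne_zero hNne hv₀ne)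
  have hR0 : R (c, e₀) = 1 := by
    simp only [hR]
    rw [div_eq_one_iff_eq (mul_ne_zero hNne hv₀ne), hD0, ← hφ₀val, ← hN0, mul_comm]
  have hlog : HolAt (fun y => Complex.log (R y)) (c, e₀) := by
    have h1 : ∀ᶠ y in 𝓝 (c, e₀), R y ∈ Complex.slitPlane :=
      hRhol.continuousAt.eventually (Complex.isOpen_slitPlane.mem_nhds (by
        rw [hR0]; exact Complex.one_mem_slitPlane))
    filter_upwards [h1, hRhol] with y a b
    exact b.clog a
  set P : (Fin (n + 1) → ℂ) × E → ℂ × V n × ℂ := fun y =>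
    (p₀.1 - Complex.log (R y) / (2 * Real.pi * Complex.I), ofZeros (Y y), τ y.2) with hP
  have hPhol : HolAt P (c, e₀) := by
    refine HolAt.prodMk ?_ (HolAt.prodMk ?_ hτ')
    · exact (hconst _).sub (hlog.div (hconst _) Complex.two_pi_I_ne_zero)
    · exact HolAt.comp' (g := ofZeros) (f := Y) (x := (c, e₀))
        (holAt_of_differentiable differentiable_ofZeros _) hYhol
  have hP0 : P (c, e₀) = omegaCoord p₀ := by
    simp only [hP, hR0, Complex.log_one, zero_div, sub_zero, hY0, ofZeros_zerosV, hτ0]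
    rfl
  -- the normalisation
  have hnorm : ∀ᶠ y in 𝓝 (c, e₀), ((toOmega (P y)).2.2 : ℂ) = τ y.2 ∧ φ₀ y.2 ≠ 0 ∧
      superpotential (toOmega (P y)) w₀ = ((φ₀ y.2 : ℂ) : OnePoint ℂ) := by
    have h1 : ∀ᶠ y : (Fin (n + 1) → ℂ) × E in 𝓝 (c, e₀), 0 < (τ y.2).im :=
      (Complex.continuous_im.continuousAt.comp hτ'.continuousAt).eventually (lt_mem_nhds him0)
    filter_upwards [h1, hNhol.continuousAt.eventually_ne hNne, hDhol.continuousAt.eventually_ne hDne,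
      hφ'.continuousAt.eventually_ne hφ₀ne] with y a b d f
    have hTy : ((toOmega (P y)).2.2 : ℂ) = τ y.2 := coe_toOmega a
    have hzy : zerosV (toOmega (P y)).2.1 = Y y := zerosV_ofZeros _
    have hpy : poleV (toOmega (P y)).2.1 = ∑ i, Y y i := poleV_ofZeros _
    have huy : (toOmega (P y)).1 = p₀.1 - Complex.log (R y) / (2 * Real.pi * Complex.I) := rfl
    have hdy : superDen (toOmega (P y)) w₀ = D y := by rw [superDen_eq, hpy, hTy]
    have hexp : Complex.exp (-(2 * Real.pi * Complex.I * (toOmega (P y)).1)) = v₀ * R y := by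
      have hRy : R y ≠ 0 := div_ne_zero (mul_ne_zero f d) (mul_ne_zero b hv₀ne)
      rw [huy, ← Complex.exp_log hRy, hv₀, ← Complex.exp_add, Complex.exp_log hRy]
      congr 1
      have := Complex.two_pi_I_ne_zero
      field_simp
      ring
    refine ⟨hTy, f, ?_⟩
    rw [superpotential_eq, hdy, sphereDiv_of_ne d, OnePoint.coe_eq_coe, div_eq_iff d, superNum_eq, hexp,
      hzy, hTy]
    change v₀ * (φ₀ y.2 * D y / (N y * v₀)) * N y = _
    field_simp
  have hreg : ∀ᶠ y in 𝓝 (c, e₀), toOmega (P y) ∈ regularLocus n := by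
    have him : 0 < (P (c, e₀)).2.2.im := him0
    have h1 : ContinuousAt (fun y => toOmega (P y)) (c, e₀) :=
      ContinuousAt.comp (g := toOmega) (continuousAt_toOmega him) hPhol.continuousAt
    refine h1.eventually (isOpen_regularLocus.mem_nhds ?_)
    change toOmega (P (c, e₀)) ∈ _
    rw [hP0, toOmega_omegaCoord]
    exact hp₀
  refine ⟨c, P, x, hPhol, hP0, hx, hxps, fun w hw => ?_, ?_⟩
  · have hperm : Tendsto (fun y : (Fin (n + 1) → ℂ) × E => (y.1 ∘ w, y.2)) (𝓝 (c, e₀)) (𝓝 (c, e₀)) := by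
      have : Continuous fun y : (Fin (n + 1) → ℂ) × E => (y.1 ∘ w, y.2) :=
        (continuous_pi fun i => by
          simp only [Function.comp]
          fun_prop).prodMk continuous_snd
      have h := this.tendsto (c, e₀)
      simpa only [hw] using h
    filter_upwards [hnorm, hperm.eventually hnorm, hreg] with y h1 h2 h3
    have hτeq : (toOmega (P (y.1 ∘ w, y.2))).2.2 = (toOmega (P y)).2.2 :=
      UpperHalfPlane.ext (by rw [h1.1, h2.1])
    -- A permutation fixing `c` mixes only indices with the same centre as parameters. The zeros
    -- change by lattice vectors, and the value at `w₀` is normalised, so the superpotential is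
    -- unchanged.
    refine ⟨hτeq, (superpotential_eq_of_congruent hn h3 hτeq w⁻¹ (fun i => ?_) h1.2.1 h1.2.2 h2.2.2).2⟩
    have e1 : zerosV (toOmega (P (y.1 ∘ w, y.2))).2.1 = Y (y.1 ∘ w, y.2) := zerosV_ofZeros _
    have e2 : zerosV (toOmega (P y)).2.1 = Y y := zerosV_ofZeros _
    have e3 : w (w⁻¹ i) = i := w.apply_symm_apply i
    rw [e1, e2, mem_tauLattice, h1.1]
    refine ⟨m (w⁻¹ i) - m i, k (w⁻¹ i) - k i, ?_⟩
    simp only [hY, Function.comp, e3]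
    push_cast
    ring
  · have hxe : Tendsto (fun e => (x e, e)) (𝓝 e₀) (𝓝 (c, e₀)) := hx.prodMk_nhds tendsto_id
    set T : E → ℍ := fun e => UpperHalfPlane.ofComplex (τ e) with hT
    have hTτ : ∀ᶠ e in 𝓝 e₀, (T e : ℂ) = τ e := by
      have := (Complex.continuous_im.continuousAt.comp hτ.continuousAt).eventually (lt_mem_nhds him0)
      filter_upwards [this] with e he
      simp only [hT]
      rw [UpperHalfPlane.ofComplex_apply_of_im_pos he]
    have hTlim : Tendsto T (𝓝 e₀) (𝓝 p₀.2.2) := by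
      rw [tendsto_coe_upperHalfPlane, ← hτ0]
      exact hτ.continuousAt.tendsto.congr' (hTτ.mono fun e he => he.symm)
    have hxi := fun i => tendsto_pi_nhds.1 hx i
    have hsep : ∀ᶠ e in 𝓝 e₀, ∀ i j, x e j - x e i ∈ (tauPeriods (T e)).lattice →
        c j = c i ∧ x e j = x e i := by
      rw [eventually_all]
      intro i
      rw [eventually_all]
      intro j
      by_cases hij : c j = c i
      · have hlim : Tendsto (fun e => x e j - x e i) (𝓝 e₀) (𝓝 0) := by
          have := (hxi j).sub (hxi i)
          rwa [hij, sub_self] at this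
        filter_upwards [eventually_eq_zero_of_mem_lattice hlim hTlim] with e he hmem
        exact ⟨hij, sub_eq_zero.1 (he hmem)⟩
      · filter_upwards [eventually_notMem_lattice ((hxi j).sub (hxi i)) hTlim fun h => hij (hcc i j h)]
          with e he hmem
        exact absurd hmem he
    filter_upwards [hq, hxloc, hTτ, hsep, hxe.eventually hnorm, hFφ₀] with e h1 h2 h3 h4 h5 h6
    obtain ⟨q, hqreg, hqτ, hqF⟩ := h1
    have hqT : q.2.2 = T e := UpperHalfPlane.ext (by rw [hqτ, h3])
    rw [← hqT] at h4
    -- The roots followed in the family are all the zeros of `λ_q` modulo the lattice. Together with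
    -- the value at `w₀` this identifies `λ_q` with the superpotential of the lift.
    obtain ⟨σ, hσ⟩ := exists_perm_of_local_zeros h4 fun i => by
      obtain ⟨h, a1, a2, a3⟩ := h2 i
      refine ⟨h, a1, a2, a3.mono fun z hz => ?_⟩
      rw [← hqF]
      convert hz
    have hτeq : (toOmega (P (x e, e))).2.2 = q.2.2 := UpperHalfPlane.ext (by rw [h5.1, hqτ])
    refine ⟨h5.1, fun z => ?_⟩
    rw [hqF]
    refine (superpotential_eq_of_congruent hn hqreg hτeq σ⁻¹ (fun i => ?_) h5.2.1 ?_ h5.2.2).2 z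
    · have e1 : zerosV (toOmega (P (x e, e))).2.1 = Y (x e, e) := zerosV_ofZeros _
      have e3 : σ (σ⁻¹ i) = i := σ.apply_symm_apply i
      have hσi := hσ (σ⁻¹ i)
      rw [e3] at hσi
      rw [e1]
      have hω : (m (σ⁻¹ i) : ℂ) + k (σ⁻¹ i) * τ e ∈ (tauPeriods q.2.2).lattice :=
        mem_tauLattice.2 ⟨_, _, by rw [hqτ]⟩
      convert sub_mem hω hσi using 1
      simp only [hY]
      ring
    · rw [← hqF]
      exact h6

end

section

variable {n : ℕ}

/-! ### The Jacobi group acts by homeomorphisms -/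

lemma Continuous.form {X : Type*} [TopologicalSpace X] {f g : X → V n} (hf : Continuous f)
    (hg : Continuous g) : Continuous fun x => form (f x) (g x) := by
  have h : ∀ (f : X → V n), Continuous f → ∀ i, Continuous fun x => (f x).1.1 i := fun f hf i =>
    (continuous_apply i).comp (continuous_subtype_val.comp (continuous_fst.comp hf))
  unfold JacobiHurwitz.form
  exact (continuous_finsetSum _ fun i _ => (h f hf i).mul (h g hg i)).sub
    (continuous_const.mul ((continuous_snd.comp hf).mul (continuous_snd.comp hg)))

lemma continuous_permV (w : Equiv.Perm (Fin (n + 1))) : Continuous (permV (n := n) w) := by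
  refine Continuous.prodMk (Continuous.subtype_mk (continuous_pi fun i => ?_) _) continuous_snd
  exact (continuous_apply (w.symm i)).comp (continuous_subtype_val.comp continuous_fst)

lemma continuous_weylAct (w : Equiv.Perm (Fin (n + 1))) : Continuous (weylAct (n := n) w) :=
  continuous_fst.prodMk (((continuous_permV w).comp continuous_snd.fst).prodMk continuous_snd.snd)

lemma continuous_translationAct (l m : L n) (k : ℤ) :
    Continuous (translationAct l m k) ∧ Continuous (translationAct l m k).symm := by
  have hτ : Continuous fun p : Omega n => (p.2.2 : ℂ) := by fun_prop
  have hv : Continuous fun p : Omega n => p.2.1 := by fun_prop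
  have hinv : Continuous fun p : Omega n => p.2.1 - (p.2.2 : ℂ) • l.1 - m.1 := by fun_prop
  constructor
  · refine Continuous.prodMk ?_ (by fun_prop)
    exact ((continuous_fst.sub (Continuous.form continuous_const hv)).sub
      ((continuous_const.mul hτ).div_const _)).add continuous_const
  · refine Continuous.prodMk ?_ (hinv.prodMk continuous_snd.snd)
    exact ((continuous_fst.add (Continuous.form continuous_const hinv)).add
      ((continuous_const.mul hτ).div_const _)).sub continuous_const

lemma continuous_cocyc (γ : SL(2, ℤ)) : Continuous (cocyc γ) := by
  unfold cocyc
  fun_prop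

lemma continuous_smul_upperHalfPlane (γ : SL(2, ℤ)) : Continuous fun τ : ℍ => γ • τ := by
  rw [UpperHalfPlane.isOpenEmbedding_coe.isInducing.continuous_iff]
  have : (fun τ : ℍ => ((γ • τ : ℍ) : ℂ)) = fun τ : ℍ =>
      (((γ 0 0 : ℤ) : ℂ) * τ + ((γ 0 1 : ℤ) : ℂ)) / cocyc γ τ := by
    ext τ
    rw [eq_div_iff (cocyc_ne_zero γ τ), coe_smul_mul_cocyc]
  change Continuous fun τ : ℍ => ((γ • τ : ℍ) : ℂ)
  rw [this]
  exact Continuous.div (by fun_prop) (continuous_cocyc γ) fun τ => cocyc_ne_zero γ τ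

lemma continuous_modularAct (γ : SL(2, ℤ)) :
    Continuous (modularAct (n := n) γ) ∧ Continuous (modularAct (n := n) γ).symm := by
  have hv : Continuous fun p : Omega n => p.2.1 := by fun_prop
  have hc : Continuous fun p : Omega n => cocyc γ p.2.2 := (continuous_cocyc γ).comp (by fun_prop)
  have hτ : Continuous fun p : Omega n => γ⁻¹ • p.2.2 :=
    (continuous_smul_upperHalfPlane γ⁻¹).comp continuous_snd.snd
  have hc' : Continuous fun p : Omega n => cocyc γ (γ⁻¹ • p.2.2) := (continuous_cocyc γ).comp hτ
  have hv' : Continuous fun p : Omega n => cocyc γ (γ⁻¹ • p.2.2) • p.2.1 := hc'.smul hv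
  constructor
  · refine Continuous.prodMk ?_ (Continuous.prodMk ?_
      ((continuous_smul_upperHalfPlane γ).comp continuous_snd.snd))
    · exact continuous_fst.add ((continuous_const.mul (Continuous.form hv hv)).div (continuous_const.mul hc)
        fun p => mul_ne_zero two_ne_zero (cocyc_ne_zero _ _))
    · exact (hc.inv₀ fun p => cocyc_ne_zero _ _).smul hv
  · refine Continuous.prodMk ?_ (hv'.prodMk hτ)
    exact continuous_fst.sub ((continuous_const.mul (Continuous.form hv' hv')).div (continuous_const.mul hc')
      fun p => mul_ne_zero two_ne_zero (cocyc_ne_zero _ _))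

lemma continuous_of_mem_jacobiGroup {g : Equiv.Perm (Omega n)} (hg : g ∈ jacobiGroup n) :
    Continuous g := by
  suffices Continuous g ∧ Continuous (g⁻¹ : Equiv.Perm (Omega n)) from this.1
  unfold jacobiGroup at hg
  induction hg using Subgroup.closure_induction with
  | mem g hg =>
    rcases hg with (hg | hg) | hg
    · obtain ⟨w, hw⟩ := hg
      rw [← hw]
      exact ⟨continuous_weylAct w, continuous_weylAct w.symm⟩
    · obtain ⟨l, m, k, hw⟩ := hg
      rw [hw]
      exact continuous_translationAct l m k
    · obtain ⟨γ, hw⟩ := hg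
      rw [← hw]
      exact continuous_modularAct γ
  | one => exact ⟨continuous_id, continuous_id⟩
  | mul g h _ _ hg hh =>
    refine ⟨hg.1.comp hh.1, ?_⟩
    rw [mul_inv_rev]
    exact hh.2.comp hg.2
  | inv g _ hg => exact ⟨hg.2, by rw [inv_inv]; exact hg.1⟩

lemma continuous_orbitSpace_mk : Continuous (OrbitSpace.mk (n := n)) :=
  continuous_quotient_mk' (s := MulAction.orbitRel (jacobiGroup n) (Omega n))

lemma isOpen_orbitSpace {U : Set (OrbitSpace n)} : IsOpen U ↔ IsOpen (OrbitSpace.mk ⁻¹' U) :=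
  (isQuotientMap_quotient_mk' (s := MulAction.orbitRel (jacobiGroup n) (Omega n))).isOpen_preimage.symm

lemma orbitSpace_mk_eq_iff {p q : Omega n} : OrbitSpace.mk p = OrbitSpace.mk q ↔
    ∃ g ∈ jacobiGroup n, g q = p := by
  constructor
  · intro h
    obtain ⟨g, hg⟩ := Quotient.exact (s := MulAction.orbitRel (jacobiGroup n) (Omega n)) h
    exact ⟨g.1, g.2, hg⟩
  · rintro ⟨g, hg, rfl⟩
    exact orbitSpace_mk_eq hg q

/-- The saturation of an open set is a union of its preimages under homeomorphisms of the group. -/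
lemma isOpenMap_orbitSpace_mk : IsOpenMap (OrbitSpace.mk (n := n)) := by
  intro U hU
  rw [isOpen_orbitSpace]
  have : OrbitSpace.mk ⁻¹' (OrbitSpace.mk '' U) = ⋃ g : jacobiGroup n, (g : Equiv.Perm (Omega n)) ⁻¹' U := by
    ext p
    simp only [mem_preimage, mem_image, mem_iUnion, orbitSpace_mk_eq_iff]
    constructor
    · rintro ⟨q, hq, g, hg, rfl⟩
      exact ⟨⟨g, hg⟩, hq⟩
    · rintro ⟨⟨g, hg⟩, hp⟩
      exact ⟨g p, hp, g, hg, rfl⟩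
  rw [this]
  exact isOpen_iUnion fun g => hU.preimage (continuous_of_mem_jacobiGroup g.2)

/-! ### The map to the Hurwitz space -/

/-- Supplies the default pair used off the regular locus. With all `vᵢ = 0` and `vₙ₊₁ = τ/(n+2)`,
the relevant differences are, up to sign, `jτ/(n+2)` with `0 < j < n + 2`. -/
lemma exists_mem_regularLocus (n : ℕ) (hn : 1 ≤ n) : ∃ p : Omega n, p ∈ regularLocus n := by
  set τ : ℍ := UpperHalfPlane.I with hτ
  have hn2 : (n : ℂ) + 2 ≠ 0 := by exact_mod_cast (by omega : n + 2 ≠ 0)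
  have key : ∀ j : ℕ, 0 < j → j < n + 2 → (j : ℂ) * ((τ : ℂ) / (n + 2)) ∉ (tauPeriods τ).lattice := by
    intro j h1 h2 h
    obtain ⟨m, k, hmk⟩ := mem_tauLattice.1 h
    have h3 : (j : ℂ) * τ = (m * (n + 2) : ℤ) + ((k * (n + 2) : ℤ) : ℂ) * τ := by
      push_cast
      rw [mul_div_assoc', div_eq_iff hn2] at hmk
      rw [hmk]; ring
    have h4 := congrArg Complex.im h3
    have h5 : (j : ℝ) = ((k * (n + 2) : ℤ) : ℝ) := by
      simp only [Complex.add_im, Complex.intCast_im, zero_add, Complex.mul_im, Complex.natCast_re,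
        Complex.natCast_im, zero_mul, add_zero, Complex.intCast_re, UpperHalfPlane.coe_im] at h4
      exact mul_right_cancel₀ τ.im_pos.ne' h4
    have h6 : (j : ℤ) = k * (n + 2) := by exact_mod_cast h5
    have hk : 0 < k := by
      by_contra hk
      have : k * ((n : ℤ) + 2) ≤ 0 := mul_nonpos_of_nonpos_of_nonneg (by omega) (by positivity)
      omega
    have : (n : ℤ) + 2 ≤ k * (n + 2) := le_mul_of_one_le_left (by positivity) hk
    omega
  refine ⟨(0, (0, (τ : ℂ) / (n + 2)), τ), ?_, fun i => ⟨?_, ?_⟩⟩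
  · have := key (n + 1) (by omega) (by omega)
    push_cast at this
    exact this
  · have := key 1 one_pos (by omega)
    rw [Nat.cast_one, one_mul] at this
    change (0 : ℂ) - _ ∉ _
    rwa [zero_sub, neg_mem_iff]
  · have := key n (by omega) (by omega)
    change (0 : ℂ) + _ ∉ _
    rwa [zero_add]

instance nonempty_orbitSpace : Nonempty (OrbitSpace n) := ⟨OrbitSpace.mk (0, 0, UpperHalfPlane.I)⟩

lemma superPair_mk_eq (hn : 1 ≤ n) {p q : Omega n} (hp : p ∈ regularLocus n) (hq : q ∈ regularLocus n)
    (hτ : p.2.2 = q.2.2) (h : ∀ z, superpotential p z = superpotential q z) :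
    HurwitzSpace.mk (superPair hn hp) = HurwitzSpace.mk (superPair hn hq) := by
  refine HurwitzSpace.mk_eq_iff.2 (hurwitzEquivalent_iff.2 ⟨1, 0, one_ne_zero, fun z => ?_, fun z => ?_⟩)
  · change z ∈ (tauPeriods p.2.2).lattice ↔ 1 * z ∈ (tauPeriods q.2.2).lattice
    rw [one_mul, hτ]
  · change superpotential q (1 * z + 0) = superpotential p z
    rw [one_mul, add_zero, h]

open Classical in
/-- The class of `λ_p` for a regular point `p`, and a fixed class otherwise. -/
def superClass (hn : 1 ≤ n) (p : Omega n) : HurwitzSpace n :=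
  if hp : p ∈ regularLocus n then HurwitzSpace.mk (superPair hn hp)
  else HurwitzSpace.mk (superPair hn (exists_mem_regularLocus n hn).choose_spec)

/-- The map `[(u, v, τ)] ↦ [(ℂ / (ℤ + τ ℤ), λ)]`. -/
def orbitMap (hn : 1 ≤ n) : OrbitSpace n → HurwitzSpace n :=
  Quotient.lift (s := MulAction.orbitRel (jacobiGroup n) (Omega n)) (superClass hn) (by
    rintro p q ⟨g, rfl⟩
    have hg := superEquiv_of_mem_jacobiGroup hn g.2 q
    change superClass hn (g.1 q) = superClass hn q
    by_cases hq : q ∈ regularLocus n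
    · rw [superClass, superClass, dif_pos hq, dif_pos (hg.1.1 hq)]
      exact (HurwitzSpace.mk_eq_iff.2 (hurwitzEquivalent_of_superEquiv hn hq (hg.1.1 hq) hg)).symm
    · rw [superClass, superClass, dif_neg hq, dif_neg fun h => hq (hg.1.2 h)])

lemma orbitMap_mk (hn : 1 ≤ n) {p : Omega n} (hp : p ∈ regularLocus n) :
    orbitMap hn (OrbitSpace.mk p) = HurwitzSpace.mk (superPair hn hp) := dif_pos hp

lemma mem_regularLocus_of_mk_mem (hn : 1 ≤ n) {p : Omega n}
    (h : OrbitSpace.mk p ∈ OrbitSpace.mk '' regularLocus n) : p ∈ regularLocus n := by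
  obtain ⟨q, hq, hqp⟩ := h
  obtain ⟨g, hg, rfl⟩ := orbitSpace_mk_eq_iff.1 hqp
  exact (superEquiv_of_mem_jacobiGroup hn hg p).1.2 hq

/-! ### The regular locus as a holomorphic family -/

lemma holAt_superNum_superDen {x : ℂ × V n × ℂ} (hx : 0 < x.2.2.im) (z : ℂ) :
    HolAt (fun y : (ℂ × V n × ℂ) × ℂ => superNum (toOmega y.1) y.2) (x, z) ∧
      HolAt (fun y : (ℂ × V n × ℂ) × ℂ => superDen (toOmega y.1) y.2) (x, z) := by
  have hcoord : ∀ i, Differentiable ℂ fun y : (ℂ × V n × ℂ) × ℂ => y.1.2.1.1.1 i := by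
    intro i
    have : IsLinearMap ℂ fun y : (ℂ × V n × ℂ) × ℂ => y.1.2.1.1.1 i := ⟨fun _ _ => rfl, fun _ _ => rfl⟩
    exact (LinearMap.toContinuousLinearMap (IsLinearMap.mk' _ this)).differentiable
  have hlast : Differentiable ℂ fun y : (ℂ × V n × ℂ) × ℂ => y.1.2.1.2 := by fun_prop
  have hz : HolAt (fun y : (ℂ × V n × ℂ) × ℂ => y.2) (x, z) := holAt_of_differentiable (by fun_prop) _
  have hτ : HolAt (fun y : (ℂ × V n × ℂ) × ℂ => y.1.2.2) (x, z) :=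
    holAt_of_differentiable (by fun_prop) _
  have hpos : ∀ᶠ y : (ℂ × V n × ℂ) × ℂ in 𝓝 (x, z), ((toOmega y.1).2.2 : ℂ) = y.1.2.2 := by
    have : Continuous fun y : (ℂ × V n × ℂ) × ℂ => y.1.2.2.im := by fun_prop
    filter_upwards [(this.tendsto (x, z)).eventually (lt_mem_nhds hx)] with y hy
    exact coe_toOmega hy
  constructor
  · have hu : Differentiable ℂ fun y : (ℂ × V n × ℂ) × ℂ =>
        Complex.exp (-(2 * Real.pi * Complex.I * y.1.1)) := by fun_prop
    have h1 : HolAt (fun y : (ℂ × V n × ℂ) × ℂ => Complex.exp (-(2 * Real.pi * Complex.I * y.1.1)) *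
        ∏ i, theta1 (y.2 - y.1.2.1.1.1 i + y.1.2.1.2) y.1.2.2) (x, z) :=
      (holAt_of_differentiable hu _).mul (HolAt.prod fun i _ =>
        ((hz.sub (holAt_of_differentiable (hcoord i) _)).add (holAt_of_differentiable hlast _)).theta1 hτ hx)
    refine h1.congr (hpos.mono fun y hy => ?_)
    simp only [superNum, hy]
    rfl
  · have h1 : HolAt (fun y : (ℂ × V n × ℂ) × ℂ => theta1 y.2 y.1.2.2 ^ n *
        theta1 (y.2 + ((n : ℂ) + 1) * y.1.2.1.2) y.1.2.2) (x, z) :=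
      ((hz.theta1 hτ hx).pow n).mul ((hz.add (holAt_of_differentiable
        (g := fun y : (ℂ × V n × ℂ) × ℂ => ((n : ℂ) + 1) * y.1.2.1.2) (by fun_prop) _)).theta1 hτ hx)
    refine h1.congr (hpos.mono fun y hy => ?_)
    simp only [superDen, hy]
    rfl

/-- Linear coordinates on `ℂ ⊕ V ⊕ ℂ`. -/
def linearCoord (n : ℕ) : (Fin (Module.finrank ℂ (ℂ × V n × ℂ)) → ℂ) ≃L[ℂ] ℂ × V n × ℂ :=
  ContinuousLinearEquiv.ofFinrankEq (by simp)

lemma isOpen_regular_coord : IsOpen {x : ℂ × V n × ℂ | 0 < x.2.2.im ∧ toOmega x ∈ regularLocus n} := by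
  rw [isOpen_iff_mem_nhds]
  rintro x ⟨h1, h2⟩
  have : Continuous fun x : ℂ × V n × ℂ => x.2.2.im := by fun_prop
  exact ((this.tendsto x).eventually (lt_mem_nhds h1)).and
    ((continuousAt_toOmega h1).eventually (isOpen_regularLocus.mem_nhds h2))

open Classical in
/-- The universal family over the regular locus. -/
def regularFamily (hn : 1 ≤ n) : HurwitzFamily n (Module.finrank ℂ (ℂ × V n × ℂ)) where
  base := linearCoord n ⁻¹' {x | 0 < x.2.2.im ∧ toOmega x ∈ regularLocus n}
  isOpen_base := isOpen_regular_coord.preimage (linearCoord n).continuous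
  member b := if hb : toOmega (linearCoord n b) ∈ regularLocus n then superPair hn hb
    else superPair hn (exists_mem_regularLocus n hn).choose_spec
  hol_period₁ := by
    refine (differentiableOn_const (c := (1 : ℂ))).congr fun b hb => ?_
    rw [dif_pos hb.2]
    rfl
  hol_period₂ := by
    have : Differentiable ℂ fun b => (linearCoord n b).2.2 :=
      differentiable_snd.snd.comp (linearCoord n).differentiable
    refine this.differentiableOn.congr fun b hb => ?_
    rw [dif_pos hb.2]
    exact coe_toOmega hb.1
  hol_fn := by
    intro b hb z
    have hopen := (isOpen_regular_coord (n := n)).preimage (linearCoord n).continuous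
    have hd : Differentiable ℂ fun y : (Fin (Module.finrank ℂ (ℂ × V n × ℂ)) → ℂ) × ℂ =>
        (linearCoord n y.1, y.2) :=
      ((linearCoord n).differentiable.comp differentiable_fst).prodMk differentiable_snd
    have h1 : SphereHolAt (fun y : (ℂ × V n × ℂ) × ℂ => superpotential (toOmega y.1) y.2)
        (linearCoord n b, z) :=
      sphereHolAt_sphereDiv (holAt_superNum_superDen hb.1 z).1 (holAt_superNum_superDen hb.1 z).2
        (superNum_ne_zero_or hn hb.2 z)
    have h2 := SphereHolAt.comp' (x := (b, z)) h1 (holAt_of_differentiable hd (b, z))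
    have h3 : ∀ᶠ y : (Fin (Module.finrank ℂ (ℂ × V n × ℂ)) → ℂ) × ℂ in 𝓝 (b, z),
        toOmega (linearCoord n y.1) ∈ regularLocus n := by
      filter_upwards [(hopen.preimage continuous_fst).mem_nhds (show (b, z) ∈ _ from hb)] with y hy
      exact hy.2
    have h4 : ∀ᶠ y : (Fin (Module.finrank ℂ (ℂ × V n × ℂ)) → ℂ) × ℂ in 𝓝 (b, z),
        (if hb : toOmega (linearCoord n y.1) ∈ regularLocus n then superPair hn hb
          else superPair hn (exists_mem_regularLocus n hn).choose_spec).fn y.2 =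
        superpotential (toOmega (linearCoord n y.1)) y.2 := by
      filter_upwards [h3] with y hy
      rw [dif_pos hy]
      rfl
    rcases h2 with ⟨g, h5, h6⟩ | ⟨g, h5, h6⟩
    · exact Or.inl ⟨g, h5, by filter_upwards [h4, h6] with y a b; rw [a]; exact b⟩
    · exact Or.inr ⟨g, h5, by filter_upwards [h4, h6] with y a b; rw [a]; exact b⟩

lemma regularFamily_mk (hn : 1 ≤ n) {x : ℂ × V n × ℂ} (hx : toOmega x ∈ regularLocus n) :
    HurwitzSpace.mk ((regularFamily hn).member ((linearCoord n).symm x)) =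
      orbitMap hn (OrbitSpace.mk (toOmega x)) := by
  rw [orbitMap_mk hn hx]
  have : toOmega (linearCoord n ((linearCoord n).symm x)) ∈ regularLocus n := by simpa using hx
  refine (congrArg HurwitzSpace.mk (dif_pos this)).trans ?_
  exact superPair_mk_eq hn _ _ (by simp) fun z => by simp

/-- The map to the Hurwitz space is continuous on the regular locus. -/
lemma isOpen_regular_preimage (hn : 1 ≤ n) {U : Set (HurwitzSpace n)} (hU : IsOpen U) :
    IsOpen {p : Omega n | p ∈ regularLocus n ∧ orbitMap hn (OrbitSpace.mk p) ∈ U} := by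
  have h := hU _ (regularFamily hn)
  have hc : Continuous fun p : Omega n => (linearCoord n).symm (omegaCoord p) :=
    (linearCoord n).symm.continuous.comp continuous_omegaCoord
  convert h.preimage hc using 1
  ext p
  have hb : (linearCoord n).symm (omegaCoord p) ∈ (regularFamily hn).base ↔ p ∈ regularLocus n := by
    change 0 < (linearCoord n ((linearCoord n).symm (omegaCoord p))).2.2.im ∧
      toOmega (linearCoord n ((linearCoord n).symm (omegaCoord p))) ∈ regularLocus n ↔ _
    rw [ContinuousLinearEquiv.apply_symm_apply, toOmega_omegaCoord, and_iff_right_iff_imp]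
    exact fun _ => p.2.2.im_pos
  change _ ↔ _ ∧ _
  rw [hb]
  refine and_congr_right fun hp => ?_
  have := regularFamily_mk hn (x := omegaCoord p) (by simpa using hp)
  rw [toOmega_omegaCoord] at this
  rw [this]

end

section

variable {n k : ℕ}

/-! ### Lifting families of pairs to `Ω` -/

/-- The classifying map of a family lifts locally, up to the order of the zeros. -/
theorem exists_lift_family (hn : 1 ≤ n) (A : HurwitzFamily n k) {b₀ : Fin k → ℂ} (hb₀ : b₀ ∈ A.base)
    {p₀ : Omega n} (hp₀ : p₀ ∈ regularLocus n)
    (h : HurwitzSpace.mk (A.member b₀) = orbitMap hn (OrbitSpace.mk p₀)) :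
    ∃ (c : Fin (n + 1) → ℂ) (P : (Fin (n + 1) → ℂ) × (Fin k → ℂ) → ℂ × V n × ℂ)
      (x : (Fin k → ℂ) → Fin (n + 1) → ℂ),
      HolAt P (c, b₀) ∧ P (c, b₀) = omegaCoord p₀ ∧ Tendsto x (𝓝 b₀) (𝓝 c) ∧
      HolAt (fun b => powerSums (n + 1) (x b)) b₀ ∧
      (∀ᶠ y in 𝓝 (c, b₀), toOmega (P y) ∈ regularLocus n) ∧
      (∀ w : Equiv.Perm (Fin (n + 1)), c ∘ w = c → ∀ᶠ y in 𝓝 (c, b₀),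
        orbitMap hn (OrbitSpace.mk (toOmega (P (y.1 ∘ w, y.2)))) =
          orbitMap hn (OrbitSpace.mk (toOmega (P y)))) ∧
      ∀ᶠ b in 𝓝 b₀, orbitMap hn (OrbitSpace.mk (toOmega (P (x b, b)))) = HurwitzSpace.mk (A.member b) := by
  rw [orbitMap_mk hn hp₀, eq_comm, HurwitzSpace.mk_eq_iff] at h
  obtain ⟨τ, F, hτ, hτ0, hF, hF0, hq⟩ := exists_normalized_family hn A hb₀ hp₀ h
  obtain ⟨c, P, x, hP, hP0, hx, hps, hsym, hlift⟩ := exists_lift hn hp₀ hτ hτ0 hF hF0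
    (hq.mono fun b ⟨q, h1, h2, h3, _⟩ => ⟨q, h1, h2, h3⟩)
  have hreg : ∀ᶠ y in 𝓝 (c, b₀), toOmega (P y) ∈ regularLocus n := by
    have him : 0 < (P (c, b₀)).2.2.im := by rw [hP0]; exact p₀.2.2.im_pos
    have h1 : ContinuousAt (fun y => toOmega (P y)) (c, b₀) :=
      ContinuousAt.comp (g := toOmega) (continuousAt_toOmega him) hP.continuousAt
    refine h1.eventually (isOpen_regularLocus.mem_nhds ?_)
    change toOmega (P (c, b₀)) ∈ _
    rw [hP0, toOmega_omegaCoord]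
    exact hp₀
  refine ⟨c, P, x, hP, hP0, hx, hps, hreg, fun w hw => ?_, ?_⟩
  · have hperm : Tendsto (fun y : (Fin (n + 1) → ℂ) × (Fin k → ℂ) => (y.1 ∘ w, y.2)) (𝓝 (c, b₀))
        (𝓝 (c, b₀)) := by
      have : Continuous fun y : (Fin (n + 1) → ℂ) × (Fin k → ℂ) => (y.1 ∘ w, y.2) :=
        (continuous_pi fun i => by
          simp only [Function.comp]
          fun_prop).prodMk continuous_snd
      have h := this.tendsto (c, b₀)
      simpa only [hw] using h
    filter_upwards [hsym w hw, hreg, hperm.eventually hreg] with y h1 h2 h3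
    rw [orbitMap_mk hn h2, orbitMap_mk hn h3]
    exact superPair_mk_eq hn h3 h2 h1.1 h1.2
  · have hxe : Tendsto (fun b => (x b, b)) (𝓝 b₀) (𝓝 (c, b₀)) := hx.prodMk_nhds tendsto_id
    filter_upwards [hq, hlift, hxe.eventually hreg] with b h1 h2 h3
    obtain ⟨q, hqr, hqτ, hqF, hqA⟩ := h1
    rw [orbitMap_mk hn h3, ← HurwitzSpace.mk_eq_iff.2 hqA]
    exact superPair_mk_eq hn h3 hqr (UpperHalfPlane.ext (by rw [h2.1, hqτ])) fun z => by rw [h2.2, hqF]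

/-- The map to the Hurwitz space is open on the regular locus. -/
theorem isOpen_image_orbitMap (hn : 1 ≤ n) {W : Set (OrbitSpace n)} (hW : IsOpen W)
    (hWr : W ⊆ OrbitSpace.mk '' regularLocus n) : IsOpen (orbitMap hn '' W) := by
  intro k A
  rw [isOpen_iff_mem_nhds]
  rintro b₀ ⟨hb₀, o, ho, hob⟩
  obtain ⟨p₀, hp₀, rfl⟩ := hWr ho
  -- Near `b₀` the lifted points lie in the preimage of the open set `W`; convergence of the zeros
  -- suffices here.
  obtain ⟨c, P, x, hP, hP0, hx, -, hreg, -, hlift⟩ := exists_lift_family hn A hb₀ hp₀ hob.symm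
  have hxe : Tendsto (fun b => (x b, b)) (𝓝 b₀) (𝓝 (c, b₀)) := hx.prodMk_nhds tendsto_id
  have hWe : ∀ᶠ y in 𝓝 (c, b₀), OrbitSpace.mk (toOmega (P y)) ∈ W := by
    have him : 0 < (P (c, b₀)).2.2.im := by rw [hP0]; exact p₀.2.2.im_pos
    have h1 : ContinuousAt (fun y => toOmega (P y)) (c, b₀) :=
      ContinuousAt.comp (g := toOmega) (continuousAt_toOmega him) hP.continuousAt
    refine h1.eventually ((hW.preimage continuous_orbitSpace_mk).mem_nhds ?_)
    change OrbitSpace.mk (toOmega (P (c, b₀))) ∈ W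
    rw [hP0, toOmega_omegaCoord]
    exact ho
  filter_upwards [A.isOpen_base.mem_nhds hb₀, hlift, hxe.eventually hWe] with b h1 h2 h3
  exact ⟨h1, _, h3, h2⟩

/-- A function on the Hurwitz space with holomorphic pull-back to `Ω` is holomorphic along families. -/
theorem differentiableAt_of_holAt_pullback (hn : 1 ≤ n) (A : HurwitzFamily n k) {b₀ : Fin k → ℂ}
    (hb₀ : b₀ ∈ A.base) {p₀ : Omega n} (hp₀ : p₀ ∈ regularLocus n)
    (h : HurwitzSpace.mk (A.member b₀) = orbitMap hn (OrbitSpace.mk p₀)) {g : HurwitzSpace n → ℂ}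
    (hg : HolAt (fun x => g (orbitMap hn (OrbitSpace.mk (toOmega x)))) (omegaCoord p₀)) :
    DifferentiableAt ℂ (fun b => g (HurwitzSpace.mk (A.member b))) b₀ := by
  obtain ⟨c, P, x, hP, hP0, hx, hps, -, hsym, hlift⟩ := exists_lift_family hn A hb₀ hp₀ h
  rw [← hP0] at hg
  -- The pull-back is symmetric inside clusters, so it factors holomorphically through the power
  -- sums, which depend holomorphically on `b` although the zeros need not.
  obtain ⟨G, hG, hfG⟩ := exists_eq_comp_powerSums (n + 1)
    (fun y => g (orbitMap hn (OrbitSpace.mk (toOmega (P y))))) c b₀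
    (HolAt.comp' (f := P) (x := (c, b₀)) hg hP) fun w hw => (hsym w hw).mono fun y hy => by rw [hy]
  have hxe : Tendsto (fun b => (x b, b)) (𝓝 b₀) (𝓝 (c, b₀)) := hx.prodMk_nhds tendsto_id
  have hps0 : powerSums (n + 1) (x b₀) = powerSums (n + 1) c :=
    tendsto_nhds_unique hps.continuousAt.tendsto
      (((differentiable_powerSums (n + 1)).continuous.tendsto c).comp hx)
  have hcomp : HolAt (fun b => G (powerSums (n + 1) (x b), b)) b₀ :=
    HolAt.comp' (g := G) (f := fun b => (powerSums (n + 1) (x b), b)) (x := b₀) (by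
      rw [hps0]; exact hG) (hps.prodMk (holAt_of_differentiable differentiable_id b₀))
  refine (hcomp.congr ?_).differentiableAt
  filter_upwards [hlift, hxe.eventually hfG] with b h1 h2
  rw [← h1, ← h2]

/-- A holomorphic function on the Hurwitz space has a holomorphic pull-back to `Ω`. -/
theorem differentiableAt_pullback (hn : 1 ≤ n) {U : Set (HurwitzSpace n)} (hU : IsOpen U)
    {g : HurwitzSpace n → ℂ} (hg : HurwitzSpace.Holomorphic U g) {x : ℂ × V n × ℂ}
    (hx : 0 < x.2.2.im) (hxr : toOmega x ∈ regularLocus n)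
    (hxU : orbitMap hn (OrbitSpace.mk (toOmega x)) ∈ U) :
    DifferentiableAt ℂ (fun x => g (orbitMap hn (OrbitSpace.mk (toOmega x)))) x := by
  set b := (linearCoord n).symm x with hb
  have hmem : b ∈ (regularFamily hn).preimage U := by
    refine ⟨?_, ?_⟩
    · change 0 < (linearCoord n ((linearCoord n).symm x)).2.2.im ∧
        toOmega (linearCoord n ((linearCoord n).symm x)) ∈ regularLocus n
      rw [ContinuousLinearEquiv.apply_symm_apply]
      exact ⟨hx, hxr⟩
    · rw [hb, regularFamily_mk hn hxr]
      exact hxU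
  have h1 := (hg _ (regularFamily hn)).differentiableAt ((hU _ (regularFamily hn)).mem_nhds hmem)
  have h2 : DifferentiableAt ℂ (fun x => g (HurwitzSpace.mk
      ((regularFamily hn).member ((linearCoord n).symm x)))) x :=
    h1.comp x (linearCoord n).symm.differentiableAt
  refine h2.congr_of_eventuallyEq ?_
  filter_upwards [isOpen_regular_coord.mem_nhds ⟨hx, hxr⟩] with y hy
  rw [regularFamily_mk hn hy.2]

/-! ### The local biholomorphism -/

/-- Local injectivity comes from `eventually_mk_eq_of_equivalent`, continuity from the universal
family, and openness from lifting families. The two directions for holomorphic functions are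
`differentiableAt_pullback` and `differentiableAt_of_holAt_pullback`. -/
theorem isLocalBiholomorphismOn_orbitMap (hn : 1 ≤ n) :
    IsLocalBiholomorphismOn (orbitMap hn) (OrbitSpace.mk '' regularLocus n) := by
  rintro _ ⟨p₀, hp₀, rfl⟩
  obtain ⟨N₁, hN₁, hN₁'⟩ := mem_nhds_prod_iff.1 (eventually_mk_eq_of_equivalent hn hp₀)
  obtain ⟨N₂, hN₂, hN₁₂⟩ := hN₁'
  -- `N` is a single open set with `N × N` inside the neighbourhood where equivalent regular points
  -- share an orbit.
  obtain ⟨N, hNsub, hNo, hpN⟩ := mem_nhds_iff.1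
    (inter_mem (inter_mem hN₁ hN₂) (isOpen_regularLocus.mem_nhds hp₀))
  set S : Set (OrbitSpace n) := OrbitSpace.mk '' N with hS
  have hSo : IsOpen S := isOpenMap_orbitSpace_mk N hNo
  have hSr : S ⊆ OrbitSpace.mk '' regularLocus n := image_mono fun p hp => (hNsub hp).2
  have hinj : InjOn (orbitMap hn) S := by
    rintro _ ⟨p, hp, rfl⟩ _ ⟨q, hq, rfl⟩ hpq
    have hp' := hNsub hp
    have hq' := hNsub hq
    rw [orbitMap_mk hn hp'.2, orbitMap_mk hn hq'.2, HurwitzSpace.mk_eq_iff] at hpq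
    exact hN₁₂ (mk_mem_prod hp'.1.1 hq'.1.2) hp'.2 hq'.2 hpq
  have hcont : ContinuousOn (orbitMap hn) S := by
    rw [continuousOn_open_iff hSo]
    intro U hU
    have h1 := isOpenMap_orbitSpace_mk _ ((isOpen_regular_preimage hn hU).inter
      (hSo.preimage continuous_orbitSpace_mk))
    convert h1 using 1
    ext o
    constructor
    · rintro ⟨ho, hoU⟩
      obtain ⟨p, hp, rfl⟩ := hSr ho
      exact ⟨p, ⟨⟨hp, hoU⟩, ho⟩, rfl⟩
    · rintro ⟨p, ⟨⟨hp, hpU⟩, hpS⟩, rfl⟩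
      exact ⟨hpS, hpU⟩
  have hopen : IsOpenMap (S.domRestrict (orbitMap hn)) := by
    intro O hO
    obtain ⟨W, hW, rfl⟩ := isOpen_induced_iff.1 hO
    have h1 := isOpen_image_orbitMap hn (hSo.inter hW) fun o ho => hSr ho.1
    convert h1 using 1
    ext y
    constructor
    · rintro ⟨⟨o, ho⟩, hoW, rfl⟩
      exact ⟨o, ⟨ho, hoW⟩, rfl⟩
    · rintro ⟨o, ⟨ho, hoW⟩, rfl⟩
      exact ⟨⟨o, ho⟩, hoW, rfl⟩
  set e : OpenPartialHomeomorph (OrbitSpace n) (HurwitzSpace n) :=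
    OpenPartialHomeomorph.ofContinuousOpenRestrict (hinj.toPartialEquiv (orbitMap hn) S) hcont hopen hSo
    with he
  have hee : ∀ o, e o = orbitMap hn o := fun o => rfl
  have het : e.target = orbitMap hn '' S := rfl
  refine ⟨e, ⟨p₀, hpN, rfl⟩, hSr, fun o _ => (hee o).symm, fun U hU hUo g => ⟨fun hg => ?_, fun hg => ?_⟩⟩
  · rintro x ⟨hx, hxS, hxU⟩
    exact (differentiableAt_pullback hn hUo hg hx (mem_regularLocus_of_mk_mem hn (hSr hxS))
      hxU).differentiableWithinAt
  · rintro k A b₀ ⟨hb₀, hbU⟩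
    have hbt := hU hbU
    rw [het] at hbt
    obtain ⟨_, ⟨q, hq, rfl⟩, hqb⟩ := hbt
    have hqr := (hNsub hq).2
    refine (differentiableAt_of_holAt_pullback hn A hb₀ hqr hqb.symm ?_).differentiableWithinAt
    have hUo' : IsOpen (S ∩ orbitMap hn ⁻¹' U) := e.isOpen_inter_preimage hUo
    have hnhds : ∀ᶠ x in 𝓝 (omegaCoord q), 0 < x.2.2.im ∧ OrbitSpace.mk (toOmega x) ∈ S ∩ orbitMap hn ⁻¹' U := by
      have him : 0 < (omegaCoord q).2.2.im := q.2.2.im_pos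
      have hc : Continuous fun x : ℂ × V n × ℂ => x.2.2.im := by fun_prop
      refine ((hc.tendsto _).eventually (lt_mem_nhds him)).and ?_
      refine (continuousAt_toOmega him).eventually ((hUo'.preimage continuous_orbitSpace_mk).mem_nhds ?_)
      rw [toOmega_omegaCoord]
      refine ⟨⟨q, hq, rfl⟩, ?_⟩
      change orbitMap hn (OrbitSpace.mk q) ∈ U
      rw [hqb]
      exact hbU
    filter_upwards [eventually_eventually_nhds.2 hnhds] with x hx
    exact hg.differentiableAt hx

end

end JacobiHurwitz

end

/-! ### The main theorem. -/

theorem mainTheorem9 (n : ℕ) (hn : 1 ≤ n) :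
    (∀ g ∈ JacobiHurwitz.jacobiGroup n, ∀ p ∈ JacobiHurwitz.regularLocus n,
      g p ∈ JacobiHurwitz.regularLocus n) ∧
    ∃ (hreg : ∀ p ∈ JacobiHurwitz.regularLocus n,
        JacobiHurwitz.IsHurwitzFunction n (JacobiHurwitz.tauPeriods p.2.2)
          (JacobiHurwitz.superpotential p))
      (Φ : JacobiHurwitz.OrbitSpace n → JacobiHurwitz.HurwitzSpace n),
      (∀ (p : JacobiHurwitz.Omega n) (hp : p ∈ JacobiHurwitz.regularLocus n),
        Φ (JacobiHurwitz.OrbitSpace.mk p) =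
          JacobiHurwitz.HurwitzSpace.mk
            ⟨JacobiHurwitz.tauPeriods p.2.2, JacobiHurwitz.superpotential p, hreg p hp⟩) ∧
      Φ '' (JacobiHurwitz.OrbitSpace.mk '' JacobiHurwitz.regularLocus n) = Set.univ ∧
      JacobiHurwitz.IsLocalBiholomorphismOn Φ
        (JacobiHurwitz.OrbitSpace.mk '' JacobiHurwitz.regularLocus n) := by
  refine ⟨fun g hg p hp => (JacobiHurwitz.superEquiv_of_mem_jacobiGroup hn hg p).1.1 hp,
    fun p hp => JacobiHurwitz.isHurwitzFunction_superpotential hn hp, JacobiHurwitz.orbitMap hn,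
    fun p hp => JacobiHurwitz.orbitMap_mk hn hp, ?_,
    JacobiHurwitz.isLocalBiholomorphismOn_orbitMap hn⟩
  refine Set.eq_univ_of_forall fun x => ?_
  obtain ⟨A, rfl⟩ := Quotient.exists_rep x
  obtain ⟨p, hp, h⟩ := JacobiHurwitz.exists_hurwitzEquivalent_superPair hn A
  exact ⟨_, ⟨p, hp, rfl⟩, (JacobiHurwitz.orbitMap_mk hn hp).trans
    (JacobiHurwitz.HurwitzSpace.mk_eq_iff.2 h)⟩
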